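/- Let $X$ be a smooth complex variety with structure sheaf $\mathcal O_X$ (a complex manifold, or a smooth separated scheme of finite type over $\mathbb C$), and let $\mathcal F$ be a codimension one foliation on $X$: a coherent involutive subsheaf $T_{\mathcal F}\subset T_X$ with $T_X/T_{\mathcal F}$ torsion-free, whose conormal sheaf $N^*_{\mathcal F}=\{\omega\in\Omega^1_X : \omega|_{T_{\mathcal F}}=0\}$ has rank one. Put $E=N^*_{\mathcal F}$, with the Bott connection $\nabla_v(\omega)=\mathcal L_v\omega$ ($v\in T_{\mathcal F}$), a flat partial connection. Let $D\ge 0$ be a divisor on $X$. *First transverse jet.* Let $\mathcal D^1(E,\mathcal O_X)$ be the sheaf of differential operators $E\to\mathcal O_X$ of order $\le 1$, and let $S^1(\nabla)$ be its subsheaf generated by the operators $\varphi\circ\nabla_v$ with $\varphi\in E^*$, $v\in T_{\mathcal F}$. Then $\mathcal P^1(\nabla)=\big(\mathcal D^1(E,\mathcal O_X)/S^1(\nabla)\big)^*$, with the flat partial connection $\nabla^1_v(\xi)(P)=v(\xi(P))-\xi(v\circ P-P\circ\nabla_v)$. Restriction to operators of order $0$ is a morphism $\pi:\mathcal P^1(\nabla)\to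 E^{**}=E$, which is the right-hand map of the exact sequence $0\to N^*_{\mathcal F}(E)\to\mathcal P^1(\nabla)\xrightarrow{\pi}E$. *Splittings.* A meromorphic splitting with poles on $D$ is an $\mathcal O_X$-linear $\sigma:E(-D)\to\mathcal P^1(\nabla)$ such that $\pi\circ\sigma$ is the inclusion $E(-D)\subset E$. If $D$ is $\mathcal F$-invariant (that is, $v(f)\in\mathcal O_X(-D)$ for $v\in T_{\mathcal F}$, $f\in\mathcal O_X(-D)$), then $\nabla$ restricts to $E(-D)$, and $\sigma$ is called horizontal if $\sigma(\nabla_v s)=\nabla^1_v(\sigma(s))$ for all $v\in T_{\mathcal F}$, $s\in E(-D)$. *Transversely affine structures.* A singular transversely affine structure for $\mathcal F$ with poles on $D$ is a flat meromorphic connection $\widehat\nabla:E\to\Omega^1_X(D)\otimes E$ that extends $\nabla$, that is, $\widehat\nabla_v s=\nabla_v s$ for $v\in T_{\mathcal F}$. Its polar divisor is exactly $D$ if every local function $g$ such that $g\widehat\nabla$ is holomorphic lies in $\mathcal O_X(-D)$. **Corollary B.** There is a bijection $\widehat\nabla\mapsto\sigma_{\widehat\nabla}$ from the meromorphic connections on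 $E$ with poles on $D$ extending $\nabla$ onto the meromorphic splittings with poles on $D$, given by $\sigma_{\widehat\nabla}=d^1-\widehat\nabla$ on $E(-D)$; explicitly, for $s\in E(-D)$, $\omega_i\in\Omega^1_X$, $s_i\in E$, $$\widehat\nabla(s)=\sum_i\omega_i\otimes s_i\iff \sigma_{\widehat\nabla}(s)=1\otimes s-\sum_i\omega_i\otimes s_i ,$$ where $1\otimes s$ is the form $P\mapsto P(s)$ on operators and $df\otimes t$ is the form $P\mapsto P(ft)-fP(t)$ (extended $\mathcal O_X$-linearly in $df$). Moreover: 1. If $D$ is $\mathcal F$-invariant, this bijection restricts to a bijection between the singular transversely affine structures for $\mathcal F$ with poles on $D$ and the horizontal meromorphic splittings with poles on $D$. 2. If there is a singular transversely affine structure for $\mathcal F$ whose polar divisor is exactly $D$, then $D$ is $\mathcal F$-invariant. -/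

import Mathlib

open TopologicalSpace Opposite

namespace TransverseJets

/-! ### Structure sheaves and sheaves of modules -/

/-- A sheaf of commutative `ℂ`-algebras on a topological space. -/
structure CAlgSheaf (X : Type) [TopologicalSpace X] where
  sec : Opens X → Type
  [commRing : ∀ U, CommRing (sec U)]
  [algebra : ∀ U, Algebra ℂ (sec U)]
  res : ∀ {U V : Opens X}, V ≤ U → sec U →ₐ[ℂ] sec V
  res_self : ∀ (U : Opens X) (s : sec U), res (le_refl U) s = s
  res_res : ∀ {U V W : Opens X} (hV : V ≤ U) (hW : W ≤ V) (s : sec U),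
    res hW (res hV s) = res (hW.trans hV) s
  existsUnique_glue : ∀ {ι : Type} (U : Opens X) (V : ι → Opens X) (hV : ∀ i, V i ≤ U)
    (_ : U ≤ ⨆ i, V i) (s : ∀ i, sec (V i))
    (_ : ∀ i j, res (inf_le_left : V i ⊓ V j ≤ V i) (s i) =
      res (inf_le_right : V i ⊓ V j ≤ V j) (s j)),
    ∃! t : sec U, ∀ i, res (hV i) t = s i

attribute [instance] CAlgSheaf.commRing CAlgSheaf.algebra

variable {X : Type} [TopologicalSpace X] {𝒪 : CAlgSheaf X}

theorem CAlgSheaf.eq_of_locally_eq (𝒪 : CAlgSheaf X) {U : Opens X} (s t : 𝒪.sec U)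
    (h : ∀ x ∈ U, ∃ (V : Opens X) (hV : V ≤ U), x ∈ V ∧ 𝒪.res hV s = 𝒪.res hV t) : s = t := by
  choose V hV hx he using h
  obtain ⟨r, -, hr⟩ := 𝒪.existsUnique_glue (ι := U) U (fun x => V x.1 x.2)
    (fun x => hV x.1 x.2)
    (fun x hxU => Opens.mem_iSup.2 ⟨⟨x, hxU⟩, hx x hxU⟩)
    (fun x => 𝒪.res (hV x.1 x.2) s)
    (fun i j => by rw [𝒪.res_res, 𝒪.res_res])
  rw [hr s fun i => rfl, hr t fun i => (he i.1 i.2).symm]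

/-- A (pre)sheaf of modules over `𝒪`. All the instances that are built below out of the structure
sheaf and of subsheaves of its sheaf of derivations are sheaves. -/
structure OMod (𝒪 : CAlgSheaf X) where
  sec : Opens X → Type
  [addCommGroup : ∀ U, AddCommGroup (sec U)]
  [module : ∀ U, Module (𝒪.sec U) (sec U)]
  res : ∀ {U V : Opens X}, V ≤ U → sec U →+ sec V
  res_smul : ∀ {U V : Opens X} (h : V ≤ U) (f : 𝒪.sec U) (s : sec U),
    res h (f • s) = 𝒪.res h f • res h s
  res_self : ∀ (U : Opens X) (s : sec U), res (le_refl U) s = s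
  res_res : ∀ {U V W : Opens X} (hV : V ≤ U) (hW : W ≤ V) (s : sec U),
    res hW (res hV s) = res (hW.trans hV) s

attribute [instance] OMod.addCommGroup OMod.module

/-- The structure sheaf as a module over itself. -/
@[reducible] def OMod.unit (𝒪 : CAlgSheaf X) : OMod 𝒪 where
  sec U := 𝒪.sec U
  res h := (𝒪.res h : _ →+ _)
  res_smul h f s := map_mul (𝒪.res h) f s
  res_self := 𝒪.res_self
  res_res := 𝒪.res_res

/-- A subsheaf of `𝒪`-modules. -/
structure SubMod (M : OMod 𝒪) where
  carrier : ∀ U : Opens X, Submodule (𝒪.sec U) (M.sec U)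
  res_mem : ∀ {U V : Opens X} (h : V ≤ U) {s : M.sec U}, s ∈ carrier U → M.res h s ∈ carrier V
  local_mem : ∀ {U : Opens X} (s : M.sec U),
    (∀ x ∈ U, ∃ (V : Opens X) (h : V ≤ U), x ∈ V ∧ M.res h s ∈ carrier V) → s ∈ carrier U

@[reducible] def SubMod.toOMod {M : OMod 𝒪} (S : SubMod M) : OMod 𝒪 where
  sec U := S.carrier U
  res h := ((M.res h).comp (S.carrier _).subtype.toAddMonoidHom).codRestrict (S.carrier _)
    (fun s => S.res_mem h s.2)
  res_smul h f s := Subtype.ext (M.res_smul h f s.1)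
  res_self U s := Subtype.ext (M.res_self U s.1)
  res_res hV hW s := Subtype.ext (M.res_res hV hW s.1)

/-- An `𝒪`-linear morphism of sheaves `M|_U → N|_U`. -/
@[ext] structure LHom (M N : OMod 𝒪) (U : Opens X) where
  app : ∀ V : Opens X, V ≤ U → M.sec V →ₗ[𝒪.sec V] N.sec V
  nat : ∀ (V W : Opens X) (hV : V ≤ U) (hW : W ≤ V) (s : M.sec V),
    N.res hW (app V hV s) = app W (hW.trans hV) (M.res hW s)

namespace LHom
variable {M N : OMod 𝒪} {U : Opens X}

instance : Zero (LHom M N U) := ⟨⟨fun _ _ => 0, by intros; simp⟩⟩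
instance : Add (LHom M N U) := ⟨fun φ ψ => ⟨fun V h => φ.app V h + ψ.app V h, by
  intro V W hV hW s; simp [φ.nat V W hV hW, ψ.nat V W hV hW]⟩⟩
instance : Neg (LHom M N U) := ⟨fun φ => ⟨fun V h => -φ.app V h, by
  intro V W hV hW s; simp [φ.nat V W hV hW]⟩⟩
instance : SMul (𝒪.sec U) (LHom M N U) := ⟨fun f φ => ⟨fun V h => 𝒪.res h f • φ.app V h, by
  intro V W hV hW s; simp [φ.nat V W hV hW, N.res_smul, 𝒪.res_res]⟩⟩

@[simp] theorem zero_app (V : Opens X) (h : V ≤ U) : (0 : LHom M N U).app V h = 0 := rfl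
@[simp] theorem add_app (φ ψ : LHom M N U) (V : Opens X) (h : V ≤ U) :
    (φ + ψ).app V h = φ.app V h + ψ.app V h := rfl
@[simp] theorem neg_app (φ : LHom M N U) (V : Opens X) (h : V ≤ U) :
    (-φ).app V h = -φ.app V h := rfl
@[simp] theorem smul_app (f : 𝒪.sec U) (φ : LHom M N U) (V : Opens X) (h : V ≤ U) :
    (f • φ).app V h = 𝒪.res h f • φ.app V h := rfl

instance : AddCommGroup (LHom M N U) where
  add_assoc a b c := by ext; simp [add_assoc]
  zero_add a := by ext; simp
  add_zero a := by ext; simp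
  add_comm a b := by ext; simp [add_comm]
  neg_add_cancel a := by ext; simp
  nsmul := nsmulRec
  zsmul := zsmulRec

instance : Module (𝒪.sec U) (LHom M N U) where
  one_smul a := by ext; simp
  mul_smul f g a := by ext; simp [mul_smul]
  smul_zero f := by ext; simp
  smul_add f a b := by ext; simp
  add_smul f g a := by ext; simp [add_smul]
  zero_smul a := by ext; simp

/-- The restriction of a morphism to a smaller open set. -/
@[reducible] def restrict {V : Opens X} (h : V ≤ U) (φ : LHom M N U) : LHom M N V :=
  ⟨fun W hW => φ.app W (hW.trans h), fun W W' hW hW' s => φ.nat W W' (hW.trans h) hW' s⟩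

end LHom

/-- The sheaf of homomorphisms `ℋom(M, N)`. -/
@[reducible] def OMod.hom (M N : OMod 𝒪) : OMod 𝒪 where
  sec U := LHom M N U
  res h := { toFun := LHom.restrict h, map_zero' := rfl, map_add' := fun _ _ => rfl }
  res_smul h f φ := by
    apply LHom.ext; funext W hW
    change 𝒪.res _ f • _ = 𝒪.res _ (𝒪.res h f) • _
    rw [𝒪.res_res]
    rfl
  res_self _ _ := rfl
  res_res _ _ _ := rfl

/-- A section over `U` of the tangent sheaf: a `ℂ`-derivation of the sheaf `𝒪|_U`. -/
@[ext] structure VField (𝒪 : CAlgSheaf X) (U : Opens X) where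
  app : ∀ V : Opens X, V ≤ U → Derivation ℂ (𝒪.sec V) (𝒪.sec V)
  nat : ∀ (V W : Opens X) (hV : V ≤ U) (hW : W ≤ V) (f : 𝒪.sec V),
    𝒪.res hW (app V hV f) = app W (hW.trans hV) (𝒪.res hW f)

namespace VField
variable {U : Opens X}

instance : Zero (VField 𝒪 U) := ⟨⟨fun _ _ => 0, by intros; simp⟩⟩
instance : Add (VField 𝒪 U) := ⟨fun φ ψ => ⟨fun V h => φ.app V h + ψ.app V h, by
  intro V W hV hW s; simp [φ.nat V W hV hW, ψ.nat V W hV hW]⟩⟩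
instance : Neg (VField 𝒪 U) := ⟨fun φ => ⟨fun V h => -φ.app V h, by
  intro V W hV hW s; simp [φ.nat V W hV hW]⟩⟩
instance : SMul (𝒪.sec U) (VField 𝒪 U) := ⟨fun f φ => ⟨fun V h => 𝒪.res h f • φ.app V h, by
  intro V W hV hW s; simp [φ.nat V W hV hW, 𝒪.res_res]⟩⟩

@[simp] theorem zero_app (V : Opens X) (h : V ≤ U) : (0 : VField 𝒪 U).app V h = 0 := rfl
@[simp] theorem add_app (φ ψ : VField 𝒪 U) (V : Opens X) (h : V ≤ U) :
    (φ + ψ).app V h = φ.app V h + ψ.app V h := rfl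
@[simp] theorem neg_app (φ : VField 𝒪 U) (V : Opens X) (h : V ≤ U) :
    (-φ).app V h = -φ.app V h := rfl
@[simp] theorem smul_app (f : 𝒪.sec U) (φ : VField 𝒪 U) (V : Opens X) (h : V ≤ U) :
    (f • φ).app V h = 𝒪.res h f • φ.app V h := rfl

instance : AddCommGroup (VField 𝒪 U) where
  add_assoc a b c := by ext; simp [add_assoc]
  zero_add a := by ext; simp
  add_zero a := by ext; simp
  add_comm a b := by ext; simp [add_comm]
  neg_add_cancel a := by ext; simp
  nsmul := nsmulRec
  zsmul := zsmulRec

instance : Module (𝒪.sec U) (VField 𝒪 U) where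
  one_smul a := by ext; simp
  mul_smul f g a := by ext; simp [mul_assoc]
  smul_zero f := by ext; simp
  smul_add f a b := by ext; simp
  add_smul f g a := by ext; simp [add_mul]
  zero_smul a := by ext; simp

@[reducible] def restrict {V : Opens X} (h : V ≤ U) (v : VField 𝒪 U) : VField 𝒪 V :=
  ⟨fun W hW => v.app W (hW.trans h), fun W W' hW hW' s => v.nat W W' (hW.trans h) hW' s⟩

/-- The Lie bracket of vector fields. -/
@[reducible] def bracket (v w : VField 𝒪 U) : VField 𝒪 U :=
  ⟨fun V h => ⁅v.app V h, w.app V h⁆, fun V W hV hW f => by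
    simp [Derivation.commutator_apply, v.nat V W hV hW, w.nat V W hV hW]⟩

/-- The function `v(f)`, for `f` a function on the domain of `v`. -/
@[reducible] def act (v : VField 𝒪 U) (f : 𝒪.sec U) : 𝒪.sec U := v.app U le_rfl f

end VField

/-- The tangent sheaf `T_X`, the sheaf of `ℂ`-derivations of the structure sheaf. -/
@[reducible] def tangent (𝒪 : CAlgSheaf X) : OMod 𝒪 where
  sec U := VField 𝒪 U
  res h := { toFun := VField.restrict h, map_zero' := rfl, map_add' := fun _ _ => rfl }
  res_smul h f φ := by
    apply VField.ext; funext W hW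
    change 𝒪.res _ f • _ = 𝒪.res _ (𝒪.res h f) • _
    rw [𝒪.res_res]
    rfl
  res_self _ _ := rfl
  res_res _ _ _ := rfl

/-- The cotangent sheaf `Ω¹_X`. On a smooth variety it is the dual of the tangent sheaf. -/
@[reducible] def cotangent (𝒪 : CAlgSheaf X) : OMod 𝒪 := (tangent 𝒪).hom (OMod.unit 𝒪)

/-- The Lie derivative of a 1-form: `(L_v ω)(w) = v(ω(w)) - ω([v, w])`. -/
@[reducible] def lieDerivative {U : Opens X} (v : VField 𝒪 U)
    (ω : LHom (tangent 𝒪) (OMod.unit 𝒪) U) : LHom (tangent 𝒪) (OMod.unit 𝒪) U where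
  app V h :=
    { toFun := fun w => v.app V h (ω.app V h w) - ω.app V h ((v.restrict h).bracket w)
      map_add' := by
        intro w w'
        have : (v.restrict h).bracket (w + w') =
            (v.restrict h).bracket w + (v.restrict h).bracket w' := by
          ext W hW f; simp
        simp only [this, map_add]; ring
      map_smul' := by
        intro f w
        have : (v.restrict h).bracket (f • w) =
            v.app V h f • w + f • (v.restrict h).bracket w := by
          ext W hW g
          simp only [Derivation.commutator_apply, VField.smul_app, VField.add_app,
            Derivation.smul_apply, Derivation.add_apply, smul_eq_mul, Derivation.leibniz,
            v.nat V W h hW]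
          ring
        simp only [this, map_add, map_smul, smul_eq_mul, Derivation.leibniz, RingHom.id_apply]
        ring }
  nat V W hV hW w := by
    have h1 := ω.nat V W hV hW w
    have h2 := ω.nat V W hV hW ((v.restrict hV).bracket w)
    simp only [AddMonoidHom.coe_coe, LinearMap.coe_mk, AddHom.coe_mk, map_sub] at h1 h2 ⊢
    rw [v.nat V W hV hW, h1, h2]
    rfl

/-! ### Finiteness, rank and torsion -/

/-- `f` is a nonzerodivisor in the sheaf `𝒪|_U`. -/
def IsRegularSec {U : Opens X} (f : 𝒪.sec U) : Prop :=
  ∀ (V : Opens X) (h : V ≤ U) (g : 𝒪.sec V), 𝒪.res h f * g = 0 → g = 0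

/-- The subsheaf of relations `∑ aᵢ sᵢ = 0` between finitely many sections over `U` is locally
finitely generated. -/
def OMod.RelationsFinite (M : OMod 𝒪) {U : Opens X} {n : ℕ} (s : Fin n → M.sec U) : Prop :=
  ∀ x ∈ U, ∃ (V : Opens X) (hV : V ≤ U), x ∈ V ∧ ∃ (m : ℕ) (r : Fin m → Fin n → 𝒪.sec V),
    (∀ j, ∑ i, r j i • M.res hV (s i) = 0) ∧
    ∀ (W : Opens X) (hW : W ≤ V) (a : Fin n → 𝒪.sec W),
      ∑ i, a i • M.res (hW.trans hV) (s i) = 0 →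
      ∀ y ∈ W, ∃ (W' : Opens X) (hW' : W' ≤ W), y ∈ W' ∧ ∃ c : Fin m → 𝒪.sec W',
        ∀ i, 𝒪.res hW' (a i) = ∑ j, c j * 𝒪.res (hW'.trans hW) (r j i)

/-- The sheaf is locally generated by finitely many sections. -/
def OMod.FiniteType (M : OMod 𝒪) : Prop :=
  ∀ x : X, ∃ U : Opens X, x ∈ U ∧ ∃ (n : ℕ) (s : Fin n → M.sec U),
    ∀ (V : Opens X) (hV : V ≤ U) (t : M.sec V), ∀ y ∈ V,
      ∃ (W : Opens X) (hW : W ≤ V), y ∈ W ∧ ∃ c : Fin n → 𝒪.sec W,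
        M.res hW t = ∑ i, c i • M.res (hW.trans hV) (s i)

/-- Coherence: finite type, and all sheaves of relations between finitely many local sections are
of finite type. -/
def OMod.IsCoherent (M : OMod 𝒪) : Prop :=
  M.FiniteType ∧ ∀ (U : Opens X) (n : ℕ) (s : Fin n → M.sec U), M.RelationsFinite s

/-- The generic rank is `r`: on a dense open set the sheaf is locally free of rank `r`. -/
def OMod.HasRank (M : OMod 𝒪) (r : ℕ) : Prop :=
  ∃ U₀ : Opens X, Dense (U₀ : Set X) ∧ ∀ x ∈ U₀, ∃ V : Opens X, x ∈ V ∧ ∃ e : Fin r → M.sec V,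
    ∀ (W : Opens X) (hW : W ≤ V) (t : M.sec W),
      ∃! a : Fin r → 𝒪.sec W, t = ∑ i, a i • M.res hW (e i)

/-! ### Foliations, conormal sheaf and partial connections -/

/-- A foliation: a coherent involutive subsheaf of `T_X` with torsion-free quotient. -/
structure Foliation (𝒪 : CAlgSheaf X) where
  T : SubMod (tangent 𝒪)
  coherent : T.toOMod.IsCoherent
  involutive : ∀ (U : Opens X) (v w : VField 𝒪 U), v ∈ T.carrier U → w ∈ T.carrier U →
    v.bracket w ∈ T.carrier U
  torsionFree_quotient : ∀ (U : Opens X) (f : 𝒪.sec U) (v : VField 𝒪 U), IsRegularSec f →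
    f • v ∈ T.carrier U → v ∈ T.carrier U

/-- The tangent sheaf of the foliation as a sheaf of modules. -/
@[reducible] def Foliation.tan (F : Foliation 𝒪) : OMod 𝒪 := F.T.toOMod

/-- The Lie bracket of two sections of the tangent sheaf of the foliation. -/
@[reducible] def Foliation.bracket (F : Foliation 𝒪) {U : Opens X} (v w : F.tan.sec U) :
    F.tan.sec U :=
  ⟨VField.bracket v.1 w.1, F.involutive U v.1 w.1 v.2 w.2⟩

/-- The conormal sheaf: the 1-forms vanishing on the tangent sheaf of the foliation. -/
@[reducible] def Foliation.conormalSub (F : Foliation 𝒪) : SubMod (cotangent 𝒪) where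
  carrier U :=
    { carrier := {ω | ∀ (V : Opens X) (h : V ≤ U), ∀ v ∈ F.T.carrier V, ω.app V h v = 0}
      zero_mem' := fun V h v _ => rfl
      add_mem' := by intro a b ha hb V h v hv; simp [ha V h v hv, hb V h v hv]
      smul_mem' := by intro f a ha V h v hv; simp [ha V h v hv] }
  res_mem h _ hs V hV v hv := hs V (hV.trans h) v hv
  local_mem {U} ω hω V h v hv := by
    apply 𝒪.eq_of_locally_eq
    intro x hx
    obtain ⟨W, hW, hxW, hmem⟩ := hω x (h hx)
    refine ⟨W ⊓ V, inf_le_right, ⟨hxW, hx⟩, ?_⟩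
    have h1 := ω.nat V (W ⊓ V) h inf_le_right v
    have h2 := hmem (W ⊓ V) inf_le_left _
      (F.T.res_mem (inf_le_right : W ⊓ V ≤ V) hv)
    rw [map_zero]
    exact h1.trans h2

@[reducible] def Foliation.conormal (F : Foliation 𝒪) : OMod 𝒪 := F.conormalSub.toOMod

/-- The foliation has codimension one, that is, its conormal sheaf has rank one. -/
def Foliation.IsCodimOne (F : Foliation 𝒪) : Prop := F.conormal.HasRank 1

/-- A partial connection `∇ : E → Ω¹_F(E) = ℋom(T_F, E)`. (The Leibniz rule makes an additive
`∇` automatically `ℂ`-linear.) -/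
structure PartialConnection (F : Foliation 𝒪) (E : OMod 𝒪) where
  nabla : ∀ U : Opens X, E.sec U →+ (F.tan.hom E).sec U
  nat : ∀ (U V : Opens X) (h : V ≤ U) (s : E.sec U),
    (F.tan.hom E).res h (nabla U s) = nabla V (E.res h s)
  leibniz : ∀ (U : Opens X) (f : 𝒪.sec U) (s : E.sec U) (v : F.tan.sec U),
    (nabla U (f • s)).app U le_rfl v =
      VField.act v.1 f • s + f • (nabla U s).app U le_rfl v

namespace PartialConnection
variable {F : Foliation 𝒪} {E : OMod 𝒪}

/-- `∇_v s`. -/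
@[reducible] def along (D : PartialConnection F E) {U : Opens X} (v : F.tan.sec U) (s : E.sec U) :
    E.sec U := (D.nabla U s).app U le_rfl v

theorem along_add_right (D : PartialConnection F E) {U : Opens X} (v : F.tan.sec U)
    (s t : E.sec U) : D.along v (s + t) = D.along v s + D.along v t := by
  simp [along]

theorem along_smul_left (D : PartialConnection F E) {U : Opens X} (f : 𝒪.sec U)
    (v : F.tan.sec U) (s : E.sec U) : D.along (f • v) s = f • D.along v s := by
  simp [along]

theorem along_smul_right (D : PartialConnection F E) {U : Opens X} (f : 𝒪.sec U)
    (v : F.tan.sec U) (s : E.sec U) :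
    D.along v (f • s) = VField.act v.1 f • s + f • D.along v s := D.leibniz U f s v

theorem res_along (D : PartialConnection F E) {U V : Opens X} (h : V ≤ U) (v : F.tan.sec U)
    (s : E.sec U) : E.res h (D.along v s) = D.along (F.tan.res h v) (E.res h s) := by
  have h1 := (D.nabla U s).nat U V le_rfl h v
  have h2 := congrArg (fun φ : LHom F.tan E V => φ.app V le_rfl (F.tan.res h v)) (D.nat U V h s)
  exact h1.trans h2

/-- Flatness: `∇_{[v,w]} = ∇_v ∇_w - ∇_w ∇_v`. -/
def IsFlat (D : PartialConnection F E) : Prop :=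
  ∀ (U : Opens X) (v w : F.tan.sec U) (s : E.sec U),
    D.along (F.bracket v w) s = D.along v (D.along w s) - D.along w (D.along v s)

/-- A morphism of sheaves is horizontal for the given partial connections. -/
def IsHorizontal {E' : OMod 𝒪} (D : PartialConnection F E) (D' : PartialConnection F E')
    (φ : LHom E E' ⊤) : Prop :=
  ∀ (U : Opens X) (v : F.tan.sec U) (s : E.sec U),
    φ.app U le_top (D.along v s) = D'.along v (φ.app U le_top s)

end PartialConnection

theorem lieDerivative_mem (F : Foliation 𝒪) {U : Opens X} (v : F.tan.sec U)
    (ω : F.conormal.sec U) : lieDerivative v.1 ω.1 ∈ F.conormalSub.carrier U := by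
  intro V h w hw
  have h1 := ω.2 V h w hw
  have h2 := ω.2 V h _ (F.involutive V (VField.restrict h v.1) w (F.T.res_mem h v.2) hw)
  change v.1.app V h (ω.1.app V h w) - ω.1.app V h _ = 0
  rw [h1, h2]; simp

/-- The Bott connection `ω ↦ (v ↦ L_v ω)` on the conormal sheaf. -/
@[reducible] def bott (F : Foliation 𝒪) : PartialConnection F F.conormal where
  nabla U :=
    { toFun := fun ω =>
        { app := fun V h =>
            { toFun := fun v =>
                ⟨lieDerivative v.1 (LHom.restrict h ω.1),
                  lieDerivative_mem F v (F.conormal.res h ω)⟩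
              map_add' := by
                intro v w
                apply Subtype.ext; apply LHom.ext; funext W hW; apply LinearMap.ext; intro u
                have : VField.bracket (VField.restrict hW (v.1 + w.1)) u =
                    VField.bracket (VField.restrict hW v.1) u +
                    VField.bracket (VField.restrict hW w.1) u := by
                  ext W' hW' f; simp [VField.restrict]
                change (v.1.app W hW + w.1.app W hW) (ω.1.app W (hW.trans h) u) -
                  ω.1.app W (hW.trans h) (VField.bracket (VField.restrict hW (v.1 + w.1)) u) =
                  (v.1.app W hW (ω.1.app W (hW.trans h) u) -
                    ω.1.app W (hW.trans h) (VField.bracket (VField.restrict hW v.1) u)) +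
                  (w.1.app W hW (ω.1.app W (hW.trans h) u) -
                    ω.1.app W (hW.trans h) (VField.bracket (VField.restrict hW w.1) u))
                rw [this, map_add, Derivation.add_apply]; ring
              map_smul' := by
                intro f v
                apply Subtype.ext; apply LHom.ext; funext W hW; apply LinearMap.ext; intro u
                have : VField.bracket (VField.restrict hW (f • v.1)) u =
                    𝒪.res hW f • VField.bracket (VField.restrict hW v.1) u -
                    u.act (𝒪.res hW f) • VField.restrict hW v.1 := by
                  ext W' hW' g
                  rw [sub_eq_add_neg]
                  simp only [VField.restrict, VField.act, Derivation.commutator_apply,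
                    VField.smul_app, VField.add_app, VField.neg_app, Derivation.neg_apply,
                    Derivation.smul_apply, Derivation.add_apply, smul_eq_mul,
                    Derivation.leibniz, u.nat W W' le_rfl hW', 𝒪.res_res]
                  ring
                have h0 : ω.1.app W (hW.trans h) (VField.restrict hW v.1) = 0 :=
                  ω.2 W (hW.trans h) _ (F.T.res_mem hW v.2)
                change 𝒪.res hW f * v.1.app W hW (ω.1.app W (hW.trans h) u) -
                  ω.1.app W (hW.trans h) (VField.bracket (VField.restrict hW (f • v.1)) u) =
                  𝒪.res hW f * (v.1.app W hW (ω.1.app W (hW.trans h) u) -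
                    ω.1.app W (hW.trans h) (VField.bracket (VField.restrict hW v.1) u))
                rw [this, map_sub, map_smul, map_smul, h0]
                simp only [smul_eq_mul]; ring }
          nat := fun V W hV hW v => rfl }
      map_zero' := by
        apply LHom.ext; funext V h; apply LinearMap.ext; intro v
        apply Subtype.ext; apply LHom.ext; funext W hW; apply LinearMap.ext; intro u
        change v.1.app W hW 0 - 0 = 0
        simp
      map_add' := by
        intro ω ω'
        apply LHom.ext; funext V h; apply LinearMap.ext; intro v
        apply Subtype.ext; apply LHom.ext; funext W hW; apply LinearMap.ext; intro u
        change v.1.app W hW (ω.1.app W (hW.trans h) u + ω'.1.app W (hW.trans h) u) -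
            (ω.1.app W (hW.trans h) (VField.bracket (VField.restrict hW v.1) u) +
              ω'.1.app W (hW.trans h) (VField.bracket (VField.restrict hW v.1) u)) =
          (v.1.app W hW (ω.1.app W (hW.trans h) u) -
            ω.1.app W (hW.trans h) (VField.bracket (VField.restrict hW v.1) u)) +
          (v.1.app W hW (ω'.1.app W (hW.trans h) u) -
            ω'.1.app W (hW.trans h) (VField.bracket (VField.restrict hW v.1) u))
        rw [map_add]; ring }
  nat U V h s := rfl
  leibniz U f ω v := by
    apply Subtype.ext; apply LHom.ext; funext W hW; apply LinearMap.ext; intro u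
    change v.1.app W hW (𝒪.res hW f * ω.1.app W hW u) -
        𝒪.res hW f * ω.1.app W hW (VField.bracket (VField.restrict hW v.1) u) =
      𝒪.res hW (v.1.app U le_rfl f) * ω.1.app W hW u +
        𝒪.res hW f * (v.1.app W hW (ω.1.app W hW u) -
          ω.1.app W hW (VField.bracket (VField.restrict hW v.1) u))
    rw [v.1.nat U W le_rfl hW]
    simp only [Derivation.leibniz, smul_eq_mul]; ring

theorem bott_isFlat (F : Foliation 𝒪) : (bott F).IsFlat := by
  intro U v w ω
  apply Subtype.ext; apply LHom.ext; funext V h; apply LinearMap.ext; intro u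
  have jac : VField.bracket (VField.restrict h (VField.bracket v.1 w.1)) u =
      VField.bracket (VField.restrict h v.1) (VField.bracket (VField.restrict h w.1) u) -
      VField.bracket (VField.restrict h w.1) (VField.bracket (VField.restrict h v.1) u) := by
    ext W hW f
    rw [sub_eq_add_neg]
    simp only [VField.bracket, VField.add_app, VField.neg_app,
      Derivation.add_apply, Derivation.neg_apply, Derivation.commutator_apply, map_sub]
    ring
  change ⁅v.1.app V h, w.1.app V h⁆ (ω.1.app V h u) -
      ω.1.app V h (VField.bracket (VField.restrict h (VField.bracket v.1 w.1)) u) =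
    (v.1.app V h (w.1.app V h (ω.1.app V h u) -
        ω.1.app V h (VField.bracket (VField.restrict h w.1) u)) -
      (w.1.app V h (ω.1.app V h (VField.bracket (VField.restrict h v.1) u)) -
        ω.1.app V h (VField.bracket (VField.restrict h w.1)
          (VField.bracket (VField.restrict h v.1) u)))) +
    -(w.1.app V h (v.1.app V h (ω.1.app V h u) -
        ω.1.app V h (VField.bracket (VField.restrict h v.1) u)) -
      (v.1.app V h (ω.1.app V h (VField.bracket (VField.restrict h w.1) u)) -
        ω.1.app V h (VField.bracket (VField.restrict h v.1)
          (VField.bracket (VField.restrict h w.1) u))))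
  rw [jac, map_sub, Derivation.commutator_apply]
  simp only [map_sub]
  ring

/-! ### Differential operators of order at most one and the first transverse jet -/

/-- A differential operator `E|_U → 𝒪|_U` of order at most one: a `ℂ`-linear morphism of sheaves
`P` all of whose commutators `[P, f] : s ↦ P(fs) - f P(s)` with functions are `𝒪`-linear. -/
@[ext] structure DiffOp (E : OMod 𝒪) (U : Opens X) where
  app : ∀ V : Opens X, V ≤ U → E.sec V →+ 𝒪.sec V
  nat : ∀ (V W : Opens X) (hV : V ≤ U) (hW : W ≤ V) (s : E.sec V),
    𝒪.res hW (app V hV s) = app W (hW.trans hV) (E.res hW s)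
  map_const : ∀ (V : Opens X) (h : V ≤ U) (c : ℂ) (s : E.sec V),
    app V h (algebraMap ℂ (𝒪.sec V) c • s) = algebraMap ℂ (𝒪.sec V) c * app V h s
  order_le_one : ∀ (V : Opens X) (h : V ≤ U) (f g : 𝒪.sec V) (s : E.sec V),
    app V h (f • g • s) - f * app V h (g • s) = g * (app V h (f • s) - f * app V h s)

namespace DiffOp
variable {E : OMod 𝒪} {U : Opens X}

instance : Zero (DiffOp E U) := ⟨⟨fun _ _ => 0, by intros; simp, by intros; simp,
  by intros; simp⟩⟩
instance : Add (DiffOp E U) := ⟨fun P Q => ⟨fun V h => P.app V h + Q.app V h, by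
  intro V W hV hW s; simp [P.nat V W hV hW, Q.nat V W hV hW], by
  intro V h c s; simp [P.map_const, Q.map_const, mul_add], by
  intro V h f g s
  have h1 := P.order_le_one V h f g s
  have h2 := Q.order_le_one V h f g s
  simp only [AddMonoidHom.add_apply]
  linear_combination h1 + h2⟩⟩
instance : Neg (DiffOp E U) := ⟨fun P => ⟨fun V h => -P.app V h, by
  intro V W hV hW s; simp [P.nat V W hV hW], by
  intro V h c s; simp [P.map_const], by
  intro V h f g s
  have h1 := P.order_le_one V h f g s
  simp only [AddMonoidHom.neg_apply]
  linear_combination -h1⟩⟩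
/-- The canonical `𝒪`-module structure, by multiplication on the left. -/
instance : SMul (𝒪.sec U) (DiffOp E U) := ⟨fun a P =>
  ⟨fun V h => (AddMonoidHom.mulLeft (𝒪.res h a)).comp (P.app V h), by
  intro V W hV hW s; simp [P.nat V W hV hW, 𝒪.res_res], by
  intro V h c s; simp [P.map_const, mul_left_comm], by
  intro V h f g s
  have h1 := P.order_le_one V h f g s
  simp only [AddMonoidHom.comp_apply, AddMonoidHom.coe_mulLeft]
  linear_combination 𝒪.res h a * h1⟩⟩

@[simp] theorem zero_app (V : Opens X) (h : V ≤ U) : (0 : DiffOp E U).app V h = 0 := rfl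
@[simp] theorem add_app (P Q : DiffOp E U) (V : Opens X) (h : V ≤ U) :
    (P + Q).app V h = P.app V h + Q.app V h := rfl
@[simp] theorem neg_app (P : DiffOp E U) (V : Opens X) (h : V ≤ U) :
    (-P).app V h = -P.app V h := rfl
@[simp] theorem smul_app_apply (a : 𝒪.sec U) (P : DiffOp E U) (V : Opens X) (h : V ≤ U)
    (s : E.sec V) : (a • P).app V h s = 𝒪.res h a * P.app V h s := rfl

instance : AddCommGroup (DiffOp E U) where
  add_assoc a b c := by ext; simp [add_assoc]
  zero_add a := by ext; simp
  add_zero a := by ext; simp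
  add_comm a b := by ext; simp [add_comm]
  neg_add_cancel a := by ext; simp
  nsmul := nsmulRec
  zsmul := zsmulRec

instance : Module (𝒪.sec U) (DiffOp E U) where
  one_smul a := by ext; simp
  mul_smul f g a := by ext; simp [mul_assoc]
  smul_zero f := by ext; simp
  smul_add f a b := by ext; simp [mul_add]
  add_smul f g a := by ext; simp [add_mul]
  zero_smul a := by ext; simp

@[reducible] def restrict {V : Opens X} (h : V ≤ U) (P : DiffOp E U) : DiffOp E V :=
  ⟨fun W hW => P.app W (hW.trans h), fun W W' hW hW' s => P.nat W W' (hW.trans h) hW' s,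
    fun W hW c s => P.map_const W (hW.trans h) c s,
    fun W hW f g s => P.order_le_one W (hW.trans h) f g s⟩

/-- The commutator `[P, f]`, an `𝒪`-linear form on `E`. -/
@[reducible] def commutator (P : DiffOp E U) (f : 𝒪.sec U) : LHom E (OMod.unit 𝒪) U where
  app V h :=
    { toFun := fun s => P.app V h (𝒪.res h f • s) - 𝒪.res h f * P.app V h s
      map_add' := by intro s t; simp only [smul_add, map_add]; ring
      map_smul' := by
        intro g s
        simpa using P.order_le_one V h (𝒪.res h f) g s }
  nat V W hV hW s := by
    change 𝒪.res hW (P.app V hV (𝒪.res hV f • s) - 𝒪.res hV f * P.app V hV s) =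
      P.app W (hW.trans hV) (𝒪.res (hW.trans hV) f • E.res hW s) -
        𝒪.res (hW.trans hV) f * P.app W (hW.trans hV) (E.res hW s)
    rw [map_sub, map_mul, P.nat V W hV hW, P.nat V W hV hW, E.res_smul, 𝒪.res_res]

/-- The symbol of `P` at a section `s` of `E`: the vector field `f ↦ [P, f](s)`. -/
@[reducible] def symbol (P : DiffOp E U) (s : E.sec U) : VField 𝒪 U where
  app V h := Derivation.mk'
    { toFun := fun f => P.app V h (f • E.res h s) - f * P.app V h (E.res h s)
      map_add' := by intro f g; simp only [add_smul, map_add]; ring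
      map_smul' := by
        intro c f
        have := P.map_const V h c (f • E.res h s)
        rw [smul_smul] at this
        simp only [Algebra.smul_def, this, RingHom.id_apply]
        ring }
    (by
      intro f g
      have := P.order_le_one V h f g (E.res h s)
      simp only [LinearMap.coe_mk, AddHom.coe_mk, smul_eq_mul, mul_smul] at this ⊢
      linear_combination this)
  nat V W hV hW f := by
    change 𝒪.res hW (P.app V hV (f • E.res hV s) - f * P.app V hV (E.res hV s)) =
      P.app W (hW.trans hV) (𝒪.res hW f • E.res (hW.trans hV) s) -
        𝒪.res hW f * P.app W (hW.trans hV) (E.res (hW.trans hV) s)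
    rw [map_sub, map_mul, P.nat V W hV hW, P.nat V W hV hW, E.res_smul, E.res_res]

/-- An operator of order zero, that is, a section of the dual of `E`, as an operator of order at
most one. -/
@[reducible] def ofLHom (φ : LHom E (OMod.unit 𝒪) U) : DiffOp E U where
  app V h := (φ.app V h : _ →+ _)
  nat V W hV hW s := φ.nat V W hV hW s
  map_const V h c s := (φ.app V h).map_smul _ s
  order_le_one V h f g s := by simp

end DiffOp

/-- The sheaf of differential operators of order at most one from `E` to the structure sheaf. -/
@[reducible] def diffOps (E : OMod 𝒪) : OMod 𝒪 where
  sec U := DiffOp E U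
  res h := { toFun := DiffOp.restrict h, map_zero' := rfl, map_add' := fun _ _ => rfl }
  res_smul h f φ := by
    apply DiffOp.ext; funext W hW; apply AddMonoidHom.ext; intro s
    change 𝒪.res _ f * _ = 𝒪.res _ (𝒪.res h f) * _
    rw [𝒪.res_res]
    rfl
  res_self _ _ := rfl
  res_res _ _ _ := rfl

section Jets
variable {F : Foliation 𝒪} {E : OMod 𝒪}

/-- The operator `φ ∘ ∇_v`, for `φ` a section of the dual of `E` and `v` tangent to the foliation.
These generate the prolongation `S¹(∇)`. -/
@[reducible] def PartialConnection.comp (D : PartialConnection F E) {U : Opens X}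
    (φ : LHom E (OMod.unit 𝒪) U) (v : F.tan.sec U) : DiffOp E U where
  app V h :=
    { toFun := fun s => φ.app V h (D.along (F.tan.res h v) s)
      map_zero' := by simp [PartialConnection.along]
      map_add' := by intro s t; rw [D.along_add_right, map_add] }
  nat V W hV hW s := by
    have := φ.nat V W hV hW (D.along (F.tan.res hV v) s)
    rw [D.res_along, F.tan.res_res] at this
    exact this
  map_const V h c s := by
    change φ.app V h (D.along (F.tan.res h v) _) = _ * φ.app V h (D.along (F.tan.res h v) s)
    rw [D.along_smul_right, VField.act, Derivation.map_algebraMap, zero_smul, zero_add, map_smul,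
      smul_eq_mul]
  order_le_one V h f g s := by
    change φ.app V h (D.along (F.tan.res h v) _) - f * φ.app V h (D.along (F.tan.res h v) _) =
      g * (φ.app V h (D.along (F.tan.res h v) _) - f * φ.app V h (D.along (F.tan.res h v) s))
    simp only [D.along_smul_right, map_add, map_smul, smul_eq_mul]
    ring

/-- The operator `v ∘ P - P ∘ ∇_v`. -/
@[reducible] def PartialConnection.opBracket (D : PartialConnection F E) {U : Opens X}
    (v : F.tan.sec U) (P : DiffOp E U) : DiffOp E U where
  app V h :=
    { toFun := fun s => v.1.app V h (P.app V h s) - P.app V h (D.along (F.tan.res h v) s)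
      map_zero' := by simp [PartialConnection.along]
      map_add' := by
        intro s t; rw [D.along_add_right]; simp only [map_add]; ring }
  nat V W hV hW s := by
    have h1 := P.nat V W hV hW (D.along (F.tan.res hV v) s)
    rw [D.res_along, F.tan.res_res] at h1
    change 𝒪.res hW (v.1.app V hV (P.app V hV s) - P.app V hV (D.along (F.tan.res hV v) s)) =
      v.1.app W _ (P.app W _ (E.res hW s)) - P.app W _ (D.along _ (E.res hW s))
    rw [map_sub, h1, v.1.nat V W hV hW, P.nat V W hV hW]
  map_const V h c s := by
    change v.1.app V h (P.app V h _) - P.app V h (D.along (F.tan.res h v) _) =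
      _ * (v.1.app V h (P.app V h s) - P.app V h (D.along (F.tan.res h v) s))
    rw [D.along_smul_right, VField.act, Derivation.map_algebraMap, zero_smul, zero_add,
      P.map_const, P.map_const, Derivation.leibniz, Derivation.map_algebraMap]
    simp only [smul_eq_mul]; ring
  order_le_one V h f g s := by
    change (v.1.app V h (P.app V h _) - P.app V h (D.along (F.tan.res h v) _)) -
        f * (v.1.app V h (P.app V h _) - P.app V h (D.along (F.tan.res h v) _)) =
      g * ((v.1.app V h (P.app V h _) - P.app V h (D.along (F.tan.res h v) _)) -
        f * (v.1.app V h (P.app V h s) - P.app V h (D.along (F.tan.res h v) s)))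
    have e1 := P.order_le_one V h f g s
    have e2 := congrArg (v.1.app V h) e1
    have e3 := P.order_le_one V h (v.1.app V h f) g s
    have e4 := P.order_le_one V h f g (D.along (F.tan.res h v) s)
    have e5 := P.order_le_one V h f (v.1.app V h g) s
    have a1 : VField.act (F.tan.res h v).1 f = v.1.app V h f := rfl
    have a2 : VField.act (F.tan.res h v).1 g = v.1.app V h g := rfl
    simp only [D.along_smul_right, a1, a2, smul_add, map_add, map_sub, Derivation.leibniz,
      smul_eq_mul] at e2 ⊢
    linear_combination e2 - e3 - e4 - e5

/-- The first sheaf of transverse jets of `∇`: the dual of the quotient of the sheaf of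
differential operators of order at most one from `E` to `𝒪` by the prolongation `S¹(∇)`, that is,
the `𝒪`-linear forms on differential operators that vanish on all `φ ∘ ∇_v`. -/
@[reducible] def transverseJetSub (D : PartialConnection F E) :
    SubMod ((diffOps E).hom (OMod.unit 𝒪)) where
  carrier U :=
    { carrier := {ξ | ∀ (V : Opens X) (h : V ≤ U) (φ : LHom E (OMod.unit 𝒪) V)
        (v : F.tan.sec V), ξ.app V h (D.comp φ v) = 0}
      zero_mem' := fun V h φ v => rfl
      add_mem' := by intro a b ha hb V h φ v; simp [ha V h φ v, hb V h φ v]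
      smul_mem' := by intro f a ha V h φ v; simp [ha V h φ v] }
  res_mem h _ hs V hV φ v := hs V (hV.trans h) φ v
  local_mem {U} ξ hξ V h φ v := by
    apply 𝒪.eq_of_locally_eq
    intro x hx
    obtain ⟨W, hW, hxW, hmem⟩ := hξ x (h hx)
    refine ⟨W ⊓ V, inf_le_right, ⟨hxW, hx⟩, ?_⟩
    have h1 := ξ.nat V (W ⊓ V) h inf_le_right (D.comp φ v)
    have h2 := hmem (W ⊓ V) inf_le_left (φ.restrict inf_le_right)
      (F.tan.res (inf_le_right : W ⊓ V ≤ V) v)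
    rw [map_zero]
    exact h1.trans h2

@[reducible] def transverseJet (D : PartialConnection F E) : OMod 𝒪 := (transverseJetSub D).toOMod

/-- The section of the dual of the sheaf of differential operators given by
`P ↦ v(ξ(P)) - ξ(v ∘ P - P ∘ ∇_v)`. -/
@[reducible] def PartialConnection.dualDeriv (D : PartialConnection F E) {U : Opens X}
    (v : F.tan.sec U) (ξ : LHom (diffOps E) (OMod.unit 𝒪) U) :
    LHom (diffOps E) (OMod.unit 𝒪) U where
  app V h :=
    { toFun := fun P => v.1.app V h (ξ.app V h P) - ξ.app V h (D.opBracket (F.tan.res h v) P)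
      map_add' := by
        intro P Q
        have : D.opBracket (F.tan.res h v) (P + Q) =
            D.opBracket (F.tan.res h v) P + D.opBracket (F.tan.res h v) Q := by
          apply DiffOp.ext; funext W hW; apply AddMonoidHom.ext; intro s
          simp only [PartialConnection.opBracket, DiffOp.add_app, AddMonoidHom.add_apply,
            AddMonoidHom.coe_mk, ZeroHom.coe_mk, map_add]
          ring
        simp only [this, map_add]; ring
      map_smul' := by
        intro f P
        have : D.opBracket (F.tan.res h v) (f • P) =
            v.1.app V h f • P + f • D.opBracket (F.tan.res h v) P := by
          apply DiffOp.ext; funext W hW; apply AddMonoidHom.ext; intro s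
          have := v.1.nat V W h hW f
          have e : (F.tan.res h v).1.app W hW = v.1.app W (hW.trans h) := rfl
          simp only [DiffOp.add_app, AddMonoidHom.add_apply,
            AddMonoidHom.coe_mk, ZeroHom.coe_mk, DiffOp.smul_app_apply, this,
            Derivation.leibniz, smul_eq_mul, e]
          ring
        simp only [this, map_add, map_smul, Derivation.leibniz, smul_eq_mul, RingHom.id_apply]
        ring }
  nat V W hV hW P := by
    have h1 := ξ.nat V W hV hW P
    have h2 := ξ.nat V W hV hW (D.opBracket (F.tan.res hV v) P)
    change 𝒪.res hW (v.1.app V hV (ξ.app V hV P) - ξ.app V hV _) =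
      v.1.app W _ (ξ.app W _ ((diffOps E).res hW P)) - ξ.app W _ _
    rw [map_sub, v.1.nat V W hV hW]
    exact congrArg₂ (fun a b => v.1.app W (hW.trans hV) a - b) h1 h2

theorem PartialConnection.dualDeriv_mem (D : PartialConnection F E) (hD : D.IsFlat) {U : Opens X}
    (v : F.tan.sec U) (ξ : (transverseJet D).sec U) :
    D.dualDeriv v ξ.1 ∈ (transverseJetSub D).carrier U := by
  intro V h φ w
  let ψ : LHom E (OMod.unit 𝒪) V :=
    { app := fun W hW =>
        { toFun := fun s => v.1.app W (hW.trans h) (φ.app W hW s) -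
            φ.app W hW (D.along (F.tan.res (hW.trans h) v) s)
          map_add' := by intro s t; rw [D.along_add_right]; simp only [map_add]; ring
          map_smul' := by
            intro f s
            have a1 : VField.act (F.tan.res (hW.trans h) v).1 f = v.1.app W (hW.trans h) f := rfl
            simp only [D.along_smul_right, a1, map_add, map_smul, smul_eq_mul,
              Derivation.leibniz, RingHom.id_apply]
            ring }
      nat := by
        intro W W' hW hW' s
        have h1 := φ.nat W W' hW hW' (D.along (F.tan.res (hW.trans h) v) s)
        have h2 := φ.nat W W' hW hW' s
        rw [D.res_along, F.tan.res_res] at h1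
        change 𝒪.res hW' (v.1.app W _ (φ.app W hW s) - φ.app W hW _) =
          v.1.app W' _ (φ.app W' _ (E.res hW' s)) - φ.app W' _ _
        rw [map_sub, v.1.nat W W' (hW.trans h) hW']
        exact congrArg₂ (fun a b => v.1.app W' (hW'.trans (hW.trans h)) a - b) h2 h1 }
  have key : D.opBracket (F.tan.res h v) (D.comp φ w) =
      D.comp ψ w + D.comp φ (F.bracket (F.tan.res h v) w) := by
    apply DiffOp.ext; funext W hW; apply AddMonoidHom.ext; intro s
    have hf := hD W (F.tan.res (hW.trans h) v) (F.tan.res hW w) s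
    change v.1.app W (hW.trans h) (φ.app W hW (D.along (F.tan.res hW w) s)) -
        φ.app W hW (D.along (F.tan.res hW w) (D.along (F.tan.res (hW.trans h) v) s)) =
      (v.1.app W (hW.trans h) (φ.app W hW (D.along (F.tan.res hW w) s)) -
        φ.app W hW (D.along (F.tan.res (hW.trans h) v) (D.along (F.tan.res hW w) s))) +
      φ.app W hW (D.along (F.bracket (F.tan.res (hW.trans h) v) (F.tan.res hW w)) s)
    rw [hf, map_sub]; ring
  change v.1.app V h (ξ.1.app V h (D.comp φ w)) -
    ξ.1.app V h (D.opBracket (F.tan.res h v) (D.comp φ w)) = 0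
  rw [key, map_add, ξ.2 V h φ w, ξ.2 V h ψ w, ξ.2 V h φ _]
  simp

/-- The partial connection `∇¹` on the first sheaf of transverse jets of a flat partial
connection: `∇¹_v(ξ)(P) = v(ξ(P)) - ξ(v ∘ P - P ∘ ∇_v)`. -/
@[reducible] def transverseJetConnection (D : PartialConnection F E) (hD : D.IsFlat) :
    PartialConnection F (transverseJet D) where
  nabla U :=
    { toFun := fun ξ =>
        { app := fun V h =>
            { toFun := fun v => ⟨D.dualDeriv v (LHom.restrict h ξ.1),
                D.dualDeriv_mem hD v ((transverseJet D).res h ξ)⟩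
              map_add' := by
                intro v w
                apply Subtype.ext; apply LHom.ext; funext W hW; apply LinearMap.ext; intro P
                have : D.opBracket (F.tan.res hW (v + w)) P =
                    D.opBracket (F.tan.res hW v) P + D.opBracket (F.tan.res hW w) P := by
                  apply DiffOp.ext; funext W' hW'; apply AddMonoidHom.ext; intro s
                  change (v.1.app W' _ (P.app W' hW' s) + w.1.app W' _ (P.app W' hW' s)) -
                    P.app W' hW' ((D.nabla W' s).app W' le_rfl
                      (F.tan.res (hW'.trans hW) v + F.tan.res (hW'.trans hW) w)) =
                    (v.1.app W' _ (P.app W' hW' s) -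
                      P.app W' hW' ((D.nabla W' s).app W' le_rfl
                        (F.tan.res (hW'.trans hW) v))) +
                    (w.1.app W' _ (P.app W' hW' s) -
                      P.app W' hW' ((D.nabla W' s).app W' le_rfl
                        (F.tan.res (hW'.trans hW) w)))
                  rw [map_add, map_add]; ring
                change (v.1.app W hW (ξ.1.app W (hW.trans h) P) +
                    w.1.app W hW (ξ.1.app W (hW.trans h) P)) -
                    ξ.1.app W (hW.trans h) (D.opBracket (F.tan.res hW (v + w)) P) =
                  (v.1.app W hW (ξ.1.app W (hW.trans h) P) -
                    ξ.1.app W (hW.trans h) (D.opBracket (F.tan.res hW v) P)) +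
                  (w.1.app W hW (ξ.1.app W (hW.trans h) P) -
                    ξ.1.app W (hW.trans h) (D.opBracket (F.tan.res hW w) P))
                rw [this, map_add]; ring
              map_smul' := by
                intro f v
                apply Subtype.ext; apply LHom.ext; funext W hW; apply LinearMap.ext; intro P
                have : D.opBracket (F.tan.res hW (f • v)) P =
                    𝒪.res hW f • D.opBracket (F.tan.res hW v) P -
                    D.comp (P.commutator (𝒪.res hW f)) (F.tan.res hW v) := by
                  rw [sub_eq_add_neg]
                  apply DiffOp.ext; funext W' hW'; apply AddMonoidHom.ext; intro s
                  have e : F.tan.res hW' (F.tan.res hW (f • v)) =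
                      𝒪.res (hW'.trans hW) f • F.tan.res (hW'.trans hW) v := by
                    rw [F.tan.res_res, F.tan.res_smul]
                  change 𝒪.res (hW'.trans hW) f * v.1.app W' _ (P.app W' hW' s) -
                    P.app W' hW' (D.along (F.tan.res hW' (F.tan.res hW (f • v))) s) =
                    𝒪.res hW' (𝒪.res hW f) * (v.1.app W' _ (P.app W' hW' s) -
                      P.app W' hW' (D.along (F.tan.res (hW'.trans hW) v) s)) +
                    -(P.app W' hW' (𝒪.res hW' (𝒪.res hW f) •
                        D.along (F.tan.res (hW'.trans hW) v) s) -
                      𝒪.res hW' (𝒪.res hW f) *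
                        P.app W' hW' (D.along (F.tan.res (hW'.trans hW) v) s))
                  rw [e, D.along_smul_left, 𝒪.res_res]; ring
                have h0 : ξ.1.app W (hW.trans h)
                    (D.comp (P.commutator (𝒪.res hW f)) (F.tan.res hW v)) = 0 :=
                  ξ.2 W (hW.trans h) _ _
                change 𝒪.res hW f * v.1.app W hW (ξ.1.app W (hW.trans h) P) -
                    ξ.1.app W (hW.trans h) (D.opBracket (F.tan.res hW (f • v)) P) =
                  𝒪.res hW f * (v.1.app W hW (ξ.1.app W (hW.trans h) P) -
                    ξ.1.app W (hW.trans h) (D.opBracket (F.tan.res hW v) P))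
                rw [this, map_sub, map_smul, h0, smul_eq_mul]; ring }
          nat := fun V W hV hW v => rfl }
      map_zero' := by
        apply LHom.ext; funext V h; apply LinearMap.ext; intro v
        apply Subtype.ext; apply LHom.ext; funext W hW; apply LinearMap.ext; intro P
        change v.1.app W hW 0 - 0 = 0
        simp
      map_add' := by
        intro ξ ξ'
        apply LHom.ext; funext V h; apply LinearMap.ext; intro v
        apply Subtype.ext; apply LHom.ext; funext W hW; apply LinearMap.ext; intro P
        change v.1.app W hW (ξ.1.app W (hW.trans h) P + ξ'.1.app W (hW.trans h) P) -
            (ξ.1.app W (hW.trans h) (D.opBracket (F.tan.res hW v) P) +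
              ξ'.1.app W (hW.trans h) (D.opBracket (F.tan.res hW v) P)) =
          (v.1.app W hW (ξ.1.app W (hW.trans h) P) -
            ξ.1.app W (hW.trans h) (D.opBracket (F.tan.res hW v) P)) +
          (v.1.app W hW (ξ'.1.app W (hW.trans h) P) -
            ξ'.1.app W (hW.trans h) (D.opBracket (F.tan.res hW v) P))
        rw [map_add]; ring }
  nat U V h s := rfl
  leibniz U f ξ v := by
    apply Subtype.ext; apply LHom.ext; funext W hW; apply LinearMap.ext; intro P
    change v.1.app W hW (𝒪.res hW f * ξ.1.app W hW P) -
        𝒪.res hW f * ξ.1.app W hW (D.opBracket (F.tan.res hW v) P) =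
      𝒪.res hW (v.1.app U le_rfl f) * ξ.1.app W hW P +
        𝒪.res hW f * (v.1.app W hW (ξ.1.app W hW P) -
          ξ.1.app W hW (D.opBracket (F.tan.res hW v) P))
    rw [v.1.nat U W le_rfl hW]
    simp only [Derivation.leibniz, smul_eq_mul]; ring

end Jets

/-! ### Divisors, meromorphic connections and meromorphic splittings -/

/-- An effective divisor, given by the ideal sheaf `𝒪(-D)`, locally generated by one
nonzerodivisor. -/
structure EffectiveDivisor (𝒪 : CAlgSheaf X) where
  ideal : SubMod (OMod.unit 𝒪)
  principal : ∀ x : X, ∃ U : Opens X, x ∈ U ∧ ∃ f : 𝒪.sec U, IsRegularSec f ∧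
    ∀ (V : Opens X) (h : V ≤ U) (g : 𝒪.sec V),
      g ∈ ideal.carrier V ↔ ∃ a : 𝒪.sec V, g = a * 𝒪.res h f

/-- The divisor is invariant by the foliation: `v(f) ∈ 𝒪(-D)` for `f ∈ 𝒪(-D)`, `v ∈ T_F`. -/
def EffectiveDivisor.IsInvariant (D : EffectiveDivisor 𝒪) (F : Foliation 𝒪) : Prop :=
  ∀ (U : Opens X) (v : F.tan.sec U), ∀ f ∈ D.ideal.carrier U,
    VField.act v.1 f ∈ D.ideal.carrier U

/-- The sheaf `E(D) = 𝒪(D) ⊗ E`, as `ℋom(𝒪(-D), E)`. A section `s` of `E` is the section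
`g ↦ g s` of `E(D)`, and in general the value at `g` of a section `u` stands for `g u`. -/
@[reducible] def OMod.poles (E : OMod 𝒪) (D : EffectiveDivisor 𝒪) : OMod 𝒪 :=
  D.ideal.toOMod.hom E

/-- The section of `E(D)` defined by a section of `E`. -/
@[reducible] def OMod.toPoles (E : OMod 𝒪) (D : EffectiveDivisor 𝒪) {U : Opens X} (s : E.sec U) :
    (E.poles D).sec U where
  app V h :=
    { toFun := fun g => g.1 • E.res h s
      map_add' := fun g g' => add_smul g.1 g'.1 _
      map_smul' := fun f g => mul_smul f g.1 _ }
  nat V W hV hW g := by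
    change E.res hW (g.1 • E.res hV s) = 𝒪.res hW g.1 • E.res (hW.trans hV) s
    rw [E.res_smul, E.res_res]

/-- The subsheaf `E(-D) = 𝒪(-D) E` of `E`. -/
@[reducible] def OMod.negSub (E : OMod 𝒪) (D : EffectiveDivisor 𝒪) : SubMod E where
  carrier U :=
    { carrier := {s | ∀ x ∈ U, ∃ (V : Opens X) (h : V ≤ U), x ∈ V ∧
        E.res h s ∈ Submodule.span (𝒪.sec V)
          {t | ∃ g ∈ D.ideal.carrier V, ∃ t₀ : E.sec V, t = g • t₀}}
      zero_mem' := fun x hx => ⟨U, le_rfl, hx, by simp⟩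
      add_mem' := by
        intro a b ha hb x hx
        obtain ⟨V, hV, hxV, h1⟩ := ha x hx
        obtain ⟨W, hW, hxW, h2⟩ := hb x hx
        have mono : ∀ {V W : Opens X} (hW : W ≤ V) (t : E.sec V),
            t ∈ Submodule.span (𝒪.sec V)
              {t | ∃ g ∈ D.ideal.carrier V, ∃ t₀ : E.sec V, t = g • t₀} →
            E.res hW t ∈ Submodule.span (𝒪.sec W)
              {t | ∃ g ∈ D.ideal.carrier W, ∃ t₀ : E.sec W, t = g • t₀} := by
          intro V W hW t ht
          induction ht using Submodule.span_induction with
          | mem t h =>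
            obtain ⟨g, hg, t₀, rfl⟩ := h
            exact Submodule.subset_span ⟨_, D.ideal.res_mem hW hg, _, E.res_smul hW g t₀⟩
          | zero => simp
          | add a b _ _ ha hb => rw [map_add]; exact add_mem ha hb
          | smul f a _ ha => rw [E.res_smul]; exact Submodule.smul_mem _ _ ha
        refine ⟨V ⊓ W, inf_le_left.trans hV, ⟨hxV, hxW⟩, ?_⟩
        have h1' := mono (inf_le_left : V ⊓ W ≤ V) _ h1
        have h2' := mono (inf_le_right : V ⊓ W ≤ W) _ h2
        rw [E.res_res] at h1' h2'
        rw [map_add]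
        exact add_mem h1' h2'
      smul_mem' := by
        intro f a ha x hx
        obtain ⟨V, hV, hxV, h1⟩ := ha x hx
        exact ⟨V, hV, hxV, by rw [E.res_smul]; exact Submodule.smul_mem _ _ h1⟩ }
  res_mem {U V} h s hs x hx := by
    obtain ⟨W, hW, hxW, h1⟩ := hs x (h hx)
    refine ⟨V ⊓ W, inf_le_left, ⟨hx, hxW⟩, ?_⟩
    have key : ∀ t ∈ Submodule.span (𝒪.sec W)
        {t | ∃ g ∈ D.ideal.carrier W, ∃ t₀ : E.sec W, t = g • t₀},
        E.res (inf_le_right : V ⊓ W ≤ W) t ∈ Submodule.span (𝒪.sec (V ⊓ W))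
          {t | ∃ g ∈ D.ideal.carrier (V ⊓ W), ∃ t₀ : E.sec (V ⊓ W), t = g • t₀} := by
      intro t ht
      induction ht using Submodule.span_induction with
      | mem t h =>
        obtain ⟨g, hg, t₀, rfl⟩ := h
        exact Submodule.subset_span ⟨_, D.ideal.res_mem _ hg, _, E.res_smul _ g t₀⟩
      | zero => simp
      | add a b _ _ ha hb => rw [map_add]; exact add_mem ha hb
      | smul f a _ ha => rw [E.res_smul]; exact Submodule.smul_mem _ _ ha
    have := key _ h1
    rw [E.res_res] at this ⊢
    exact this
  local_mem {U} s hs x hx := by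
    obtain ⟨V, hV, hxV, h1⟩ := hs x hx
    obtain ⟨W, hW, hxW, h2⟩ := h1 x hxV
    refine ⟨W, hW.trans hV, hxW, ?_⟩
    rwa [E.res_res] at h2

@[reducible] def OMod.neg (E : OMod 𝒪) (D : EffectiveDivisor 𝒪) : OMod 𝒪 := (E.negSub D).toOMod

theorem PartialConnection.along_mem_neg {F : Foliation 𝒪} {E : OMod 𝒪}
    (N : PartialConnection F E) {D : EffectiveDivisor 𝒪} (hD : D.IsInvariant F) {U : Opens X}
    (v : F.tan.sec U) (s : (E.neg D).sec U) : N.along v s.1 ∈ (E.negSub D).carrier U := by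
  intro x hx
  obtain ⟨V, hV, hxV, h1⟩ := s.2 x hx
  refine ⟨V, hV, hxV, ?_⟩
  rw [N.res_along]
  generalize E.res hV s.1 = t at h1
  generalize F.tan.res hV v = w
  induction h1 using Submodule.span_induction with
  | mem t h =>
    obtain ⟨g, hg, t₀, rfl⟩ := h
    rw [N.along_smul_right]
    exact add_mem (Submodule.subset_span ⟨_, hD V w g hg, t₀, rfl⟩)
      (Submodule.subset_span ⟨g, hg, _, rfl⟩)
  | zero => simp [PartialConnection.along]
  | add a b _ _ ha hb => rw [N.along_add_right]; exact add_mem ha hb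
  | smul f a h ha =>
    rw [N.along_smul_right]
    exact add_mem (Submodule.smul_mem _ _ h) (Submodule.smul_mem _ _ ha)

/-- The partial connection induced on `E(-D)`, for `D` invariant by the foliation. -/
@[reducible] def PartialConnection.neg {F : Foliation 𝒪} {E : OMod 𝒪} (N : PartialConnection F E)
    {D : EffectiveDivisor 𝒪} (hD : D.IsInvariant F) : PartialConnection F (E.neg D) where
  nabla U :=
    { toFun := fun s =>
        { app := fun V h =>
            { toFun := fun v => ⟨N.along v (E.res h s.1),
                N.along_mem_neg hD v ((E.neg D).res h s)⟩
              map_add' := fun v w => Subtype.ext (map_add _ v w)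
              map_smul' := fun f v => Subtype.ext (map_smul _ f v) }
          nat := fun V W hV hW v => Subtype.ext (by
            have := N.res_along hW v (E.res hV s.1)
            rw [E.res_res] at this
            exact this) }
      map_zero' := by
        apply LHom.ext; funext V h; apply LinearMap.ext; intro v; apply Subtype.ext
        change N.along v (E.res h 0) = 0
        simp [PartialConnection.along]
      map_add' := by
        intro s t
        apply LHom.ext; funext V h; apply LinearMap.ext; intro v; apply Subtype.ext
        change N.along v (E.res h (s.1 + t.1)) = N.along v (E.res h s.1) + N.along v (E.res h t.1)
        rw [map_add, N.along_add_right] }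
  nat U V h s := by
    apply LHom.ext; funext W hW; apply LinearMap.ext; intro v; apply Subtype.ext
    change N.along v (E.res (hW.trans h) s.1) = N.along v (E.res hW (E.res h s.1))
    rw [E.res_res]
  leibniz U f s v := Subtype.ext (by
    change N.along v (E.res le_rfl (f • s.1)) =
      VField.act v.1 f • s.1 + f • N.along v (E.res le_rfl s.1)
    rw [E.res_self, E.res_self, N.along_smul_right])

/-- A meromorphic connection `∇ : E → Ω¹_X(D)(E)` with poles on `D`, where
`Ω¹_X(D)(E) = Ω¹_X ⊗ E(D)` is written as `ℋom(T_X, E(D))`. (The Leibniz rule makes an additive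
`∇` automatically `ℂ`-linear.) -/
@[ext] structure MeromorphicConnection (E : OMod 𝒪) (D : EffectiveDivisor 𝒪) where
  nabla : ∀ U : Opens X, E.sec U →+ ((tangent 𝒪).hom (E.poles D)).sec U
  nat : ∀ (U V : Opens X) (h : V ≤ U) (s : E.sec U),
    ((tangent 𝒪).hom (E.poles D)).res h (nabla U s) = nabla V (E.res h s)
  leibniz : ∀ (U : Opens X) (f : 𝒪.sec U) (s : E.sec U) (v : VField 𝒪 U),
    (nabla U (f • s)).app U le_rfl v =
      v.act f • E.toPoles D s + f • (nabla U s).app U le_rfl v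

namespace MeromorphicConnection
variable {E : OMod 𝒪} {D : EffectiveDivisor 𝒪}

/-- `∇_v s`, a section of `E(D)`. -/
@[reducible] def along (A : MeromorphicConnection E D) {U : Opens X} (v : VField 𝒪 U)
    (s : E.sec U) : LHom D.ideal.toOMod E U := (A.nabla U s).app U le_rfl v

/-- The section `g ∇_v s` of `E`, for `g` in `𝒪(-D)`. -/
@[reducible] def mulAlong (A : MeromorphicConnection E D) {U : Opens X} (g : D.ideal.toOMod.sec U)
    (v : VField 𝒪 U) (s : E.sec U) : E.sec U := (A.along v s).app U le_rfl g

/-- The section `g h ∇_v ∇_w s` of `E`, for `g`, `h` in `𝒪(-D)`, where `∇_v` is extended to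
sections of `E(D)` by the Leibniz rule: `g ∇_v u = ∇_v(g u) - v(g) u`. -/
@[reducible] def mulAlongAlong (A : MeromorphicConnection E D) {U : Opens X}
    (g h : D.ideal.toOMod.sec U) (v w : VField 𝒪 U) (s : E.sec U) : E.sec U :=
  A.mulAlong h v (A.mulAlong g w s) - v.act g.1 • A.mulAlong h w s

/-- Flatness: `∇_{[v,w]} = ∇_v ∇_w - ∇_w ∇_v`, an equality of sections of `E(2D)`. -/
def IsFlat (A : MeromorphicConnection E D) : Prop :=
  ∀ (U : Opens X) (v w : VField 𝒪 U) (s : E.sec U) (g h : D.ideal.toOMod.sec U),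
    h.1 • A.mulAlong g (v.bracket w) s = A.mulAlongAlong g h v w s - A.mulAlongAlong g h w v s

/-- The meromorphic connection extends the partial connection: `∇_v s` agrees in `E(D)` with the
section of `E` given by the partial connection, for `v` tangent to the foliation. -/
def Extends {F : Foliation 𝒪} (A : MeromorphicConnection E D) (N : PartialConnection F E) : Prop :=
  ∀ (U : Opens X) (v : F.tan.sec U) (s : E.sec U), A.along v.1 s = E.toPoles D (N.along v s)

/-- The polar divisor of `∇` is exactly `D`: a function `g` such that `g ∇` is holomorphic belongs
to `𝒪(-D)`. -/
def HasPolarDivisor (A : MeromorphicConnection E D) : Prop :=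
  ∀ (U : Opens X) (g : 𝒪.sec U),
    (∀ (V : Opens X) (h : V ≤ U) (v : VField 𝒪 V) (s : E.sec V),
      ∃ t : E.sec V, 𝒪.res h g • A.along v s = E.toPoles D t) →
    g ∈ D.ideal.carrier U

end MeromorphicConnection

/-- The meromorphic connections with poles on `D` extending a partial connection. -/
def MeromorphicExtension {F : Foliation 𝒪} {E : OMod 𝒪} (N : PartialConnection F E)
    (D : EffectiveDivisor 𝒪) : Type :=
  {A : MeromorphicConnection E D // A.Extends N}

/-- The meromorphic splittings with poles on `D` of the exact sequence
`0 → N*_F(E) → 𝒫¹(∇) → E` of the first transverse jet: the `𝒪`-linear morphisms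
`σ : E(-D) → 𝒫¹(∇)` whose composition with the projection is the inclusion `E(-D) → E`. The
projection restricts `ξ` to operators of order zero, with values in the bidual of the reflexive
sheaf `E`, where `s` is the form `φ ↦ φ(s)`. -/
def MeromorphicSplitting {F : Foliation 𝒪} {E : OMod 𝒪} (N : PartialConnection F E)
    (D : EffectiveDivisor 𝒪) : Type :=
  {σ : LHom (E.neg D) (transverseJet N) ⊤ //
    ∀ (U : Opens X) (s : (E.neg D).sec U) (V : Opens X) (h : V ≤ U)
      (φ : LHom E (OMod.unit 𝒪) V),
      (σ.app U le_top s).1.app V h (DiffOp.ofLHom φ) = φ.app V le_rfl (E.res h s.1)}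

/-- `σ = d¹ - ∇` on `E(-D)`: for all sections `s` of `E(-D)`, 1-forms `ωᵢ` and sections `tᵢ` of
`E`, one has `∇ s = ∑ ωᵢ ⊗ tᵢ` if and only if `σ(s) = 1 ⊗ s - ∑ ωᵢ ⊗ tᵢ`. As forms on differential
operators, the jet `1 ⊗ s` is `P ↦ P(s)` and `df ⊗ t` is `P ↦ [P, f](t)`, so that `ω ⊗ t` is the
value of `ω` on the symbol of `P` at `t`. -/
def Corresponds {F : Foliation 𝒪} {E : OMod 𝒪} {N : PartialConnection F E}
    {D : EffectiveDivisor 𝒪} (A : MeromorphicConnection E D)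
    (σ : LHom (E.neg D) (transverseJet N) ⊤) : Prop :=
  ∀ (U : Opens X) (s : (E.neg D).sec U) (k : ℕ) (ω : Fin k → (cotangent 𝒪).sec U)
    (t : Fin k → E.sec U),
    (∀ (V : Opens X) (h : V ≤ U) (v : VField 𝒪 V),
      A.along v (E.res h s.1) =
        E.toPoles D (∑ i, (ω i).app V h v • E.res h (t i))) ↔
    ∀ (V : Opens X) (h : V ≤ U) (P : DiffOp E V),
      (σ.app U le_top s).1.app V h P =
        P.app V le_rfl (E.res h s.1) - ∑ i, (ω i).app V h (P.symbol (E.res h (t i)))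

/-- A singular transversely affine structure with poles on `D`: a flat meromorphic connection on
the conormal sheaf, with poles on `D`, extending the Bott connection. -/
def TransverselyAffineStructure (F : Foliation 𝒪) (D : EffectiveDivisor 𝒪) : Type :=
  {A : MeromorphicExtension (bott F) D // A.1.IsFlat}

/-- The horizontal meromorphic splittings with poles on an invariant divisor `D` of the exact
sequence of the first transverse jet of the Bott connection. -/
def HorizontalSplitting (F : Foliation 𝒪) (D : EffectiveDivisor 𝒪) (hD : D.IsInvariant F) : Type :=
  {σ : MeromorphicSplitting (bott F) D //
    ((bott F).neg hD).IsHorizontal (transverseJetConnection (bott F) (bott_isFlat F)) σ.1}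

/-! ### Smooth complex varieties -/

open scoped Manifold ContDiff

/-- The sheaf of holomorphic functions of a complex manifold. -/
noncomputable def holomorphicSheaf (n : ℕ) (M : Type) [TopologicalSpace M]
    [ChartedSpace (EuclideanSpace ℂ (Fin n)) M] : CAlgSheaf M where
  sec U := ContMDiffMap 𝓘(ℂ, EuclideanSpace ℂ (Fin n)) 𝓘(ℂ, ℂ) U ℂ ω
  res {U V} h :=
    { toFun := fun f => ⟨f ∘ Set.inclusion h, f.contMDiff.comp (contMDiff_inclusion h)⟩
      map_one' := rfl
      map_mul' := fun _ _ => rfl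
      map_zero' := rfl
      map_add' := fun _ _ => rfl
      commutes' := fun _ => rfl }
  res_self U s := rfl
  res_res hV hW s := rfl
  existsUnique_glue {ι} U V hV hcov s hs := by
    have hc : ∀ x : U, ∃ i, x.1 ∈ V i := fun x => Opens.mem_iSup.1 (hcov x.2)
    choose i hi using hc
    have heq : ∀ (x : U) (j : ι) (hj : x.1 ∈ V j), s (i x) ⟨x.1, hi x⟩ = s j ⟨x.1, hj⟩ :=
      fun x j hj => DFunLike.congr_fun (hs (i x) j) ⟨x.1, hi x, hj⟩
    let t : U → ℂ := fun x => s (i x) ⟨x.1, hi x⟩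
    have ht : ContMDiff 𝓘(ℂ, EuclideanSpace ℂ (Fin n)) 𝓘(ℂ, ℂ) ω t := by
      intro x
      classical
      let T : M → ℂ := fun y => if hy : y ∈ U then t ⟨y, hy⟩ else 0
      have h1 : t = fun y : U => T y.1 := by
        funext y
        change t y = dite (y.1 ∈ U) _ _
        rw [dif_pos y.2]
      have h2 : (s (i x) : V (i x) → ℂ) = fun y : V (i x) => T y.1 := by
        funext y
        have hy : y.1 ∈ U := hV _ y.2
        have e : T y.1 = t ⟨y.1, hy⟩ := dif_pos hy
        rw [e]
        exact (heq ⟨y.1, hy⟩ (i x) y.2).symm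
      have h3 := (s (i x)).contMDiff ⟨x.1, hi x⟩
      rw [h2] at h3
      rw [h1]
      have h4 : ContMDiffAt 𝓘(ℂ, EuclideanSpace ℂ (Fin n)) 𝓘(ℂ, ℂ) ω T x.1 :=
        (contMDiffAt_subtype_iff (U := V (i x)) (x := ⟨x.1, hi x⟩)).1 h3
      exact contMDiffAt_subtype_iff.2 h4
    refine ⟨⟨t, ht⟩, fun j => ?_, fun u hu => ?_⟩
    · ext x
      exact heq ⟨x.1, hV j x.2⟩ j x.2
    · ext x
      exact DFunLike.congr_fun (hu (i x)) ⟨x.1, hi x⟩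

open AlgebraicGeometry CategoryTheory

/-- The constants in the functions on an open set of a scheme over `ℂ`. -/
noncomputable def schemeConst (Y : Scheme.{0}) (p : Y ⟶ Spec (CommRingCat.of ℂ)) (U : Opens Y) :
    ℂ →+* Γ(Y, U) :=
  ((Y.presheaf.map (homOfLE (le_top : U ≤ ⊤)).op).hom.comp p.appTop.hom).comp
    (Scheme.ΓSpecIso (CommRingCat.of ℂ)).inv.hom

/-- The structure sheaf of a scheme over `ℂ`, as a sheaf of `ℂ`-algebras. -/
noncomputable def schemeSheaf (Y : Scheme.{0}) (p : Y ⟶ Spec (CommRingCat.of ℂ)) :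
    CAlgSheaf Y where
  sec U := Γ(Y, U)
  commRing U := inferInstance
  algebra U := (schemeConst Y p U).toAlgebra
  res {U V} h :=
    letI : ∀ U : Opens Y, Algebra ℂ Γ(Y, U) := fun U => (schemeConst Y p U).toAlgebra
    { (Y.presheaf.map (homOfLE h).op).hom with
      commutes' := fun c => by
        have : Y.presheaf.map (homOfLE (le_top : V ≤ ⊤)).op =
            Y.presheaf.map (homOfLE (le_top : U ≤ ⊤)).op ≫ Y.presheaf.map (homOfLE h).op := by
          rw [← CategoryTheory.Functor.map_comp]; rfl
        exact (congrArg (fun φ => φ.hom (p.appTop.hom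
          ((Scheme.ΓSpecIso (CommRingCat.of ℂ)).inv.hom c))) this).symm }
  res_self U s := by
    change (Y.presheaf.map (homOfLE (le_refl U)).op).hom s = s
    have : (homOfLE (le_refl U)).op = 𝟙 (op U) := rfl
    rw [this, CategoryTheory.Functor.map_id]; rfl
  res_res {U V W} hV hW s := by
    change (Y.presheaf.map (homOfLE hW).op).hom ((Y.presheaf.map (homOfLE hV).op).hom s) =
      (Y.presheaf.map (homOfLE (hW.trans hV)).op).hom s
    have : (homOfLE (hW.trans hV)).op = (homOfLE hV).op ≫ (homOfLE hW).op := rfl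
    rw [this, CategoryTheory.Functor.map_comp]; rfl
  existsUnique_glue {ι} U V hV hcov s hs :=
    Y.sheaf.existsUnique_gluing' V U (fun i => homOfLE (hV i)) hcov s hs

/-- The structure sheaves of smooth complex varieties: complex manifolds in the analytic setting,
smooth separated schemes of finite type over `ℂ` in the algebraic setting. Connectedness is not
required. -/
inductive IsSmoothComplexVariety :
    ∀ {X : Type} [TopologicalSpace X], CAlgSheaf X → Prop
  | analytic (n : ℕ) (M : Type) [TopologicalSpace M] [T2Space M] [SecondCountableTopology M]
      [ChartedSpace (EuclideanSpace ℂ (Fin n)) M]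
      [IsManifold 𝓘(ℂ, EuclideanSpace ℂ (Fin n)) ω M] :
      IsSmoothComplexVariety (holomorphicSheaf n M)
  | algebraic (Y : Scheme.{0}) (p : Y ⟶ Spec (CommRingCat.of ℂ)) [Smooth p] [IsSeparated p]
      [QuasiCompact p] : IsSmoothComplexVariety (schemeSheaf Y p)

end TransverseJets

namespace TransverseJets

variable {X : Type} [TopologicalSpace X] {𝒪 : CAlgSheaf X}

/-! Write E for the conormal sheaf and symb_P(t) for the vector field f ↦ [P,f](t). The splitting
attached to ∇ is σ(s)(P) = P(s) - c(s,P), where c(s,P) contracts ∇s with the symbol of P. Since E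
need not be locally free, c is characterised by ∇_{symb_P(t)} s = c·t for all t (`IsContraction`).
Rank one makes this possible: φ(s)t = φ(t)s for every linear form φ on E (`lhom_smul_comm`). This is
clear where E is free, hence true everywhere, because conormal forms are determined on a dense open
set. For s in E(-D) the derivatives ∇_v s have no poles. If v = ∑ v(yᵢ)eᵢ for all fields v, then c =
∑ [P,yᵢ](∇_{eᵢ}s) works, and local solutions glue by uniqueness.

Conversely, σ is tested on the operators P_{v,w} : s ↦ v(s(w)) (`evalOp`), whose symbol is t ↦
t(w)v. They force (g∇_v s)(w) = g v(s(w)) - σ(gs)(P_{v,w}), which is taken as the definition of ∇.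
Linearity in w holds because π∘σ is the inclusion. For v tangent to the foliation, P_{v,w} =
ev_w∘∇_v + ev_{[v,w]}, so the Bott connection is extended. These operators suffice to recover σ: by
rank one, t(w)P - P_{symb_P(t),w} has zero symbol, and on operators of order zero σ is prescribed.

Let R be the curvature and v tangent to the foliation. Then R(v, symb_P(t))s = (v(c(s,P)) - c(s, v∘P
- P∘∇_v) - c(∇_v s, P)) t (`IsContraction.curvature`), so σ is horizontal if and only if R(v,·) = 0
for all such v. In that case every contraction of R is a conormal form, and an alternating form
whose contractions are all conormal vanishes in rank one (`isFlat_of_curvature_tan_eq_zero`).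

Invariance of D is read off from flatness: v(f)∇_u s = ∇_v(f∇_u s) - f∇_u∇_v s - f∇_{[v,u]}s has no
poles when f is in 𝒪(-D).

Two properties of X enter: restriction of functions to dense open sets is injective, and T_X has
local frames dual to functions. For schemes they come from reducedness and étale coordinates, for
manifolds from continuity and Hadamard's lemma in charts. -/

/-- Functions are determined by their restriction to any dense open set. -/
def CAlgSheaf.DenseInjective (𝒪 : CAlgSheaf X) : Prop :=
  ∀ U U₀ : Opens X, Dense (U₀ : Set X) → ∀ f : 𝒪.sec U,
    𝒪.res (inf_le_left : U ⊓ U₀ ≤ U) f = 0 → f = 0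

/-- Locally there are functions `yᵢ` and vector fields `eᵢ` such that `v = ∑ v(yᵢ) eᵢ` for all
vector fields `v`. -/
def CAlgSheaf.HasLocalFrames (𝒪 : CAlgSheaf X) : Prop :=
  ∀ x : X, ∃ V : Opens X, x ∈ V ∧ ∃ (n : ℕ) (y : Fin n → 𝒪.sec V) (e : Fin n → VField 𝒪 V),
    ∀ (W : Opens X) (hW : W ≤ V) (v : VField 𝒪 W),
      v = ∑ i, v.act (𝒪.res hW (y i)) • VField.restrict hW (e i)

theorem VField.act_add (U : Opens X) (v w : VField 𝒪 U) (f : 𝒪.sec U) :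
    (v + w).act f = v.act f + w.act f := rfl

theorem VField.res_act {U V : Opens X} (h : V ≤ U) (v : VField 𝒪 U) (f : 𝒪.sec U) :
    𝒪.res h (v.act f) = (v.restrict h).act (𝒪.res h f) := v.nat U V le_rfl h f

theorem VField.res_app {U V W : Opens X} (hV : V ≤ U) (hW : W ≤ V) (v : VField 𝒪 U)
    (f : 𝒪.sec V) : 𝒪.res hW (v.app V hV f) = v.app W (hW.trans hV) (𝒪.res hW f) :=
  v.nat V W hV hW f

theorem VField.sum_app {U V : Opens X} (h : V ≤ U) {ι : Type*} (s : Finset ι)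
    (v : ι → VField 𝒪 U) :
    (∑ i ∈ s, v i).app V h = ∑ i ∈ s, (v i).app V h :=
  map_sum (⟨⟨fun w : VField 𝒪 U => w.app V h, rfl⟩, fun _ _ => rfl⟩ :
    VField 𝒪 U →+ Derivation ℂ (𝒪.sec V) (𝒪.sec V)) v s

/-! ### Calculus of the products g∇_v s with g in 𝒪(-D). -/

namespace MeromorphicConnection
variable {E : OMod 𝒪} {D : EffectiveDivisor 𝒪} (A : MeromorphicConnection E D) {U : Opens X}

theorem mulAlong_smul_left (f : 𝒪.sec U) (g : D.ideal.toOMod.sec U) (v : VField 𝒪 U)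
    (s : E.sec U) : A.mulAlong (f • g) v s = f • A.mulAlong g v s := map_smul _ _ _

/-- Both sides are the value of the linear form ∇_v s at gg'. This exchange of pole-clearing factors
is what makes computations in E(D) possible inside E. -/
theorem mulAlong_comm (g g' : D.ideal.toOMod.sec U) (v : VField 𝒪 U)
    (s : E.sec U) : g.1 • A.mulAlong g' v s = g'.1 • A.mulAlong g v s := by
  have e : g.1 • g' = g'.1 • g := Subtype.ext (mul_comm _ _)
  exact (A.mulAlong_smul_left g.1 g' v s).symm.trans
    ((congrArg (A.mulAlong · v s) e).trans (A.mulAlong_smul_left g'.1 g v s))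

theorem mulAlong_add_field (g : D.ideal.toOMod.sec U) (v w : VField 𝒪 U) (s : E.sec U) :
    A.mulAlong g (v + w) s = A.mulAlong g v s + A.mulAlong g w s := by
  have := map_add ((A.nabla U s).app U le_rfl) v w
  exact congrArg (fun φ : LHom D.ideal.toOMod E U => φ.app U le_rfl g) this

theorem mulAlong_smul_field (f : 𝒪.sec U) (g : D.ideal.toOMod.sec U) (v : VField 𝒪 U)
    (s : E.sec U) : A.mulAlong g (f • v) s = f • A.mulAlong g v s := by
  have := map_smul ((A.nabla U s).app U le_rfl) f v
  refine (congrArg (fun φ : LHom D.ideal.toOMod E U => φ.app U le_rfl g) this).trans ?_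
  change 𝒪.res le_rfl f • A.mulAlong g v s = _
  rw [𝒪.res_self]

theorem mulAlong_zero_field (g : D.ideal.toOMod.sec U) (s : E.sec U) :
    A.mulAlong g 0 s = 0 := by
  have := A.mulAlong_smul_field 0 g 0 s
  rwa [zero_smul, zero_smul] at this

theorem mulAlong_neg_field (g : D.ideal.toOMod.sec U) (v : VField 𝒪 U) (s : E.sec U) :
    A.mulAlong g (-v) s = -A.mulAlong g v s := by
  have := A.mulAlong_smul_field (-1) g v s
  rwa [neg_one_smul, neg_one_smul] at this

theorem mulAlong_add (g : D.ideal.toOMod.sec U) (v : VField 𝒪 U) (s t : E.sec U) :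
    A.mulAlong g v (s + t) = A.mulAlong g v s + A.mulAlong g v t := by
  have := map_add (A.nabla U) s t
  exact congrArg (fun φ : LHom (tangent 𝒪) (E.poles D) U =>
    (φ.app U le_rfl v).app U le_rfl g) this

theorem mulAlong_zero (g : D.ideal.toOMod.sec U) (v : VField 𝒪 U) :
    A.mulAlong g v 0 = 0 := by
  have := A.mulAlong_add g v 0 0
  simpa using this

theorem mulAlong_smul (f : 𝒪.sec U) (g : D.ideal.toOMod.sec U) (v : VField 𝒪 U)
    (s : E.sec U) :
    A.mulAlong g v (f • s) = (v.act f * g.1) • s + f • A.mulAlong g v s := by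
  refine (congrArg (fun φ : LHom D.ideal.toOMod E U => φ.app U le_rfl g)
    (A.leibniz U f s v)).trans ?_
  change 𝒪.res le_rfl (v.act f) • (g.1 : 𝒪.sec U) • E.res le_rfl s +
    𝒪.res le_rfl f • A.mulAlong g v s = _
  rw [𝒪.res_self, 𝒪.res_self, E.res_self, smul_smul]

/-- Naturality brings all data to one open set. Hence a connection is determined by its products
`mulAlong`, as `ext_mulAlong` and `along_eq_toPoles_iff` exploit. -/
theorem app_along {V : Opens X} (h : V ≤ U) (g : D.ideal.toOMod.sec V) (v : VField 𝒪 U)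
    (s : E.sec U) :
    (A.along v s).app V h g = A.mulAlong g (v.restrict h) (E.res h s) := by
  have h1 := (A.nabla U s).nat U V le_rfl h v
  have h2 := congrArg (fun φ : LHom (tangent 𝒪) (E.poles D) V => φ.app V le_rfl (v.restrict h))
    (A.nat U V h s)
  exact congrArg (fun φ : LHom D.ideal.toOMod E V => φ.app V le_rfl g) (h1.trans h2)

theorem res_mulAlong {V : Opens X} (h : V ≤ U) (g : D.ideal.toOMod.sec U) (v : VField 𝒪 U)
    (s : E.sec U) :
    E.res h (A.mulAlong g v s) =
      A.mulAlong (D.ideal.toOMod.res h g) (v.restrict h) (E.res h s) :=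
  ((A.along v s).nat U V le_rfl h g).trans (A.app_along h _ v s)

theorem app_nabla {V : Opens X} (h : V ≤ U) (v : VField 𝒪 V) (s : E.sec U) :
    (A.nabla U s).app V h v = A.along v (E.res h s) :=
  congrArg (fun φ : LHom (tangent 𝒪) (E.poles D) V => φ.app V le_rfl v) (A.nat U V h s)

theorem ext_mulAlong {A B : MeromorphicConnection E D}
    (h : ∀ (U : Opens X) (g : D.ideal.toOMod.sec U) (v : VField 𝒪 U) (s : E.sec U),
      A.mulAlong g v s = B.mulAlong g v s) : A = B := by
  apply MeromorphicConnection.ext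
  funext U
  apply AddMonoidHom.ext; intro s
  apply LHom.ext; funext V hV; apply LinearMap.ext; intro v
  rw [A.app_nabla, B.app_nabla]
  apply LHom.ext; funext W hW; apply LinearMap.ext; intro g
  rw [A.app_along, B.app_along, h]

theorem along_eq_toPoles_iff (v : VField 𝒪 U) (s t : E.sec U) :
    A.along v s = E.toPoles D t ↔ ∀ (V : Opens X) (h : V ≤ U) (g : D.ideal.toOMod.sec V),
      A.mulAlong g (v.restrict h) (E.res h s) = g.1 • E.res h t := by
  constructor
  · intro e V h g
    rw [← A.app_along h g v s, e]
    rfl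
  · intro e
    apply LHom.ext; funext V h; apply LinearMap.ext; intro g
    rw [A.app_along, e]
    rfl

/-- A meromorphic connection from the sections `g ∇_v s`. -/
def ofMulAlong (m : ∀ U : Opens X, D.ideal.toOMod.sec U → VField 𝒪 U → E.sec U → E.sec U)
    (add_left : ∀ U g g' v s, m U (g + g') v s = m U g v s + m U g' v s)
    (smul_left : ∀ U (f : 𝒪.sec U) g v s, m U (f • g) v s = f • m U g v s)
    (add_field : ∀ U g v w s, m U g (v + w) s = m U g v s + m U g w s)
    (smul_field : ∀ U (f : 𝒪.sec U) g v s, m U g (f • v) s = f • m U g v s)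
    (add_right : ∀ U g v s t, m U g v (s + t) = m U g v s + m U g v t)
    (smul_right : ∀ U (f : 𝒪.sec U) g v s,
      m U g v (f • s) = (v.act f * g.1) • s + f • m U g v s)
    (res_m : ∀ U V (h : V ≤ U) g v s,
      E.res h (m U g v s) = m V (D.ideal.toOMod.res h g) (v.restrict h) (E.res h s)) :
    MeromorphicConnection E D where
  nabla U :=
    { toFun := fun s =>
        { app := fun V h =>
            { toFun := fun v =>
                { app := fun W hW =>
                    { toFun := fun g => m W g (v.restrict hW) (E.res (hW.trans h) s)
                      map_add' := fun g g' => add_left W g g' _ _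
                      map_smul' := fun f g => smul_left W f g _ _ }
                  nat := fun W W' hW hW' g => by
                    refine (res_m W W' hW' g _ _).trans ?_
                    rw [E.res_res]
                    rfl }
              map_add' := fun v w => by
                apply LHom.ext; funext W hW; apply LinearMap.ext; intro g
                exact add_field W g (v.restrict hW) (w.restrict hW) _
              map_smul' := fun f v => by
                apply LHom.ext; funext W hW; apply LinearMap.ext; intro g
                have : VField.restrict hW (f • v) = 𝒪.res hW f • v.restrict hW :=
                  (tangent 𝒪).res_smul hW f v
                change m W g (VField.restrict hW (f • v)) _ = 𝒪.res hW f • m W g _ _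
                rw [this, smul_field] }
          nat := fun V W hV hW v => rfl }
      map_zero' := by
        apply LHom.ext; funext V h; apply LinearMap.ext; intro v
        apply LHom.ext; funext W hW; apply LinearMap.ext; intro g
        change m W g (v.restrict hW) (E.res _ 0) = 0
        have := add_right W g (v.restrict hW) 0 0
        rw [map_zero]
        simpa using this
      map_add' := by
        intro s t
        apply LHom.ext; funext V h; apply LinearMap.ext; intro v
        apply LHom.ext; funext W hW; apply LinearMap.ext; intro g
        change m W g (v.restrict hW) (E.res _ (s + t)) = m W g _ _ + m W g _ _
        rw [map_add, add_right] }
  nat U V h s := by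
    apply LHom.ext; funext W hW; apply LinearMap.ext; intro v
    apply LHom.ext; funext W' hW'; apply LinearMap.ext; intro g
    change m W' g _ (E.res _ s) = m W' g _ (E.res _ (E.res h s))
    rw [E.res_res]
  leibniz U f s v := by
    apply LHom.ext; funext W hW; apply LinearMap.ext; intro g
    change m W g (v.restrict hW) (E.res _ (f • s)) =
      𝒪.res hW (v.act f) • g.1 • E.res hW s + 𝒪.res hW f • m W g _ (E.res _ s)
    rw [E.res_smul, smul_right, VField.res_act, smul_smul]

theorem mulAlong_ofMulAlong (m : ∀ U : Opens X, D.ideal.toOMod.sec U → VField 𝒪 U → E.sec U → E.sec U)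
    (h1 h2 h3 h4 h5 h6 h7) (g : D.ideal.toOMod.sec U) (v : VField 𝒪 U) (s : E.sec U) :
    (ofMulAlong m h1 h2 h3 h4 h5 h6 h7).mulAlong g v s = m U g v s :=
  congrArg (m U g v) (E.res_self U s)

end MeromorphicConnection

/-! ### Torsion -/

theorem EffectiveDivisor.eq_zero_of_mul (D : EffectiveDivisor 𝒪) {U : Opens X} (f : 𝒪.sec U)
    (hf : ∀ (V : Opens X) (h : V ≤ U), ∀ g ∈ D.ideal.carrier V, g * 𝒪.res h f = 0) : f = 0 := by
  apply 𝒪.eq_of_locally_eq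
  intro x hx
  obtain ⟨V, hxV, a, ha, hI⟩ := D.principal x
  refine ⟨U ⊓ V, inf_le_left, ⟨hx, hxV⟩, ?_⟩
  rw [map_zero]
  -- The local equation `a` of D is itself a section of the ideal, and it is a nonzerodivisor.
  apply ha (U ⊓ V) inf_le_right
  exact hf _ _ _ ((hI _ _ _).2 ⟨1, (one_mul _).symm⟩)

variable {F : Foliation 𝒪} {U : Opens X}

theorem Foliation.conormal_ext {s t : F.conormal.sec U}
    (h : ∀ (V : Opens X) (hV : V ≤ U) (w : VField 𝒪 V), s.1.app V hV w = t.1.app V hV w) :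
    s = t := by
  apply Subtype.ext; apply LHom.ext; funext V hV; apply LinearMap.ext; intro w
  exact h V hV w

/-- The value of a conormal form on a vector field. -/
def Foliation.pair (s : F.conormal.sec U) (w : VField 𝒪 U) : 𝒪.sec U := s.1.app U le_rfl w

/-! ### Conormal forms: torsion-freeness and the consequences of rank one. -/

namespace Foliation

theorem pair_add_left (s t : F.conormal.sec U) (w : VField 𝒪 U) :
    pair (s + t) w = pair s w + pair t w := rfl

theorem pair_zero_left (w : VField 𝒪 U) : pair (0 : F.conormal.sec U) w = 0 := rfl

theorem pair_neg_left (s : F.conormal.sec U) (w : VField 𝒪 U) :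
    pair (-s) w = -pair s w := rfl

theorem pair_smul_left (f : 𝒪.sec U) (s : F.conormal.sec U) (w : VField 𝒪 U) :
    pair (f • s) w = f * pair s w := by
  change 𝒪.res _ f * pair s w = _
  rw [𝒪.res_self]

theorem pair_add_right (s : F.conormal.sec U) (w w' : VField 𝒪 U) :
    pair s (w + w') = pair s w + pair s w' := map_add _ _ _

theorem pair_smul_right (f : 𝒪.sec U) (s : F.conormal.sec U) (w : VField 𝒪 U) :
    pair s (f • w) = f * pair s w := map_smul (s.1.app U le_rfl) f w

theorem res_pair {V : Opens X} (h : V ≤ U) (s : F.conormal.sec U) (w : VField 𝒪 U) :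
    𝒪.res h (pair s w) = pair (F.conormal.res h s) (w.restrict h) :=
  s.1.nat U V le_rfl h w

theorem pair_tan (s : F.conormal.sec U) (w : F.tan.sec U) : pair s w.1 = 0 :=
  s.2 U le_rfl w.1 w.2

theorem ext_pair {s t : F.conormal.sec U}
    (h : ∀ (V : Opens X) (hV : V ≤ U) (w : VField 𝒪 V),
      pair (F.conormal.res hV s) w = pair (F.conormal.res hV t) w) : s = t :=
  conormal_ext h

theorem conormal_eq_of_locally_eq {s t : F.conormal.sec U}
    (h : ∀ x ∈ U, ∃ (V : Opens X) (hV : V ≤ U), x ∈ V ∧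
      F.conormal.res hV s = F.conormal.res hV t) : s = t := by
  apply ext_pair
  intro V hV w
  apply 𝒪.eq_of_locally_eq
  intro x hx
  obtain ⟨W, hW, hxW, e⟩ := h x (hV hx)
  refine ⟨V ⊓ W, inf_le_left, ⟨hx, hxW⟩, ?_⟩
  have e' := congrArg (F.conormal.res (inf_le_right : V ⊓ W ≤ W)) e
  simp only [F.conormal.res_res] at e'
  rw [res_pair, res_pair, F.conormal.res_res, F.conormal.res_res, e']

/-- Conormal forms are compared through their values, which are functions; so density and torsion
properties of 𝒪 pass to them, although the sheaf need not be locally free. -/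
theorem conormal_eq_of_dense (h𝒪 : 𝒪.DenseInjective) {U₀ : Opens X} (h₀ : Dense (U₀ : Set X))
    {s t : F.conormal.sec U}
    (h : F.conormal.res (inf_le_left : U ⊓ U₀ ≤ U) s = F.conormal.res inf_le_left t) :
    s = t := by
  apply ext_pair
  intro V hV w
  rw [← sub_eq_zero]
  apply h𝒪 V U₀ h₀
  have e' := congrArg (F.conormal.res (inf_le_inf_right U₀ hV : V ⊓ U₀ ≤ U ⊓ U₀)) h
  simp only [F.conormal.res_res] at e'
  rw [map_sub, res_pair, res_pair, F.conormal.res_res, F.conormal.res_res, e', sub_self]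

theorem conormal_eq_zero_of_ideal_smul (D : EffectiveDivisor 𝒪) (s : F.conormal.sec U)
    (h : ∀ (V : Opens X) (hV : V ≤ U) (g : D.ideal.toOMod.sec V),
      g.1 • F.conormal.res hV s = 0) : s = 0 := by
  apply ext_pair
  intro V hV w
  rw [map_zero, pair_zero_left]
  apply D.eq_zero_of_mul
  intro W hW g hg
  have := h W (hW.trans hV) ⟨g, hg⟩
  rw [res_pair, ← pair_smul_left, F.conormal.res_res, this, pair_zero_left]

theorem conormal_eq_of_ideal_smul (D : EffectiveDivisor 𝒪) (s t : F.conormal.sec U)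
    (h : ∀ (V : Opens X) (hV : V ≤ U) (g : D.ideal.toOMod.sec V),
      g.1 • F.conormal.res hV s = g.1 • F.conormal.res hV t) : s = t := by
  rw [← sub_eq_zero]
  apply conormal_eq_zero_of_ideal_smul D
  intro V hV g
  rw [map_sub, smul_sub, h, sub_self]

/-- Linear forms on a sheaf of rank one are proportional to each other on sections. -/
theorem lhom_smul_comm (h𝒪 : 𝒪.DenseInjective) (hF : F.IsCodimOne)
    (φ : LHom F.conormal (OMod.unit 𝒪) U) (s t : F.conormal.sec U) :
    φ.app U le_rfl s • t = φ.app U le_rfl t • s := by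
  -- Where the sheaf has a generator e, with s = ae and t = be, both sides equal abφ(e)e. Density
  -- carries the identity to the points where no generator exists.
  obtain ⟨U₀, h₀, hU₀⟩ := hF
  apply conormal_eq_of_dense h𝒪 h₀
  apply conormal_eq_of_locally_eq
  intro x hx
  obtain ⟨V, hxV, e, he⟩ := hU₀ x hx.2
  refine ⟨U ⊓ U₀ ⊓ V, inf_le_left, ⟨hx, hxV⟩, ?_⟩
  have hU : U ⊓ U₀ ⊓ V ≤ U := inf_le_left.trans inf_le_left
  have key : ∀ s : F.conormal.sec (U ⊓ U₀ ⊓ V), ∃ a : 𝒪.sec (U ⊓ U₀ ⊓ V),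
      s = a • F.conormal.res inf_le_right (e 0) := by
    intro s
    obtain ⟨a, ha, -⟩ := he (U ⊓ U₀ ⊓ V) inf_le_right s
    exact ⟨a 0, by simpa using ha⟩
  have hφ := fun s => φ.nat U (U ⊓ U₀ ⊓ V) le_rfl hU s
  rw [F.conormal.res_res, F.conormal.res_res, F.conormal.res_smul, F.conormal.res_smul]
  change (OMod.unit 𝒪).res hU _ • _ = (OMod.unit 𝒪).res hU _ • _
  rw [hφ, hφ]
  obtain ⟨a, ha⟩ := key (F.conormal.res hU s)
  obtain ⟨b, hb⟩ := key (F.conormal.res hU t)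
  rw [ha, hb, map_smul, map_smul, smul_smul, smul_smul]
  congr 1
  simp only [smul_eq_mul]
  ring

theorem eq_zero_of_smul_conormal (h𝒪 : 𝒪.DenseInjective) (hF : F.IsCodimOne) (f : 𝒪.sec U)
    (h : ∀ (V : Opens X) (hV : V ≤ U) (t : F.conormal.sec V), 𝒪.res hV f • t = 0) : f = 0 := by
  obtain ⟨U₀, h₀, hU₀⟩ := hF
  apply h𝒪 U U₀ h₀
  apply 𝒪.eq_of_locally_eq
  intro x hx
  obtain ⟨V, hxV, e, he⟩ := hU₀ x hx.2
  refine ⟨U ⊓ U₀ ⊓ V, inf_le_left, ⟨hx, hxV⟩, ?_⟩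
  have hU : U ⊓ U₀ ⊓ V ≤ U := inf_le_left.trans inf_le_left
  -- On the free locus, f·e and 0·e are two expressions of the zero section, and coefficients are
  -- unique.
  obtain ⟨a, -, ha⟩ := he (U ⊓ U₀ ⊓ V) inf_le_right 0
  have e1 := ha (fun _ => 𝒪.res hU f) (by simp [h])
  have e2 := ha (fun _ => 0) (by simp)
  rw [𝒪.res_res, map_zero]
  exact congrFun (e1.trans e2.symm) 0

/-- This is the cancellation behind the uniqueness of contractions: the factor g disappears because
𝒪(-D) is locally generated by a nonzerodivisor, the factor t because the conormal sheaf is faithful.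
-/
theorem eq_of_smul_conormal (h𝒪 : 𝒪.DenseInjective) (hF : F.IsCodimOne) (D : EffectiveDivisor 𝒪)
    (f f' : 𝒪.sec U)
    (h : ∀ (V : Opens X) (hV : V ≤ U) (t : F.conormal.sec V) (g : D.ideal.toOMod.sec V),
      (g.1 * 𝒪.res hV f) • t = (g.1 * 𝒪.res hV f') • t) : f = f' := by
  rw [← sub_eq_zero]
  apply eq_zero_of_smul_conormal h𝒪 hF
  intro V hV t
  apply conormal_eq_zero_of_ideal_smul D
  intro W hW g
  have := h W (hW.trans hV) (F.conormal.res hW t) g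
  rw [F.conormal.res_smul, 𝒪.res_res, smul_smul, map_sub, mul_sub, sub_smul, this, sub_self]

/-- The evaluation of conormal forms on a vector field. -/
@[reducible] def evalForm (F : Foliation 𝒪) (w : VField 𝒪 U) : LHom F.conormal (OMod.unit 𝒪) U where
  app _ h :=
    { toFun := fun s => pair s (w.restrict h)
      map_add' := fun s t => pair_add_left s t _
      map_smul' := fun f s => pair_smul_left f s _ }
  nat _ _ _ hW s := res_pair hW s _

theorem pair_smul_comm (h𝒪 : 𝒪.DenseInjective) (hF : F.IsCodimOne) (w : VField 𝒪 U)
    (s t : F.conormal.sec U) : pair s w • t = pair t w • s :=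
  lhom_smul_comm h𝒪 hF (evalForm F w) s t

theorem pair_mul_comm (h𝒪 : 𝒪.DenseInjective) (hF : F.IsCodimOne) (w u : VField 𝒪 U)
    (s t : F.conormal.sec U) : pair s w * pair t u = pair t w * pair s u := by
  rw [← pair_smul_left, ← pair_smul_left, pair_smul_comm h𝒪 hF]

/-- The differential operator `s ↦ v(s(w))`. -/
@[reducible] def evalOp (F : Foliation 𝒪) (v w : VField 𝒪 U) : DiffOp F.conormal U where
  app V h :=
    { toFun := fun s => v.app V h (pair s (w.restrict h))
      map_zero' := by rw [pair_zero_left, map_zero]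
      map_add' := fun s t => by rw [pair_add_left, map_add] }
  nat V W hV hW s := by
    change 𝒪.res hW (v.app V hV (pair s (w.restrict hV))) =
      v.app W _ (pair (F.conormal.res hW s) _)
    rw [VField.res_app, res_pair]
  map_const V h c s := by
    change v.app V h (pair _ _) = _ * v.app V h _
    rw [pair_smul_left, Derivation.leibniz, Derivation.map_algebraMap]
    simp
  order_le_one V h f g s := by
    change v.app V h (pair _ _) - f * v.app V h (pair _ _) =
      g * (v.app V h (pair _ _) - f * v.app V h (pair _ _))
    rw [pair_smul_left, pair_smul_left, pair_smul_left]
    simp only [Derivation.leibniz, smul_eq_mul]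
    ring

end Foliation

/-! ### Symbols of differential operators of order at most one. -/

namespace DiffOp
variable {E : OMod 𝒪}

theorem symbol_act (P : DiffOp E U) (t : E.sec U) (f : 𝒪.sec U) :
    (P.symbol t).act f = (P.commutator f).app U le_rfl t := by
  change P.app U le_rfl (f • E.res _ t) - f * P.app U le_rfl (E.res _ t) =
    P.app U le_rfl (𝒪.res _ f • t) - 𝒪.res _ f * P.app U le_rfl t
  rw [E.res_self, 𝒪.res_self]

theorem symbol_app {V : Opens X} (h : V ≤ U) (P : DiffOp E U) (t : E.sec U) (f : 𝒪.sec V) :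
    (P.symbol t).app V h f = P.app V h (f • E.res h t) - f * P.app V h (E.res h t) := rfl

theorem symbol_restrict {V : Opens X} (h : V ≤ U) (P : DiffOp E U) (t : E.sec U) :
    (P.symbol t).restrict h = (P.restrict h).symbol (E.res h t) := by
  ext W hW f
  change P.app W _ (f • E.res _ t) - f * P.app W _ (E.res _ t) =
    P.app W _ (f • E.res _ (E.res _ t)) - f * P.app W _ (E.res _ (E.res _ t))
  rw [E.res_res]

theorem symbol_add_left (P Q : DiffOp E U) (t : E.sec U) :
    (P + Q).symbol t = P.symbol t + Q.symbol t := by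
  ext W hW f
  rw [VField.add_app, Derivation.add_apply, symbol_app, symbol_app, symbol_app]
  simp only [add_app, AddMonoidHom.add_apply]
  ring

theorem symbol_smul_left (a : 𝒪.sec U) (P : DiffOp E U) (t : E.sec U) :
    (a • P).symbol t = a • P.symbol t := by
  ext W hW f
  rw [VField.smul_app, Derivation.smul_apply, smul_eq_mul, symbol_app, symbol_app]
  simp only [smul_app_apply]
  ring

theorem symbol_add (P : DiffOp E U) (s t : E.sec U) :
    P.symbol (s + t) = P.symbol s + P.symbol t := by
  ext W hW f
  rw [VField.add_app, Derivation.add_apply, symbol_app, symbol_app, symbol_app]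
  simp only [map_add, smul_add]
  ring

/-- This is the axiom `order_le_one` read as a statement in t: the symbol is a morphism from E to
the tangent sheaf. -/
theorem symbol_smul (P : DiffOp E U) (a : 𝒪.sec U) (t : E.sec U) :
    P.symbol (a • t) = a • P.symbol t := by
  ext W hW f
  rw [VField.smul_app, Derivation.smul_apply, smul_eq_mul, symbol_app, symbol_app, E.res_smul]
  exact P.order_le_one W hW f (𝒪.res hW a) (E.res hW t)

theorem symbol_ofLHom (φ : LHom E (OMod.unit 𝒪) U) (t : E.sec U) : (ofLHom φ).symbol t = 0 := by
  ext W hW f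
  change φ.app W hW (f • E.res hW t) - f * φ.app W hW (E.res hW t) = 0
  rw [map_smul, smul_eq_mul, sub_self]

/-- The Leibniz rule gives v(f t(w)) - f v(t(w)) = t(w) v(f). Since the symbol only involves the
direction v, these operators isolate the component (∇_v s)(w) of a connection. -/
theorem symbol_evalOp (v w : VField 𝒪 U) (t : F.conormal.sec U) :
    (F.evalOp v w).symbol t = Foliation.pair t w • v := by
  ext W hW f
  rw [VField.smul_app, Derivation.smul_apply, smul_eq_mul, Foliation.res_pair]
  change v.app W hW (Foliation.pair _ _) - f * v.app W hW (Foliation.pair _ _) = _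
  rw [Foliation.pair_smul_left, Derivation.leibniz, smul_eq_mul, smul_eq_mul]
  ring

theorem symbol_comp (N : PartialConnection F E) (φ : LHom E (OMod.unit 𝒪) U) (v : F.tan.sec U)
    (t : E.sec U) : (N.comp φ v).symbol t = φ.app U le_rfl t • v.1 := by
  ext W hW f
  rw [VField.smul_app, Derivation.smul_apply, smul_eq_mul]
  have := φ.nat U W le_rfl hW t
  change φ.app W hW (N.along _ (f • E.res hW t)) - f * φ.app W hW (N.along _ (E.res hW t)) =
    (OMod.unit 𝒪).res hW (φ.app U le_rfl t) * _
  rw [this, N.along_smul_right, map_add, map_smul, map_smul, smul_eq_mul, smul_eq_mul,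
    add_sub_cancel_right, mul_comm]
  rfl

/-- Taking symbols turns the commutator of P with v and ∇_v into the derivative of the morphism t ↦
symb_P(t); the Leibniz terms in v(f) cancel. This links the connection on jets with the bracket in
the curvature. -/
theorem symbol_opBracket (N : PartialConnection F E) (v : F.tan.sec U) (P : DiffOp E U)
    (t : E.sec U) : (N.opBracket v P).symbol t =
      VField.bracket v.1 (P.symbol t) - P.symbol (N.along v t) := by
  ext W hW f
  rw [sub_eq_add_neg, VField.add_app, VField.neg_app, Derivation.add_apply, Derivation.neg_apply,
    Derivation.commutator_apply, symbol_app, symbol_app, symbol_app, symbol_app,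
    N.res_along]
  change (v.1.app W hW (P.app W hW (f • E.res hW t)) -
      P.app W hW (N.along (F.tan.res hW v) (f • E.res hW t))) -
      f * (v.1.app W hW (P.app W hW (E.res hW t)) -
      P.app W hW (N.along (F.tan.res hW v) (E.res hW t))) = _
  have e : VField.act (F.tan.res hW v).1 f = v.1.app W hW f := rfl
  rw [N.along_smul_right, e]
  simp only [map_sub, map_add, Derivation.leibniz, smul_eq_mul]
  ring

end DiffOp
end TransverseJets

namespace TransverseJets
variable {X : Type} [TopologicalSpace X] {𝒪 : CAlgSheaf X}
variable {F : Foliation 𝒪} {D : EffectiveDivisor 𝒪} {U : Opens X}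
open Foliation

/-! ### The contraction of a connection with the symbol of an operator -/

theorem MeromorphicConnection.mulAlong_sum_field {E : OMod 𝒪} (A : MeromorphicConnection E D)
    {ι : Type*} (I : Finset ι) (g : D.ideal.toOMod.sec U) (v : ι → VField 𝒪 U) (s : E.sec U) :
    A.mulAlong g (∑ i ∈ I, v i) s = ∑ i ∈ I, A.mulAlong g (v i) s :=
  map_sum (⟨⟨fun w => A.mulAlong g w s, A.mulAlong_zero_field g s⟩,
    fun v w => A.mulAlong_add_field g v w s⟩ : VField 𝒪 U →+ E.sec U) v I

/-- The function `c` is the contraction of the form `∇ s` with the symbol of `P`. -/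
def IsContraction (A : MeromorphicConnection F.conormal D) (s : F.conormal.sec U)
    (P : DiffOp F.conormal U) (c : 𝒪.sec U) : Prop :=
  ∀ (V : Opens X) (h : V ≤ U) (t : F.conormal.sec V) (g : D.ideal.toOMod.sec V),
    A.mulAlong g ((P.restrict h).symbol t) (F.conormal.res h s) = ((g.1 : 𝒪.sec V) * 𝒪.res h c) • t

namespace IsContraction
variable {A : MeromorphicConnection F.conormal D} {s s' : F.conormal.sec U}
  {P Q : DiffOp F.conormal U} {c c' : 𝒪.sec U}

theorem unique (h𝒪 : 𝒪.DenseInjective) (hF : F.IsCodimOne) (h : IsContraction A s P c)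
    (h' : IsContraction A s P c') : c = c' :=
  eq_of_smul_conormal h𝒪 hF D c c' fun V hV t g => (h V hV t g).symm.trans (h' V hV t g)

theorem res (h : IsContraction A s P c) {V : Opens X} (hV : V ≤ U) :
    IsContraction A (F.conormal.res hV s) (P.restrict hV) (𝒪.res hV c) := by
  intro W hW t g
  rw [F.conormal.res_res, 𝒪.res_res]
  exact h W (hW.trans hV) t g

theorem add_op (h : IsContraction A s P c) (h' : IsContraction A s Q c') :
    IsContraction A s (P + Q) (c + c') := by
  intro V hV t g
  have e : DiffOp.restrict hV (P + Q) = P.restrict hV + Q.restrict hV := rfl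
  rw [e, DiffOp.symbol_add_left, A.mulAlong_add_field, h, h', map_add, mul_add, add_smul]

theorem smul_op (a : 𝒪.sec U) (h : IsContraction A s P c) :
    IsContraction A s (a • P) (a * c) := by
  intro V hV t g
  have e : DiffOp.restrict hV (a • P) = 𝒪.res hV a • P.restrict hV :=
    (diffOps F.conormal).res_smul hV a P
  rw [e, DiffOp.symbol_smul_left, A.mulAlong_smul_field, h, map_mul, smul_smul]
  congr 1
  ring

theorem add_sec (h : IsContraction A s P c) (h' : IsContraction A s' P c') :
    IsContraction A (s + s') P (c + c') := by
  intro V hV t g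
  rw [map_add, A.mulAlong_add, h, h', map_add, mul_add, add_smul]

theorem smul_sec (h𝒪 : 𝒪.DenseInjective) (hF : F.IsCodimOne) (f : 𝒪.sec U)
    (h : IsContraction A s P c) :
    IsContraction A (f • s) P ((P.commutator f).app U le_rfl s + f * c) := by
  intro V hV t g
  have e : 𝒪.res hV ((P.commutator f).app U le_rfl s) =
      ((P.restrict hV).commutator (𝒪.res hV f)).app V le_rfl (F.conormal.res hV s) := by
    refine ((P.commutator f).nat U V le_rfl hV s).trans ?_
    change P.app V _ (𝒪.res hV f • _) - 𝒪.res hV f * P.app V _ _ =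
      P.app V _ (𝒪.res le_rfl (𝒪.res hV f) • _) - 𝒪.res le_rfl (𝒪.res hV f) * P.app V _ _
    rw [𝒪.res_self]
  rw [F.conormal.res_smul, A.mulAlong_smul, h, map_add, map_mul, e, DiffOp.symbol_act]
  -- Differentiating f s in the direction symb_P(t) produces [P,f](t) s; rank one rewrites it as
  -- [P,f](s) t, a multiple of t as required.
  have := lhom_smul_comm h𝒪 hF ((P.restrict hV).commutator (𝒪.res hV f)) t (F.conormal.res hV s)
  rw [mul_comm _ (g.1 : 𝒪.sec V), mul_smul, this, smul_smul, smul_smul, ← add_smul]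
  congr 1
  ring

theorem ofLHom (A : MeromorphicConnection F.conormal D) (s : F.conormal.sec U)
    (φ : LHom F.conormal (OMod.unit 𝒪) U) : IsContraction A s (DiffOp.ofLHom φ) 0 := by
  intro V hV t g
  have e : DiffOp.restrict hV (DiffOp.ofLHom φ) = DiffOp.ofLHom (φ.restrict hV) := rfl
  rw [e, DiffOp.symbol_ofLHom, A.mulAlong_zero_field, map_zero, mul_zero, zero_smul]

/-- The symbol of φ∘∇_v is t ↦ φ(t)v, and along v the connection is the given partial one, so the
contraction is defined by φ(t)∇_v s = φ(∇_v s)t. This makes P(s) - c(s,P) vanish on the generators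
of S¹(∇). -/
theorem comp (h𝒪 : 𝒪.DenseInjective) (hF : F.IsCodimOne) {N : PartialConnection F F.conormal}
    (hA : A.Extends N) (s : F.conormal.sec U)
    (φ : LHom F.conormal (OMod.unit 𝒪) U) (v : F.tan.sec U) :
    IsContraction A s (N.comp φ v) (φ.app U le_rfl (N.along v s)) := by
  intro V hV t g
  have e : DiffOp.restrict hV (N.comp φ v) = N.comp (φ.restrict hV) (F.tan.res hV v) := by
    apply DiffOp.ext; funext W hW; apply AddMonoidHom.ext; intro x; rfl
  have e1 : A.mulAlong g (F.tan.res hV v).1 (F.conormal.res hV s) =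
      (g.1 : 𝒪.sec V) • N.along (F.tan.res hV v) (F.conormal.res hV s) := by
    have := (A.along_eq_toPoles_iff _ _ _).1 (hA V (F.tan.res hV v) (F.conormal.res hV s)) V le_rfl g
    simp only [F.conormal.res_self] at this
    exact this
  have e2 : 𝒪.res hV (φ.app U le_rfl (N.along v s)) =
      (φ.restrict hV).app V le_rfl (N.along (F.tan.res hV v) (F.conormal.res hV s)) := by
    rw [← N.res_along]
    exact φ.nat U V le_rfl hV _
  rw [e, DiffOp.symbol_comp, A.mulAlong_smul_field, e1, e2, smul_comm,
    lhom_smul_comm h𝒪 hF, smul_smul]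

/-- In this case c is the function (∇_v s)(w), so contractions with the operators `evalOp` contain
all components of ∇s. -/
theorem evalOp_iff (h𝒪 : 𝒪.DenseInjective) (hF : F.IsCodimOne) (v w : VField 𝒪 U) :
    IsContraction A s (evalOp F v w) c ↔ ∀ (V : Opens X) (h : V ≤ U) (g : D.ideal.toOMod.sec V),
      pair (A.mulAlong g (v.restrict h) (F.conormal.res h s)) (w.restrict h) =
        (g.1 : 𝒪.sec V) * 𝒪.res h c := by
  have e : ∀ (V : Opens X) (h : V ≤ U) (g : D.ideal.toOMod.sec V) (t : F.conormal.sec V),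
      A.mulAlong g ((DiffOp.restrict h (evalOp F v w)).symbol t) (F.conormal.res h s) =
      pair (A.mulAlong g (v.restrict h) (F.conormal.res h s)) (w.restrict h) • t := by
    intro V h g t
    have e : DiffOp.restrict h (evalOp F v w) = evalOp F (v.restrict h) (w.restrict h) := rfl
    rw [e, DiffOp.symbol_evalOp, A.mulAlong_smul_field]
    exact pair_smul_comm h𝒪 hF _ _ _
  constructor
  · intro hc V h g
    rw [← sub_eq_zero]
    apply eq_zero_of_smul_conormal h𝒪 hF
    intro W hW t
    have := hc W (hW.trans h) t (D.ideal.toOMod.res hW g)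
    rw [e] at this
    rw [map_sub, sub_smul, res_pair, A.res_mulAlong, F.conormal.res_res, map_mul, 𝒪.res_res]
    exact sub_eq_zero.2 this
  · intro hc V h t g
    rw [e, hc]

end IsContraction

/-! ### Existence of contractions for sections of E(-D). -/

/-- The pole is absorbed by the coefficient: ∇_v(g₀t₀) = v(g₀)t₀ + g₀∇_v t₀, and g₀∇_v t₀ is a
section of E for g₀ in 𝒪(-D). -/
theorem exists_toPoles_of_mem_span {E : OMod 𝒪} (A : MeromorphicConnection E D) (s : E.sec U)
    (hs : s ∈ Submodule.span (𝒪.sec U) {t | ∃ g ∈ D.ideal.carrier U, ∃ t₀ : E.sec U, t = g • t₀})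
    (v : VField 𝒪 U) : ∃ t : E.sec U, A.along v s = E.toPoles D t := by
  simp only [A.along_eq_toPoles_iff]
  induction hs using Submodule.span_induction with
  | mem s h =>
    obtain ⟨g₀, hg₀, t₀, rfl⟩ := h
    refine ⟨v.act g₀ • t₀ + A.mulAlong ⟨g₀, hg₀⟩ v t₀, fun V h g => ?_⟩
    have := A.mulAlong_comm (D.ideal.toOMod.res h ⟨g₀, hg₀⟩) g (v.restrict h) (E.res h t₀)
    rw [E.res_smul, A.mulAlong_smul, map_add, E.res_smul, A.res_mulAlong, smul_add, ← this,
      VField.res_act, smul_smul, mul_comm]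
    rfl
  | zero => exact ⟨0, fun V h g => by rw [map_zero, A.mulAlong_zero, smul_zero]⟩
  | add a b _ _ ha hb =>
    obtain ⟨ta, ha⟩ := ha
    obtain ⟨tb, hb⟩ := hb
    exact ⟨ta + tb, fun V h g => by
      rw [map_add, map_add, A.mulAlong_add, ha, hb, smul_add]⟩
  | smul f a _ ha =>
    obtain ⟨ta, ha⟩ := ha
    exact ⟨v.act f • a + f • ta, fun V h g => by
      rw [E.res_smul, map_add, E.res_smul, E.res_smul, A.mulAlong_smul, ha, smul_add, VField.res_act]
      congr 1
      · rw [mul_comm, mul_smul]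
      · rw [smul_comm]⟩

theorem exists_isContraction_of_frame (h𝒪 : 𝒪.DenseInjective) (hF : F.IsCodimOne)
    (A : MeromorphicConnection F.conormal D) (s : F.conormal.sec U)
    (hs : s ∈ Submodule.span (𝒪.sec U)
      {t | ∃ g ∈ D.ideal.carrier U, ∃ t₀ : F.conormal.sec U, t = g • t₀})
    {n : ℕ} (y : Fin n → 𝒪.sec U) (e : Fin n → VField 𝒪 U)
    (he : ∀ (W : Opens X) (hW : W ≤ U) (v : VField 𝒪 W),
      v = ∑ i, v.act (𝒪.res hW (y i)) • VField.restrict hW (e i))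
    (P : DiffOp F.conormal U) : ∃ c, IsContraction A s P c := by
  choose t ht using fun i => exists_toPoles_of_mem_span A s hs (e i)
  simp only [A.along_eq_toPoles_iff] at ht
  -- With tᵢ = ∇_{eᵢ}s, expanding symb_P(x) in the frame gives ∇_{symb_P(x)}s = ∑ [P,yᵢ](x) tᵢ, and
  -- rank one turns this into ∑ [P,yᵢ](tᵢ) x.
  refine ⟨∑ i, (P.commutator (y i)).app U le_rfl (t i), fun V h x g => ?_⟩
  rw [he V h ((P.restrict h).symbol x), A.mulAlong_sum_field, map_sum, Finset.mul_sum,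
    Finset.sum_smul]
  refine Finset.sum_congr rfl fun i _ => ?_
  have e1 : 𝒪.res h ((P.commutator (y i)).app U le_rfl (t i)) =
      ((P.restrict h).commutator (𝒪.res h (y i))).app V le_rfl (F.conormal.res h (t i)) := by
    refine ((P.commutator (y i)).nat U V le_rfl h (t i)).trans ?_
    change P.app V _ (𝒪.res h (y i) • _) - 𝒪.res h (y i) * P.app V _ _ =
      P.app V _ (𝒪.res le_rfl (𝒪.res h (y i)) • _) - 𝒪.res le_rfl (𝒪.res h (y i)) * P.app V _ _
    rw [𝒪.res_self]
  rw [A.mulAlong_smul_field, ht, DiffOp.symbol_act, smul_comm, e1, lhom_smul_comm h𝒪 hF,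
    smul_smul]

/-- Frames, and expressions of s as a combination of products gt₀, exist only locally. Contractions
are unique, so the local ones glue. -/
theorem exists_isContraction (h𝒪 : 𝒪.DenseInjective) (hT : 𝒪.HasLocalFrames)
    (hF : F.IsCodimOne) (A : MeromorphicConnection F.conormal D) (s : (F.conormal.neg D).sec U)
    (P : DiffOp F.conormal U) : ∃ c, IsContraction A s.1 P c := by
  have hloc : ∀ x : U, ∃ (V : Opens X) (h : V ≤ U), x.1 ∈ V ∧
      ∃ c, IsContraction A (F.conormal.res h s.1) (P.restrict h) c := by
    intro x
    obtain ⟨V, hV, hxV, hs⟩ := s.2 x.1 x.2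
    obtain ⟨W, hxW, n, y, e, he⟩ := hT x.1
    refine ⟨V ⊓ W, inf_le_left.trans hV, ⟨hxV, hxW⟩, ?_⟩
    apply exists_isContraction_of_frame h𝒪 hF A _ _ (fun i => 𝒪.res inf_le_right (y i))
      (fun i => VField.restrict inf_le_right (e i))
    · intro W' hW' v
      simp only [𝒪.res_res]
      exact he W' (hW'.trans inf_le_right) v
    · rw [← F.conormal.res_res hV inf_le_left]
      generalize F.conormal.res hV s.1 = t at hs
      induction hs using Submodule.span_induction with
      | mem t h =>
        obtain ⟨g, hg, t₀, rfl⟩ := h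
        exact Submodule.subset_span ⟨_, D.ideal.res_mem _ hg, _, F.conormal.res_smul _ g t₀⟩
      | zero => rw [map_zero]; exact zero_mem _
      | add a b _ _ ha hb => rw [map_add]; exact add_mem ha hb
      | smul f a _ ha => rw [F.conormal.res_smul]; exact Submodule.smul_mem _ _ ha
  choose V hV hxV c hc using hloc
  obtain ⟨c', hc', -⟩ := 𝒪.existsUnique_glue U V hV
    (fun x hx => Opens.mem_iSup.2 ⟨⟨x, hx⟩, hxV ⟨x, hx⟩⟩) c (by
      intro i j
      have hi := (hc i).res (inf_le_left : V i ⊓ V j ≤ V i)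
      have hj := (hc j).res (inf_le_right : V i ⊓ V j ≤ V j)
      rw [F.conormal.res_res] at hi hj
      exact hi.unique h𝒪 hF hj)
  refine ⟨c', fun W hW t g => ?_⟩
  apply conormal_eq_of_locally_eq
  intro x hx
  refine ⟨W ⊓ V ⟨x, hW hx⟩, inf_le_left, ⟨hx, hxV ⟨x, hW hx⟩⟩, ?_⟩
  have := hc ⟨x, hW hx⟩ _ (inf_le_right : W ⊓ V ⟨x, hW hx⟩ ≤ _) (F.conormal.res inf_le_left t)
    (D.ideal.toOMod.res inf_le_left g)
  rw [← hc', 𝒪.res_res, F.conormal.res_res] at this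
  rw [A.res_mulAlong, DiffOp.symbol_restrict, F.conormal.res_res, F.conormal.res_smul, map_mul,
    𝒪.res_res]
  exact this

/-- The contraction of `∇ s` with the symbol of `P`, for a section `s` of `E(-D)`. -/
noncomputable def contraction (h𝒪 : 𝒪.DenseInjective) (hT : 𝒪.HasLocalFrames)
    (hF : F.IsCodimOne) (A : MeromorphicConnection F.conormal D) (s : (F.conormal.neg D).sec U)
    (P : DiffOp F.conormal U) : 𝒪.sec U :=
  (exists_isContraction h𝒪 hT hF A s P).choose

theorem isContraction_contraction (h𝒪 : 𝒪.DenseInjective) (hT : 𝒪.HasLocalFrames)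
    (hF : F.IsCodimOne) (A : MeromorphicConnection F.conormal D) (s : (F.conormal.neg D).sec U)
    (P : DiffOp F.conormal U) : IsContraction A s.1 P (contraction h𝒪 hT hF A s P) :=
  (exists_isContraction h𝒪 hT hF A s P).choose_spec

/-! ### The jet of a splitting -/

section Jet
variable {N : PartialConnection F F.conormal}

/-- The value of `σ(s)` at the operator `P`. -/
def jet (σ : LHom (F.conormal.neg D) (transverseJet N) ⊤) (s : (F.conormal.neg D).sec U)
    (P : DiffOp F.conormal U) : 𝒪.sec U := (σ.app U le_top s).1.app U le_rfl P

variable (σ : LHom (F.conormal.neg D) (transverseJet N) ⊤)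

theorem app_eq_jet (s : (F.conormal.neg D).sec U) {V : Opens X} (h : V ≤ U)
    (P : DiffOp F.conormal V) :
    (σ.app U le_top s).1.app V h P = jet σ ((F.conormal.neg D).res h s) P := by
  have := σ.nat U V le_top h s
  exact congrArg (fun ξ : (transverseJet N).sec V => ξ.1.app V le_rfl P) this

theorem res_jet (s : (F.conormal.neg D).sec U) {V : Opens X} (h : V ≤ U)
    (P : DiffOp F.conormal U) :
    𝒪.res h (jet σ s P) = jet σ ((F.conormal.neg D).res h s) (P.restrict h) :=
  ((σ.app U le_top s).1.nat U V le_rfl h P).trans (app_eq_jet σ s h _)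

theorem jet_add_left (s t : (F.conormal.neg D).sec U) (P : DiffOp F.conormal U) :
    jet σ (s + t) P = jet σ s P + jet σ t P :=
  congrArg (fun ξ : (transverseJet N).sec U => ξ.1.app U le_rfl P)
    (map_add (σ.app U le_top) s t)

theorem jet_smul_left (f : 𝒪.sec U) (s : (F.conormal.neg D).sec U) (P : DiffOp F.conormal U) :
    jet σ (f • s) P = f * jet σ s P := by
  refine (congrArg (fun ξ : (transverseJet N).sec U => ξ.1.app U le_rfl P)
    (map_smul (σ.app U le_top) f s)).trans ?_
  change 𝒪.res le_rfl f * jet σ s P = _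
  rw [𝒪.res_self]

theorem jet_add (s : (F.conormal.neg D).sec U) (P Q : DiffOp F.conormal U) :
    jet σ s (P + Q) = jet σ s P + jet σ s Q := map_add _ _ _

theorem jet_neg (s : (F.conormal.neg D).sec U) (P : DiffOp F.conormal U) :
    jet σ s (-P) = -jet σ s P := map_neg ((σ.app U le_top s).1.app U le_rfl) P

theorem jet_zero (s : (F.conormal.neg D).sec U) : jet σ s 0 = 0 :=
  map_zero ((σ.app U le_top s).1.app U le_rfl)

theorem jet_smul (s : (F.conormal.neg D).sec U) (f : 𝒪.sec U) (P : DiffOp F.conormal U) :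
    jet σ s (f • P) = f * jet σ s P := map_smul ((σ.app U le_top s).1.app U le_rfl) f P

theorem jet_comp (s : (F.conormal.neg D).sec U) (φ : LHom F.conormal (OMod.unit 𝒪) U)
    (v : F.tan.sec U) : jet σ s (N.comp φ v) = 0 :=
  (σ.app U le_top s).2 U le_rfl φ v

theorem jet_ext {σ σ' : LHom (F.conormal.neg D) (transverseJet N) ⊤}
    (h : ∀ (U : Opens X) (s : (F.conormal.neg D).sec U) (P : DiffOp F.conormal U),
      jet σ s P = jet σ' s P) : σ = σ' := by
  apply LHom.ext; funext U hU; apply LinearMap.ext; intro s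
  apply Subtype.ext; apply LHom.ext; funext V hV; apply LinearMap.ext; intro P
  exact (app_eq_jet σ s hV P).trans ((h _ _ _).trans (app_eq_jet σ' s hV P).symm)

variable (σ : MeromorphicSplitting N D)

theorem jet_ofLHom (s : (F.conormal.neg D).sec U) (φ : LHom F.conormal (OMod.unit 𝒪) U) :
    jet σ.1 s (DiffOp.ofLHom φ) = φ.app U le_rfl s.1 := by
  have := σ.2 U s U le_rfl φ
  rwa [F.conormal.res_self] at this

theorem DiffOp.exists_eq_ofLHom {E : OMod 𝒪} (P : DiffOp E U)
    (hP : ∀ (V : Opens X) (h : V ≤ U) (t : E.sec V), (P.restrict h).symbol t = 0) :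
    ∃ φ, P = DiffOp.ofLHom φ := by
  refine ⟨⟨fun V h => { P.app V h with
    map_smul' := fun f s => ?_ }, P.nat⟩, ?_⟩
  · have := congrArg (fun v : VField 𝒪 V => v.act f) (hP V h s)
    have h2 := DiffOp.symbol_app le_rfl (P.restrict h) s f
    rw [E.res_self] at h2
    exact sub_eq_zero.1 (h2.symm.trans this)
  · rfl

/-- An operator with zero symbol is 𝒪-linear, and on linear forms the value of σ(s) is imposed by
the condition that π∘σ is the inclusion. -/
theorem jet_of_symbol_eq_zero (s : (F.conormal.neg D).sec U) (P : DiffOp F.conormal U)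
    (hP : ∀ (V : Opens X) (h : V ≤ U) (t : F.conormal.sec V), (P.restrict h).symbol t = 0) :
    jet σ.1 s P = P.app U le_rfl s.1 := by
  obtain ⟨φ, rfl⟩ := P.exists_eq_ofLHom hP
  exact jet_ofLHom σ s φ

end Jet

/-! ### The splitting of a connection -/

section Splitting
variable (h𝒪 : 𝒪.DenseInjective) (hT : 𝒪.HasLocalFrames) (hF : F.IsCodimOne)
variable {N : PartialConnection F F.conormal} {A : MeromorphicConnection F.conormal D}
  (hA : A.Extends N)

/-- The linear form `P ↦ P(s) - c(s, P)` on differential operators. -/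
noncomputable def jetForm (A : MeromorphicConnection F.conormal D)
    (s : (F.conormal.neg D).sec U) : LHom (diffOps F.conormal) (OMod.unit 𝒪) U where
  app V h :=
    { toFun := fun P => P.app V le_rfl (F.conormal.res h s.1) -
        contraction h𝒪 hT hF A ((F.conormal.neg D).res h s) P
      map_add' := fun P Q => by
        have := (isContraction_contraction h𝒪 hT hF A ((F.conormal.neg D).res h s) (P + Q)).unique
          h𝒪 hF ((isContraction_contraction h𝒪 hT hF A _ P).add_op
            (isContraction_contraction h𝒪 hT hF A _ Q))
        rw [this, DiffOp.add_app, AddMonoidHom.add_apply]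
        ring
      map_smul' := fun f P => by
        have := (isContraction_contraction h𝒪 hT hF A ((F.conormal.neg D).res h s) (f • P)).unique
          h𝒪 hF ((isContraction_contraction h𝒪 hT hF A _ P).smul_op f)
        rw [this, DiffOp.smul_app_apply, 𝒪.res_self, RingHom.id_apply, smul_eq_mul]
        ring }
  nat V W hV hW P := by
    have := ((isContraction_contraction h𝒪 hT hF A ((F.conormal.neg D).res hV s) P).res hW).unique
      h𝒪 hF (c' := contraction h𝒪 hT hF A ((F.conormal.neg D).res (hW.trans hV) s) (P.restrict hW))
      (by
        have := isContraction_contraction h𝒪 hT hF A ((F.conormal.neg D).res (hW.trans hV) s)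
          (P.restrict hW)
        rw [← (F.conormal.neg D).res_res hV hW] at this ⊢
        exact this)
    change 𝒪.res hW (P.app V le_rfl (F.conormal.res hV s.1) - contraction h𝒪 hT hF A _ P) =
      P.app W _ (F.conormal.res (hW.trans hV) s.1) - contraction h𝒪 hT hF A _ _
    rw [map_sub, this, P.nat V W le_rfl hW, F.conormal.res_res]
    rfl

include hA in
theorem jetForm_mem (s : (F.conormal.neg D).sec U) :
    jetForm h𝒪 hT hF A s ∈ (transverseJetSub N).carrier U := by
  intro V h φ v
  have := (isContraction_contraction h𝒪 hT hF A ((F.conormal.neg D).res h s) (N.comp φ v)).unique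
    h𝒪 hF (IsContraction.comp h𝒪 hF hA _ φ v)
  change φ.app V le_rfl (N.along (F.tan.res le_rfl v) (F.conormal.res h s.1)) -
    contraction h𝒪 hT hF A _ _ = 0
  rw [this, F.tan.res_self, sub_eq_zero]
  rfl

/-- The splitting `d¹ - ∇` of a meromorphic connection `∇` extending `N`. -/
noncomputable def splittingHom : LHom (F.conormal.neg D) (transverseJet N) ⊤ where
  app U _ :=
    { toFun := fun s => ⟨jetForm h𝒪 hT hF A s, jetForm_mem h𝒪 hT hF hA s⟩
      map_add' := fun s t => by
        apply Subtype.ext; apply LHom.ext; funext V h; apply LinearMap.ext; intro P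
        have := (isContraction_contraction h𝒪 hT hF A ((F.conormal.neg D).res h (s + t)) P).unique
          h𝒪 hF (c' := contraction h𝒪 hT hF A ((F.conormal.neg D).res h s) P +
            contraction h𝒪 hT hF A ((F.conormal.neg D).res h t) P) (by
          have := (isContraction_contraction h𝒪 hT hF A ((F.conormal.neg D).res h s) P).add_sec
            (isContraction_contraction h𝒪 hT hF A ((F.conormal.neg D).res h t) P)
          rw [AddMonoidHom.map_add]
          exact this)
        change P.app V le_rfl (F.conormal.res h (s.1 + t.1)) - contraction h𝒪 hT hF A _ P =
          (P.app V le_rfl (F.conormal.res h s.1) - contraction h𝒪 hT hF A _ P) +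
          (P.app V le_rfl (F.conormal.res h t.1) - contraction h𝒪 hT hF A _ P)
        rw [this, map_add, map_add]
        ring
      -- Neither P(s) nor c(s,P) is linear in s, but both deviate by the same term [P,f](s), which
      -- cancels in the difference.
      map_smul' := fun f s => by
        apply Subtype.ext; apply LHom.ext; funext V h; apply LinearMap.ext; intro P
        have := (isContraction_contraction h𝒪 hT hF A ((F.conormal.neg D).res h (f • s)) P).unique
          h𝒪 hF (c' := (P.commutator (𝒪.res h f)).app V le_rfl (F.conormal.res h s.1) +
            𝒪.res h f * contraction h𝒪 hT hF A ((F.conormal.neg D).res h s) P) (by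
          have := (isContraction_contraction h𝒪 hT hF A ((F.conormal.neg D).res h s) P).smul_sec
            h𝒪 hF (𝒪.res h f)
          rw [(F.conormal.neg D).res_smul]
          exact this)
        change P.app V le_rfl (F.conormal.res h (f • s.1)) - contraction h𝒪 hT hF A _ P =
          𝒪.res h f * (P.app V le_rfl (F.conormal.res h s.1) - contraction h𝒪 hT hF A _ P)
        rw [this, F.conormal.res_smul]
        change P.app V le_rfl (𝒪.res h f • F.conormal.res h s.1) -
          (P.app V le_rfl (𝒪.res le_rfl (𝒪.res h f) • F.conormal.res h s.1) -
            𝒪.res le_rfl (𝒪.res h f) * P.app V le_rfl (F.conormal.res h s.1) + _) = _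
        rw [𝒪.res_self]
        ring }
  nat U V hU hV s := by
    apply Subtype.ext; apply LHom.ext; funext W h; apply LinearMap.ext; intro P
    have e : (F.conormal.neg D).res (h.trans hV) s =
      (F.conormal.neg D).res h ((F.conormal.neg D).res hV s) := by
      rw [(F.conormal.neg D).res_res]
    change P.app W le_rfl ((F.conormal.neg D).res (h.trans hV) s).1 -
        contraction h𝒪 hT hF A ((F.conormal.neg D).res (h.trans hV) s) P =
      P.app W le_rfl ((F.conormal.neg D).res h ((F.conormal.neg D).res hV s)).1 -
        contraction h𝒪 hT hF A ((F.conormal.neg D).res h ((F.conormal.neg D).res hV s)) P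
    rw [e]

theorem jet_splittingHom (s : (F.conormal.neg D).sec U) (P : DiffOp F.conormal U) :
    jet (splittingHom h𝒪 hT hF hA) s P =
      P.app U le_rfl s.1 - contraction h𝒪 hT hF A s P := by
  change P.app U le_rfl ((F.conormal.neg D).res le_rfl s).1 -
    contraction h𝒪 hT hF A ((F.conormal.neg D).res le_rfl s) P = _
  rw [(F.conormal.neg D).res_self]

theorem isContraction_jet_splittingHom (s : (F.conormal.neg D).sec U) (P : DiffOp F.conormal U) :
    IsContraction A s.1 P (P.app U le_rfl s.1 - jet (splittingHom h𝒪 hT hF hA) s P) := by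
  rw [jet_splittingHom, sub_sub_cancel]
  exact isContraction_contraction h𝒪 hT hF A s P

/-- The meromorphic splitting `d¹ - ∇` of a meromorphic connection `∇` extending `N`. -/
noncomputable def splitting : MeromorphicSplitting N D :=
  ⟨splittingHom h𝒪 hT hF hA, fun U s V h φ => by
    rw [app_eq_jet, jet_splittingHom,
      (isContraction_contraction h𝒪 hT hF A _ _).unique h𝒪 hF (IsContraction.ofLHom A _ φ),
      sub_zero]
    rfl⟩

end Splitting
end TransverseJets

namespace TransverseJets
variable {X : Type} [TopologicalSpace X] {𝒪 : CAlgSheaf X}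
variable {F : Foliation 𝒪} {D : EffectiveDivisor 𝒪} {U : Opens X}
open Foliation

/-! ### The connection of a splitting -/

theorem VField.act_map_add (v : VField 𝒪 U) (f g : 𝒪.sec U) :
    v.act (f + g) = v.act f + v.act g := map_add _ f g

theorem VField.act_mul (v : VField 𝒪 U) (f g : 𝒪.sec U) :
    v.act (f * g) = f * v.act g + g * v.act f := Derivation.leibniz _ f g

/-- The section `g s` of `E(-D)`. -/
def OMod.smulNeg {E : OMod 𝒪} (g : D.ideal.toOMod.sec U) (s : E.sec U) : (E.neg D).sec U :=
  ⟨(g.1 : 𝒪.sec U) • s, fun _ hx => ⟨U, le_rfl, hx, by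
    rw [E.res_self]
    exact Submodule.subset_span ⟨g.1, g.2, s, rfl⟩⟩⟩

namespace OMod
variable {E : OMod 𝒪}

theorem smulNeg_add_left (g g' : D.ideal.toOMod.sec U) (s : E.sec U) :
    smulNeg (g + g') s = smulNeg g s + smulNeg g' s := Subtype.ext (add_smul g.1 g'.1 s)

theorem smulNeg_smul_left (f : 𝒪.sec U) (g : D.ideal.toOMod.sec U) (s : E.sec U) :
    smulNeg (f • g) s = f • smulNeg g s := Subtype.ext (mul_smul f g.1 s)

theorem smulNeg_add (g : D.ideal.toOMod.sec U) (s t : E.sec U) :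
    smulNeg g (s + t) = smulNeg g s + smulNeg g t := Subtype.ext (smul_add g.1 s t)

theorem smulNeg_smul (f : 𝒪.sec U) (g : D.ideal.toOMod.sec U) (s : E.sec U) :
    smulNeg g (f • s) = f • smulNeg g s := Subtype.ext (smul_comm g.1 f s)

theorem smulNeg_val (g : D.ideal.toOMod.sec U) (s : (E.neg D).sec U) :
    smulNeg g s.1 = (g.1 : 𝒪.sec U) • s := rfl

theorem res_smulNeg {V : Opens X} (h : V ≤ U) (g : D.ideal.toOMod.sec U) (s : E.sec U) :
    (E.neg D).res h (smulNeg g s) = smulNeg (D.ideal.toOMod.res h g) (E.res h s) :=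
  Subtype.ext (E.res_smul h g.1 s)

end OMod

theorem evalOp_add_left (v v' w : VField 𝒪 U) :
    evalOp F (v + v') w = evalOp F v w + evalOp F v' w := rfl

theorem evalOp_smul_left (f : 𝒪.sec U) (v w : VField 𝒪 U) :
    evalOp F (f • v) w = f • evalOp F v w := rfl

theorem evalOp_add_right (v w w' : VField 𝒪 U) :
    evalOp F v (w + w') = evalOp F v w + evalOp F v w' := by
  apply DiffOp.ext; funext V h; apply AddMonoidHom.ext; intro s
  change v.app V h (pair s (w.restrict h + w'.restrict h)) =
    v.app V h (pair s (w.restrict h)) + v.app V h (pair s (w'.restrict h))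
  rw [pair_add_right, map_add]

/-- The deviation from linearity in w has order zero, where the values of a splitting are known; so
the form built from σ below can be corrected to be linear in w. -/
theorem evalOp_smul_right (f : 𝒪.sec U) (v w : VField 𝒪 U) :
    evalOp F v (f • w) = f • evalOp F v w + DiffOp.ofLHom (v.act f • evalForm F w) := by
  apply DiffOp.ext; funext V h; apply AddMonoidHom.ext; intro s
  have e : VField.restrict h (f • w) = 𝒪.res h f • w.restrict h := (tangent 𝒪).res_smul h f w
  change v.app V h (pair s (VField.restrict h (f • w))) =
    𝒪.res h f * v.app V h (pair s (w.restrict h)) + 𝒪.res h (v.act f) * pair s (w.restrict h)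
  rw [e, pair_smul_right, Derivation.leibniz, VField.res_app, smul_eq_mul, smul_eq_mul]
  ring

theorem evalOp_tan (v : VField 𝒪 U) (w : F.tan.sec U) : evalOp F v w.1 = 0 := by
  apply DiffOp.ext; funext V h; apply AddMonoidHom.ext; intro s
  change v.app V h (pair s (F.tan.res h w).1) = 0
  rw [pair_tan, map_zero]

theorem pair_bott_along (v : F.tan.sec U) (s : F.conormal.sec U) (w : VField 𝒪 U) :
    pair ((bott F).along v s) w = v.1.act (pair s w) - pair s (VField.bracket v.1 w) := rfl

/-- This is v(s(w)) = (L_v s)(w) + s([v,w]): modulo S¹(∇), the operator has order zero when v is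
tangent to the foliation. -/
theorem evalOp_eq_comp (v : F.tan.sec U) (w : VField 𝒪 U) :
    evalOp F v.1 w = (bott F).comp (evalForm F w) v +
      DiffOp.ofLHom (evalForm F (VField.bracket v.1 w)) := by
  apply DiffOp.ext; funext V h; apply AddMonoidHom.ext; intro s
  change v.1.app V h (pair s (w.restrict h)) =
    pair ((bott F).along (F.tan.res h v) s) (w.restrict h) +
      pair s (VField.bracket (v.1.restrict h) (w.restrict h))
  rw [pair_bott_along]
  exact (sub_add_cancel _ _).symm

section OfSplitting
variable {N : PartialConnection F F.conormal} (σ : MeromorphicSplitting N D)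

theorem jet_evalOp_smul_right (s : (F.conormal.neg D).sec U) (f : 𝒪.sec U) (v w : VField 𝒪 U) :
    jet σ.1 s (evalOp F v (f • w)) = f * jet σ.1 s (evalOp F v w) + v.act f * pair s.1 w := by
  rw [evalOp_smul_right, jet_add, jet_smul, jet_ofLHom]
  congr 1
  change 𝒪.res le_rfl (v.act f) * pair s.1 w = _
  rw [𝒪.res_self]

/-- The section `g ∇_v s` of the connection defined by a splitting. -/
def mulAlongOfSplitting (g : D.ideal.toOMod.sec U) (v : VField 𝒪 U) (s : F.conormal.sec U) :
    F.conormal.sec U :=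
  ⟨{ app := fun V h =>
      { toFun := fun w => (D.ideal.toOMod.res h g).1 *
            v.app V h (pair (F.conormal.res h s) w) -
          jet σ.1 ((F.conormal.neg D).res h (OMod.smulNeg g s)) (evalOp F (v.restrict h) w)
        map_add' := fun w w' => by
          rw [pair_add_right, map_add, evalOp_add_right, jet_add]
          ring
        -- The term g v(f) s(w) from the Leibniz rule cancels against v(f)·(gs)(w), the value of
        -- σ(gs) on the operator of order zero v(f)·ev_w.
        map_smul' := fun f w => by
          have e : (v.restrict h).act f = v.app V h f := rfl
          have e' : pair ((F.conormal.neg D).res h (OMod.smulNeg g s)).1 w =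
              (D.ideal.toOMod.res h g).1 * pair (F.conormal.res h s) w := by
            rw [OMod.res_smulNeg]
            exact pair_smul_left _ _ _
          rw [pair_smul_right, Derivation.leibniz, jet_evalOp_smul_right, e, e', smul_eq_mul,
            smul_eq_mul, RingHom.id_apply, smul_eq_mul]
          ring }
     nat := fun V W hV hW w => by
      change 𝒪.res hW ((D.ideal.toOMod.res hV g).1 *
            v.app V hV (pair (F.conormal.res hV s) w) -
          jet σ.1 ((F.conormal.neg D).res hV (OMod.smulNeg g s)) (evalOp F (v.restrict hV) w)) =
        (D.ideal.toOMod.res (hW.trans hV) g).1 *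
            v.app W _ (pair (F.conormal.res (hW.trans hV) s) (w.restrict hW)) -
          jet σ.1 ((F.conormal.neg D).res (hW.trans hV) (OMod.smulNeg g s))
            (evalOp F (v.restrict (hW.trans hV)) (w.restrict hW))
      rw [map_sub, map_mul, VField.res_app, res_pair, res_jet, F.conormal.res_res,
        (F.conormal.neg D).res_res, ← D.ideal.toOMod.res_res hV hW]
      rfl },
   -- The form is conormal: s(w) = 0 for w tangent to the foliation, so both s ↦ v(s(w)) and the
   -- first term vanish.
   fun V h w hw => by
    have e1 := evalOp_tan (F := F) (v.restrict h) ⟨w, hw⟩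
    have e2 := pair_tan (F.conormal.res h s) ⟨w, hw⟩
    change _ * v.app V h (pair (F.conormal.res h s) w) - jet σ.1 _ (evalOp F (v.restrict h) w) = 0
    rw [e1, e2, jet_zero, map_zero, mul_zero, sub_zero]⟩

theorem pair_mulAlongOfSplitting (g : D.ideal.toOMod.sec U) (v : VField 𝒪 U)
    (s : F.conormal.sec U) (w : VField 𝒪 U) :
    pair (mulAlongOfSplitting σ g v s) w =
      (g.1 : 𝒪.sec U) * v.act (pair s w) - jet σ.1 (OMod.smulNeg g s) (evalOp F v w) := by
  change (D.ideal.toOMod.res le_rfl g).1 * v.act (pair (F.conormal.res le_rfl s) w) -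
    jet σ.1 ((F.conormal.neg D).res le_rfl (OMod.smulNeg g s)) (evalOp F v w) = _
  rw [D.ideal.toOMod.res_self, F.conormal.res_self, (F.conormal.neg D).res_self]

theorem res_mulAlongOfSplitting {V : Opens X} (h : V ≤ U) (g : D.ideal.toOMod.sec U)
    (v : VField 𝒪 U) (s : F.conormal.sec U) :
    F.conormal.res h (mulAlongOfSplitting σ g v s) =
      mulAlongOfSplitting σ (D.ideal.toOMod.res h g) (v.restrict h) (F.conormal.res h s) := by
  apply conormal_ext
  intro W hW w
  change (D.ideal.toOMod.res (hW.trans h) g).1 *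
      v.app W _ (pair (F.conormal.res (hW.trans h) s) w) -
      jet σ.1 ((F.conormal.neg D).res (hW.trans h) (OMod.smulNeg g s)) _ =
    (D.ideal.toOMod.res hW (D.ideal.toOMod.res h g)).1 *
      v.app W _ (pair (F.conormal.res hW (F.conormal.res h s)) w) -
      jet σ.1 ((F.conormal.neg D).res hW (OMod.smulNeg _ _)) _
  rw [D.ideal.toOMod.res_res, F.conormal.res_res, ← OMod.res_smulNeg,
    (F.conormal.neg D).res_res]

theorem mulAlongOfSplitting_ext {g : D.ideal.toOMod.sec U} {v : VField 𝒪 U}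
    {s t : F.conormal.sec U}
    (h : ∀ (V : Opens X) (hV : V ≤ U) (w : VField 𝒪 V),
      ((D.ideal.toOMod.res hV g).1 : 𝒪.sec V) * (v.restrict hV).act (pair (F.conormal.res hV s) w) -
        jet σ.1 (OMod.smulNeg (D.ideal.toOMod.res hV g) (F.conormal.res hV s))
          (evalOp F (v.restrict hV) w) = pair (F.conormal.res hV t) w) :
    mulAlongOfSplitting σ g v s = t := by
  apply ext_pair
  intro V hV w
  rw [res_mulAlongOfSplitting, pair_mulAlongOfSplitting, h]

/-- The meromorphic connection defined by a meromorphic splitting. -/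
def connectionOfSplitting : MeromorphicConnection F.conormal D :=
  .ofMulAlong (fun _ g v s => mulAlongOfSplitting σ g v s)
    (fun U g g' v s => mulAlongOfSplitting_ext σ fun V hV w => by
      rw [map_add, map_add, pair_add_left, res_mulAlongOfSplitting, res_mulAlongOfSplitting,
        pair_mulAlongOfSplitting, pair_mulAlongOfSplitting, OMod.smulNeg_add_left, jet_add_left]
      change ((D.ideal.toOMod.res hV g).1 + (D.ideal.toOMod.res hV g').1) * _ - _ = _
      ring)
    (fun U f g v s => mulAlongOfSplitting_ext σ fun V hV w => by
      rw [D.ideal.toOMod.res_smul, F.conormal.res_smul, pair_smul_left, res_mulAlongOfSplitting,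
        pair_mulAlongOfSplitting, OMod.smulNeg_smul_left, jet_smul_left]
      change (_ * _) * _ - _ = _
      ring)
    (fun U g v v' s => mulAlongOfSplitting_ext σ fun V hV w => by
      have e : VField.restrict hV (v + v') = v.restrict hV + v'.restrict hV := rfl
      rw [e, map_add, pair_add_left, res_mulAlongOfSplitting, res_mulAlongOfSplitting,
        pair_mulAlongOfSplitting, pair_mulAlongOfSplitting, evalOp_add_left, jet_add,
        VField.act_add]
      ring)
    (fun U f g v s => mulAlongOfSplitting_ext σ fun V hV w => by
      have e : VField.restrict hV (f • v) = 𝒪.res hV f • v.restrict hV :=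
        (tangent 𝒪).res_smul hV f v
      have e' : ∀ x, VField.act (𝒪.res hV f • v.restrict hV) x =
          𝒪.res hV f * (v.restrict hV).act x := fun x => by
        change 𝒪.res le_rfl (𝒪.res hV f) * (v.restrict hV).act x = _
        rw [𝒪.res_self]
      rw [e, F.conormal.res_smul, pair_smul_left, res_mulAlongOfSplitting,
        pair_mulAlongOfSplitting, evalOp_smul_left, jet_smul, e']
      ring)
    (fun U g v s t => mulAlongOfSplitting_ext σ fun V hV w => by
      rw [map_add, map_add, pair_add_left, pair_add_left, res_mulAlongOfSplitting,
        res_mulAlongOfSplitting, pair_mulAlongOfSplitting, pair_mulAlongOfSplitting,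
        OMod.smulNeg_add, jet_add_left, VField.act_map_add]
      ring)
    -- The Leibniz rule for ∇: the jet term is linear in s, so the only contribution of v(f) comes
    -- from g v(f s(w)).
    (fun U f g v s => mulAlongOfSplitting_ext σ fun V hV w => by
      rw [map_add, F.conormal.res_smul, F.conormal.res_smul, F.conormal.res_smul, pair_add_left,
        pair_smul_left, pair_smul_left, pair_smul_left, res_mulAlongOfSplitting,
        pair_mulAlongOfSplitting, OMod.smulNeg_smul, jet_smul_left, VField.act_mul, map_mul,
        VField.res_act]
      change 𝒪.res hV g.1 * _ - _ =
        _ * 𝒪.res hV g.1 * _ + _ * (𝒪.res hV g.1 * _ - _)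
      ring)
    (fun U V h g v s => res_mulAlongOfSplitting σ h g v s)

theorem pair_mulAlong_connectionOfSplitting (g : D.ideal.toOMod.sec U) (v : VField 𝒪 U)
    (s : F.conormal.sec U) (w : VField 𝒪 U) :
    pair ((connectionOfSplitting σ).mulAlong g v s) w =
      (g.1 : 𝒪.sec U) * v.act (pair s w) - jet σ.1 (OMod.smulNeg g s) (evalOp F v w) := by
  rw [connectionOfSplitting, MeromorphicConnection.mulAlong_ofMulAlong, pair_mulAlongOfSplitting]

end OfSplitting

/-- By `evalOp_eq_comp`, only ev_{[v,w]} contributes to σ(gs), which leaves g(v(s(w)) - s([v,w])),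
the Lie derivative. -/
theorem connectionOfSplitting_extends (σ : MeromorphicSplitting (bott F) D) :
    (connectionOfSplitting σ).Extends (bott F) := by
  intro U v s
  rw [MeromorphicConnection.along_eq_toPoles_iff]
  intro V h g
  apply ext_pair
  intro W hW w
  have e : VField.restrict hW (VField.restrict h v.1) = (F.tan.res (hW.trans h) v).1 := rfl
  rw [MeromorphicConnection.res_mulAlong, e, pair_mulAlong_connectionOfSplitting, evalOp_eq_comp,
    jet_add, jet_comp, jet_ofLHom, F.conormal.res_smul, pair_smul_left, F.conormal.res_res,
    F.conormal.res_res, (bott F).res_along, pair_bott_along]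
  have e' : (evalForm F (VField.bracket (F.tan.res (hW.trans h) v).1 w)).app W le_rfl
      (OMod.smulNeg (D.ideal.toOMod.res hW g) (F.conormal.res (hW.trans h) s)).1 =
      𝒪.res hW g.1 * pair (F.conormal.res (hW.trans h) s)
        (VField.bracket (F.tan.res (hW.trans h) v).1 w) := pair_smul_left _ _ _
  rw [e', zero_add, mul_sub]
  rfl

/-! ### The two constructions are mutually inverse and match the explicit formula. -/

theorem connectionOfSplitting_splitting (h𝒪 : 𝒪.DenseInjective) (hT : 𝒪.HasLocalFrames)
    (hF : F.IsCodimOne) {N : PartialConnection F F.conormal}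
    {A : MeromorphicConnection F.conormal D} (hA : A.Extends N) :
    connectionOfSplitting (splitting h𝒪 hT hF hA) = A := by
  apply MeromorphicConnection.ext_mulAlong
  intro U g v s
  -- The contraction is specified only after multiplication by a section of 𝒪(-D), so a second
  -- factor g' is introduced and cancelled.
  apply conormal_eq_of_ideal_smul D
  intro V hV g'
  apply ext_pair
  intro W hW w
  have h1 := (IsContraction.evalOp_iff h𝒪 hF _ _).1
    (isContraction_jet_splittingHom h𝒪 hT hF hA
    (OMod.smulNeg (D.ideal.toOMod.res (hW.trans hV) g) (F.conormal.res (hW.trans hV) s))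
    (evalOp F (v.restrict (hW.trans hV)) w)) W le_rfl (D.ideal.toOMod.res hW g')
  rw [F.conormal.res_self, 𝒪.res_self] at h1
  have e1 : (evalOp F (v.restrict (hW.trans hV)) w).app W le_rfl
      (OMod.smulNeg (D.ideal.toOMod.res (hW.trans hV) g) (F.conormal.res (hW.trans hV) s)).1 =
      (v.restrict (hW.trans hV)).act
        (𝒪.res (hW.trans hV) g.1 * pair (F.conormal.res (hW.trans hV) s) w) :=
    congrArg (v.restrict (hW.trans hV)).act (pair_smul_left _ _ _)
  -- Leibniz for g'∇_v(gs), followed by an exchange of g and g'. The term v(g)s cancels the one from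
  -- v(g s(w)), leaving g∇_v s.
  have e2 : A.mulAlong (D.ideal.toOMod.res hW g') (v.restrict (hW.trans hV))
      (OMod.smulNeg (D.ideal.toOMod.res (hW.trans hV) g) (F.conormal.res (hW.trans hV) s)).1 =
      ((v.restrict (hW.trans hV)).act (𝒪.res (hW.trans hV) g.1) * 𝒪.res hW g'.1) •
        F.conormal.res (hW.trans hV) s + 𝒪.res hW g'.1 •
        A.mulAlong (D.ideal.toOMod.res (hW.trans hV) g) (v.restrict (hW.trans hV))
          (F.conormal.res (hW.trans hV) s) :=
    (A.mulAlong_smul _ _ _ _).trans (congrArg _ (A.mulAlong_comm _ _ _ _))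
  have e3 : VField.restrict (le_refl W) (VField.restrict (hW.trans hV) v) =
    VField.restrict (hW.trans hV) v := rfl
  have e4 : VField.restrict (le_refl W) w = w := rfl
  rw [e1, e3, e4, e2, pair_add_left, pair_smul_left, pair_smul_left, VField.act_mul] at h1
  rw [F.conormal.res_smul, F.conormal.res_smul, pair_smul_left, pair_smul_left,
    F.conormal.res_res, F.conormal.res_res, MeromorphicConnection.res_mulAlong,
    A.res_mulAlong, pair_mulAlong_connectionOfSplitting]
  change 𝒪.res hW g'.1 * (𝒪.res (hW.trans hV) g.1 * _ -
    jet (splittingHom h𝒪 hT hF hA) _ _) = 𝒪.res hW g'.1 * _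
  change _ = 𝒪.res hW g'.1 * _ at h1
  linear_combination -h1

theorem splitting_connectionOfSplitting (h𝒪 : 𝒪.DenseInjective) (hT : 𝒪.HasLocalFrames)
    (hF : F.IsCodimOne) {N : PartialConnection F F.conormal} (σ : MeromorphicSplitting N D)
    (hσ : (connectionOfSplitting σ).Extends N) : splitting h𝒪 hT hF hσ = σ := by
  apply Subtype.ext
  apply jet_ext
  intro U s P
  have key : IsContraction (connectionOfSplitting σ) s.1 P
      (P.app U le_rfl s.1 - jet σ.1 s P) := by
    intro V h t g
    apply ext_pair
    intro W hW w
    set s' := (F.conormal.neg D).res (hW.trans h) s with hs'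
    set P' := P.restrict (hW.trans h) with hP'
    set t' := F.conormal.res hW t with ht'
    have e1 : F.conormal.res (hW.trans h) s.1 = s'.1 := rfl
    rw [MeromorphicConnection.res_mulAlong, F.conormal.res_res, e1,
      DiffOp.symbol_restrict, pair_mulAlong_connectionOfSplitting, OMod.smulNeg_val,
      jet_smul_left, F.conormal.res_smul, map_mul, 𝒪.res_res, map_sub, res_jet, pair_smul_left,
      P.nat]
    -- The operator t(w)P - P_{symb_P(t),w} sends x to the symbol t(w)symb_P(x) - x(w)symb_P(t) =
    -- symb_P(t(w)x - x(w)t), which is zero in rank one. Thus the value of σ at P, times t(w), is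
    -- determined by its values on operators of the form `evalOp`.
    have hQ := jet_of_symbol_eq_zero σ s' (pair t' w • P' + -evalOp F (P'.symbol t') w) (by
      intro V' hV' x
      have a1 : DiffOp.restrict hV' (pair t' w • P' + -evalOp F (P'.symbol t') w) =
          𝒪.res hV' (pair t' w) • P'.restrict hV' +
            -evalOp F ((P'.symbol t').restrict hV') (w.restrict hV') := by
        exact congrArg (· + -evalOp F ((P'.symbol t').restrict hV') (w.restrict hV'))
          ((diffOps F.conormal).res_smul hV' (pair t' w) P')
      have a2 : ∀ Q : DiffOp F.conormal V', (-Q).symbol x = -Q.symbol x := fun Q => by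
        have := DiffOp.symbol_smul_left (-1) Q x
        rwa [neg_one_smul, neg_one_smul] at this
      rw [a1, DiffOp.symbol_add_left, a2, DiffOp.symbol_smul_left, DiffOp.symbol_evalOp,
        DiffOp.symbol_restrict, ← DiffOp.symbol_smul, ← DiffOp.symbol_smul, res_pair,
        pair_smul_comm h𝒪 hF, add_neg_cancel])
    have b1 : (pair t' w • P' + -evalOp F (P'.symbol t') w).app W le_rfl s'.1 =
        pair t' w * P'.app W le_rfl s'.1 - (P'.symbol t').act (pair s'.1 w) := by
      rw [DiffOp.add_app, AddMonoidHom.add_apply, DiffOp.smul_app_apply, 𝒪.res_self,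
        DiffOp.neg_app, AddMonoidHom.neg_apply, ← sub_eq_add_neg]
      rfl
    rw [b1, jet_add, jet_neg, jet_smul] at hQ
    change 𝒪.res hW g.1 * (P'.symbol t').act _ - 𝒪.res hW g.1 * jet σ.1 s' (evalOp F (P'.symbol t') w) =
      𝒪.res hW g.1 * (P'.app W le_rfl s'.1 - jet σ.1 s' P') * pair t' w
    linear_combination (𝒪.res hW g.1) * hQ
  have h2 := (isContraction_jet_splittingHom h𝒪 hT hF hσ s P).unique h𝒪 hF key
  exact sub_right_injective h2

/-- The bijection between meromorphic extensions and meromorphic splittings. -/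
noncomputable def extensionEquivSplitting (h𝒪 : 𝒪.DenseInjective) (hT : 𝒪.HasLocalFrames)
    (hF : F.IsCodimOne) (D : EffectiveDivisor 𝒪) :
    MeromorphicExtension (bott F) D ≃ MeromorphicSplitting (bott F) D where
  toFun A := splitting h𝒪 hT hF A.2
  invFun σ := ⟨connectionOfSplitting σ, connectionOfSplitting_extends σ⟩
  left_inv A := Subtype.ext (connectionOfSplitting_splitting h𝒪 hT hF A.2)
  right_inv σ := splitting_connectionOfSplitting h𝒪 hT hF σ _

/-- The formula for σ(s) says that ∑ ωᵢ(symb_P(tᵢ)) is the contraction of ∇s with P. Rank one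
derives this from ∇s = ∑ ωᵢ ⊗ tᵢ; the converse follows by taking for P the operators `evalOp`. -/
theorem corresponds_splitting (h𝒪 : 𝒪.DenseInjective) (hT : 𝒪.HasLocalFrames)
    (hF : F.IsCodimOne) {N : PartialConnection F F.conormal}
    {A : MeromorphicConnection F.conormal D} (hA : A.Extends N) :
    Corresponds A (splitting h𝒪 hT hF hA).1 := by
  intro U s k ω t
  have hc : ∀ (V : Opens X) (h : V ≤ U) (P : DiffOp F.conormal V),
      (((splitting h𝒪 hT hF hA).1.app U le_top s).1.app V h P =
        P.app V le_rfl (F.conormal.res h s.1) -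
          ∑ i, (ω i).app V h (P.symbol (F.conormal.res h (t i)))) ↔
      IsContraction A (F.conormal.res h s.1) P
        (∑ i, (ω i).app V h (P.symbol (F.conormal.res h (t i)))) := by
    intro V h P
    rw [app_eq_jet]
    have h1 := isContraction_jet_splittingHom h𝒪 hT hF hA ((F.conormal.neg D).res h s) P
    constructor
    · intro e
      change jet (splittingHom h𝒪 hT hF hA) _ P = _ at e
      rw [e] at h1
      change IsContraction A _ P (P.app V le_rfl (F.conormal.res h s.1) - _) at h1
      rwa [sub_sub_cancel] at h1
    · intro h2
      rw [← h1.unique h𝒪 hF h2]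
      change jet (splittingHom h𝒪 hT hF hA) _ P = P.app V le_rfl (F.conormal.res h s.1) -
        (P.app V le_rfl (F.conormal.res h s.1) - _)
      rw [sub_sub_cancel]
  have res_ω : ∀ (i : Fin k) (V W : Opens X) (hV : V ≤ U) (hW : W ≤ V) (v : VField 𝒪 V),
      𝒪.res hW ((ω i).app V hV v) = (ω i).app W (hW.trans hV) (v.restrict hW) :=
    fun i V W hV hW v => (ω i).nat V W hV hW v
  constructor
  · intro H V h P
    rw [hc]
    intro W hW x g
    have := (A.along_eq_toPoles_iff _ _ _).1 (H W (hW.trans h) ((P.restrict hW).symbol x)) W le_rfl g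
    simp only [F.conormal.res_self] at this
    rw [F.conormal.res_res, mul_smul, map_sum, Finset.sum_smul]
    refine this.trans ?_
    congr 1
    refine Finset.sum_congr rfl fun i _ => ?_
    -- The linear form y ↦ ωᵢ(symb_P(y)), to which rank one is applied: ωᵢ(symb_P(x))tᵢ =
    -- ωᵢ(symb_P(tᵢ))x.
    let φ : LHom F.conormal (OMod.unit 𝒪) W :=
      { app := fun W' hW' =>
          { toFun := fun y => (ω i).app W' (hW'.trans (hW.trans h))
              ((P.restrict (hW'.trans hW)).symbol y)
            map_add' := fun y z => by rw [DiffOp.symbol_add, map_add]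
            map_smul' := fun f y => by rw [DiffOp.symbol_smul, map_smul]; rfl }
        nat := fun W' W'' hW' hW'' y => by
          refine (res_ω i W' W'' _ hW'' _).trans ?_
          rw [DiffOp.symbol_restrict]
          rfl }
    have hφ := lhom_smul_comm h𝒪 hF φ x (F.conormal.res (hW.trans h) (t i))
    refine hφ.trans ?_
    congr 1
    rw [res_ω, DiffOp.symbol_restrict, F.conormal.res_res]
    rfl
  · intro H V h v
    rw [A.along_eq_toPoles_iff]
    intro W hW g
    apply ext_pair
    intro W' hW' w
    -- For P = P_{v,w} the symbol at tᵢ is tᵢ(w)v, so the contraction is ∑ ωᵢ(v)tᵢ(w), the value at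
    -- w of ∑ ωᵢ(v)tᵢ.
    have h1 := (IsContraction.evalOp_iff h𝒪 hF _ _).1 ((hc W' (hW'.trans (hW.trans h))
      (evalOp F (v.restrict (hW'.trans hW)) w)).1 (H _ _ _)) W' le_rfl (D.ideal.toOMod.res hW' g)
    rw [F.conormal.res_self, 𝒪.res_self] at h1
    rw [A.res_mulAlong, F.conormal.res_res, F.conormal.res_res]
    refine h1.trans ?_
    rw [F.conormal.res_smul, pair_smul_left, F.conormal.res_res, map_sum]
    congr 1
    refine Eq.trans ?_ (map_sum (⟨⟨fun x => pair x w, rfl⟩, fun x y => pair_add_left x y w⟩ :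
      F.conormal.sec W' →+ 𝒪.sec W') _ Finset.univ).symm
    refine Finset.sum_congr rfl fun i _ => ?_
    change _ = pair (F.conormal.res (hW'.trans hW) ((ω i).app V h v • F.conormal.res h (t i))) w
    rw [DiffOp.symbol_evalOp, map_smul, F.conormal.res_smul, F.conormal.res_res, pair_smul_left,
      smul_eq_mul, mul_comm, res_ω]

end TransverseJets

namespace TransverseJets
variable {X : Type} [TopologicalSpace X] {𝒪 : CAlgSheaf X}
variable {F : Foliation 𝒪} {D : EffectiveDivisor 𝒪} {U : Opens X}
open Foliation

/-! ### Curvature and horizontality -/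

namespace MeromorphicConnection
variable {E : OMod 𝒪} {A : MeromorphicConnection E D}

theorem Extends.mulAlong {N : PartialConnection F E} (hA : A.Extends N)
    (g : D.ideal.toOMod.sec U) (v : F.tan.sec U) (s : E.sec U) :
    A.mulAlong g v.1 s = (g.1 : 𝒪.sec U) • N.along v s := by
  have := (A.along_eq_toPoles_iff _ _ _).1 (hA U v s) U le_rfl g
  simp only [E.res_self] at this
  exact this

/-- The section `g h R(v, w) s` for the curvature `R` of the connection. -/
def curvature (A : MeromorphicConnection E D) (g h : D.ideal.toOMod.sec U) (v w : VField 𝒪 U)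
    (s : E.sec U) : E.sec U :=
  A.mulAlongAlong g h v w s - A.mulAlongAlong g h w v s - (h.1 : 𝒪.sec U) •
    A.mulAlong g (v.bracket w) s

theorem isFlat_iff : A.IsFlat ↔ ∀ (U : Opens X) (g h : D.ideal.toOMod.sec U) (v w : VField 𝒪 U)
    (s : E.sec U), A.curvature g h v w s = 0 :=
  ⟨fun H U g h v w s => sub_eq_zero.2 (H U v w s g h).symm,
    fun H U v w s g h => (sub_eq_zero.1 (H U g h v w s)).symm⟩

theorem curvature_eq (g h : D.ideal.toOMod.sec U) (v w : VField 𝒪 U) (s : E.sec U) :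
    A.curvature g h v w s = (A.mulAlong h v (A.mulAlong g w s) - v.act g.1 • A.mulAlong h w s) -
      (A.mulAlong h w (A.mulAlong g v s) - w.act g.1 • A.mulAlong h v s) -
      (h.1 : 𝒪.sec U) • A.mulAlong g (v.bracket w) s := rfl

theorem res_curvature {V : Opens X} (hV : V ≤ U) (g h : D.ideal.toOMod.sec U)
    (v w : VField 𝒪 U) (s : E.sec U) :
    E.res hV (A.curvature g h v w s) = A.curvature (D.ideal.toOMod.res hV g)
      (D.ideal.toOMod.res hV h) (v.restrict hV) (w.restrict hV) (E.res hV s) := by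
  rw [curvature_eq, curvature_eq, map_sub, map_sub, map_sub, map_sub]
  simp only [E.res_smul, A.res_mulAlong]
  rw [VField.res_act, VField.res_act]
  rfl

theorem VField.bracket_swap (v w : VField 𝒪 U) : v.bracket w = -w.bracket v := by
  ext V h f
  rw [VField.neg_app, Derivation.neg_apply, Derivation.commutator_apply,
    Derivation.commutator_apply, neg_sub]

theorem curvature_swap (g h : D.ideal.toOMod.sec U) (v w : VField 𝒪 U) (s : E.sec U) :
    A.curvature g h v w s = -A.curvature g h w v s := by
  rw [curvature_eq, curvature_eq, VField.bracket_swap v w, A.mulAlong_neg_field, smul_neg]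
  abel

theorem curvature_add_field (g h : D.ideal.toOMod.sec U) (v w w' : VField 𝒪 U) (s : E.sec U) :
    A.curvature g h v (w + w') s = A.curvature g h v w s + A.curvature g h v w' s := by
  have e : v.bracket (w + w') = v.bracket w + v.bracket w' := by
    ext V h f
    rw [VField.add_app, Derivation.add_apply, Derivation.commutator_apply,
      Derivation.commutator_apply, Derivation.commutator_apply, VField.add_app,
      Derivation.add_apply, Derivation.add_apply, map_add]
    ring
  rw [curvature_eq, curvature_eq, curvature_eq, e]
  simp only [A.mulAlong_add_field, A.mulAlong_add, VField.act_add, add_smul, smul_add]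
  abel

theorem VField.bracket_smul (v w : VField 𝒪 U) (f : 𝒪.sec U) :
    v.bracket (f • w) = v.act f • w + f • v.bracket w := by
  ext V h g
  rw [VField.add_app, Derivation.add_apply, VField.smul_app, VField.smul_app,
    Derivation.smul_apply, Derivation.smul_apply, Derivation.commutator_apply,
    Derivation.commutator_apply, VField.smul_app, Derivation.smul_apply, Derivation.smul_apply,
    VField.res_act]
  simp only [smul_eq_mul, Derivation.leibniz]
  change _ = v.app V h _ * _ + _
  ring

theorem VField.smul_act (f g : 𝒪.sec U) (v : VField 𝒪 U) : (f • v).act g = f * v.act g := by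
  change 𝒪.res le_rfl f * v.act g = _
  rw [𝒪.res_self]

/-- The terms with v(f) from differentiating f·(g∇_w s) and from [v,fw] cancel. This tensoriality
allows w to be replaced by symbols and the curvature to be contracted to a 1-form. -/
theorem curvature_smul_field (f : 𝒪.sec U) (g h : D.ideal.toOMod.sec U) (v w : VField 𝒪 U)
    (s : E.sec U) : A.curvature g h v (f • w) s = f • A.curvature g h v w s := by
  rw [curvature_eq, curvature_eq, VField.bracket_smul]
  rw [A.mulAlong_smul_field f g w s, A.mulAlong_smul, A.mulAlong_smul_field,
    A.mulAlong_smul_field, A.mulAlong_add_field, A.mulAlong_smul_field, A.mulAlong_smul_field,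
    VField.smul_act]
  module

theorem curvature_smul (f : 𝒪.sec U) (g h : D.ideal.toOMod.sec U) (v w : VField 𝒪 U)
    (s : E.sec U) : A.curvature g h v w (f • s) = f • A.curvature g h v w s := by
  have e : (v.bracket w).act f = v.act (w.act f) - w.act (v.act f) :=
    Derivation.commutator_apply _
  rw [curvature_eq, curvature_eq, A.mulAlong_smul f g w s, A.mulAlong_smul f g v s,
    A.mulAlong_smul f h w s, A.mulAlong_smul f h v s, A.mulAlong_smul f g _ s, A.mulAlong_add,
    A.mulAlong_add, A.mulAlong_smul, A.mulAlong_smul, A.mulAlong_smul, A.mulAlong_smul, e,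
    VField.act_mul, VField.act_mul]
  -- The first-order terms in f carry g and h in opposite places; `mulAlong_comm` exchanges them.
  linear_combination (norm := module) w.act f • A.mulAlong_comm g h v s -
    v.act f • A.mulAlong_comm g h w s

/-- Along a tangent v the connection acts on E itself, so the Leibniz correction for h disappears.
This form of the curvature serves both horizontality and invariance of D. -/
theorem Extends.curvature {N : PartialConnection F E} (hA : A.Extends N)
    (g h : D.ideal.toOMod.sec U) (v : F.tan.sec U) (w : VField 𝒪 U) (s : E.sec U) :
    A.curvature g h v.1 w s = (h.1 : 𝒪.sec U) • N.along v (A.mulAlong g w s) -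
      VField.act v.1 g.1 • A.mulAlong h w s - (g.1 : 𝒪.sec U) • A.mulAlong h w (N.along v s) -
      (h.1 : 𝒪.sec U) • A.mulAlong g (VField.bracket v.1 w) s := by
  rw [curvature_eq, hA.mulAlong, hA.mulAlong, hA.mulAlong, A.mulAlong_smul]
  module

end MeromorphicConnection

open MeromorphicConnection

variable {A : MeromorphicConnection F.conormal D} {N : PartialConnection F F.conormal}

/-- Each ∇-term in the curvature is a contraction once [v, symb_P(t)] is written as the symbol of
v∘P - P∘∇_v at t plus symb_P(∇_v t). The terms with ∇_v t and v(g) cancel, leaving a multiple of t.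
-/
theorem IsContraction.curvature (hA : A.Extends N) {s : F.conormal.sec U} {v : F.tan.sec U}
    {P : DiffOp F.conormal U} {c₀ c₁ c₂ : 𝒪.sec U} (h₀ : IsContraction A s P c₀)
    (h₁ : IsContraction A s (N.opBracket v P) c₁) (h₂ : IsContraction A (N.along v s) P c₂)
    (g h : D.ideal.toOMod.sec U) (t : F.conormal.sec U) :
    A.curvature g h v.1 (P.symbol t) s =
      ((g.1 : 𝒪.sec U) * h.1 * (VField.act v.1 c₀ - c₁ - c₂)) • t := by
  have key : ∀ {s : F.conormal.sec U} {P : DiffOp F.conormal U} {c : 𝒪.sec U}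
      (_ : IsContraction A s P c) (g : D.ideal.toOMod.sec U) (t : F.conormal.sec U),
      A.mulAlong g (P.symbol t) s = ((g.1 : 𝒪.sec U) * c) • t := by
    intro s P c hc g t
    have := hc U le_rfl t g
    rwa [F.conormal.res_self, 𝒪.res_self] at this
  have e : VField.bracket v.1 (P.symbol t) =
      (N.opBracket v P).symbol t + P.symbol (N.along v t) := by
    rw [DiffOp.symbol_opBracket, sub_add_cancel]
  rw [hA.curvature, e, A.mulAlong_add_field, key h₀, key h₀, key h₀, key h₁, key h₂,
    N.along_smul_right, VField.act_mul]
  module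

theorem pair_eq_zero_ext (s : F.conormal.sec U)
    (h : ∀ (V : Opens X) (hV : V ≤ U) (w : VField 𝒪 V), pair (F.conormal.res hV s) w = 0) :
    s = 0 := by
  apply ext_pair
  intro V hV w
  rw [h, map_zero, pair_zero_left]

/-- Equality of two jets must be tested on operators over all smaller open sets; naturality reduces
this to operators on the domain of s. -/
theorem jet_bott_neg_iff (hD : D.IsInvariant F) (σ : MeromorphicSplitting (bott F) D) :
    ((bott F).neg hD).IsHorizontal (transverseJetConnection (bott F) (bott_isFlat F)) σ.1 ↔
    ∀ (U : Opens X) (v : F.tan.sec U) (s : (F.conormal.neg D).sec U) (P : DiffOp F.conormal U),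
      jet σ.1 ⟨(bott F).along v s.1, (bott F).along_mem_neg hD v s⟩ P =
        VField.act v.1 (jet σ.1 s P) - jet σ.1 s ((bott F).opBracket v P) := by
  have e : ∀ (U : Opens X) (v : F.tan.sec U) (s : (F.conormal.neg D).sec U),
      ((bott F).neg hD).along v s = ⟨(bott F).along v s.1, (bott F).along_mem_neg hD v s⟩ :=
    fun U v s => Subtype.ext (congrArg ((bott F).along v) (F.conormal.res_self U s.1))
  constructor
  · intro H U v s P
    have := congrArg (fun ξ : (transverseJet (bott F)).sec U => ξ.1.app U le_rfl P) (H U v s)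
    rw [e] at this
    exact this
  · intro H U v s
    apply Subtype.ext; apply LHom.ext; funext V hV; apply LinearMap.ext; intro P
    have h1 := H V (F.tan.res hV v) ((F.conormal.neg D).res hV s) P
    refine (app_eq_jet σ.1 _ hV P).trans (Eq.trans ?_ (h1.trans ?_))
    · rw [e]
      exact congrArg (jet σ.1 · P) (Subtype.ext ((bott F).res_along hV v s.1))
    · change _ = v.1.app V hV ((σ.1.app U le_top s).1.app V hV P) -
        (σ.1.app U le_top s).1.app V hV ((bott F).opBracket (F.tan.res hV v) P)
      rw [app_eq_jet, app_eq_jet]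
      rfl

/-- The part s ↦ (P ↦ P(s)) of σ is horizontal by the very definition of ∇¹, so only the
contractions remain. -/
theorem isHorizontal_splitting_iff (h𝒪 : 𝒪.DenseInjective) (hT : 𝒪.HasLocalFrames)
    (hF : F.IsCodimOne) (hD : D.IsInvariant F) (hA : A.Extends (bott F)) :
    ((bott F).neg hD).IsHorizontal (transverseJetConnection (bott F) (bott_isFlat F))
      (splitting h𝒪 hT hF hA).1 ↔
    ∀ (U : Opens X) (v : F.tan.sec U) (s : (F.conormal.neg D).sec U) (P : DiffOp F.conormal U),
      VField.act v.1 (contraction h𝒪 hT hF A s P) -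
        contraction h𝒪 hT hF A s ((bott F).opBracket v P) -
        contraction h𝒪 hT hF A ⟨(bott F).along v s.1, (bott F).along_mem_neg hD v s⟩ P = 0 := by
  rw [jet_bott_neg_iff]
  refine forall_congr' fun U => forall_congr' fun v => forall_congr' fun s =>
    forall_congr' fun P => ?_
  change jet (splittingHom h𝒪 hT hF hA) _ P = VField.act v.1 (jet (splittingHom h𝒪 hT hF hA) s P) -
    jet (splittingHom h𝒪 hT hF hA) s _ ↔ _
  rw [jet_splittingHom, jet_splittingHom, jet_splittingHom]
  have e1 : VField.act v.1 (P.app U le_rfl s.1 - contraction h𝒪 hT hF A s P) =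
    VField.act v.1 (P.app U le_rfl s.1) - VField.act v.1 (contraction h𝒪 hT hF A s P) :=
    map_sub _ _ _
  have e2 : ((bott F).opBracket v P).app U le_rfl s.1 =
    VField.act v.1 (P.app U le_rfl s.1) - P.app U le_rfl ((bott F).along v s.1) := rfl
  rw [e1, e2, ← sub_eq_zero]
  refine iff_of_eq (congrArg (· = 0) ?_)
  change P.app U le_rfl ((bott F).along v s.1) - _ - _ = _
  ring

theorem isHorizontal_splitting_of_isFlat (h𝒪 : 𝒪.DenseInjective) (hT : 𝒪.HasLocalFrames)
    (hF : F.IsCodimOne) (hD : D.IsInvariant F) (hA : A.Extends (bott F)) (hflat : A.IsFlat) :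
    ((bott F).neg hD).IsHorizontal (transverseJetConnection (bott F) (bott_isFlat F))
      (splitting h𝒪 hT hF hA).1 := by
  rw [isHorizontal_splitting_iff]
  intro U v s P
  -- The defect of horizontality vanishes once gh times it kills all t, and by
  -- `IsContraction.curvature` that product is the curvature at v and symb_P(t).
  apply eq_zero_of_smul_conormal h𝒪 hF
  intro V hV t
  apply conormal_eq_zero_of_ideal_smul D
  intro W hW g
  apply conormal_eq_zero_of_ideal_smul D
  intro W' hW' h
  have hle : W' ≤ U := hW'.trans (hW.trans hV)
  have h₀ := (isContraction_contraction h𝒪 hT hF A s P).res hle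
  have h₁ := (isContraction_contraction h𝒪 hT hF A s ((bott F).opBracket v P)).res hle
  have h₂ := (isContraction_contraction h𝒪 hT hF A
    ⟨(bott F).along v s.1, (bott F).along_mem_neg hD v s⟩ P).res hle
  rw [(bott F).res_along] at h₂
  have e : DiffOp.restrict hle ((bott F).opBracket v P) =
      (bott F).opBracket (F.tan.res hle v) (P.restrict hle) := by
    apply DiffOp.ext; funext W hW; apply AddMonoidHom.ext; intro x; rfl
  rw [e] at h₁
  have := IsContraction.curvature hA h₀ h₁ h₂ (D.ideal.toOMod.res hW' g) h
    (F.conormal.res (hW'.trans hW) t)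
  rw [isFlat_iff.1 hflat] at this
  rw [F.conormal.res_smul, F.conormal.res_smul, F.conormal.res_smul, F.conormal.res_res,
    𝒪.res_res, 𝒪.res_res, map_sub, map_sub, VField.res_act, smul_smul, smul_smul]
  refine Eq.trans ?_ this.symm
  congr 1
  rw [mul_comm (h.1 : 𝒪.sec W')]
  rfl

theorem curvature_tan_eq_zero (h𝒪 : 𝒪.DenseInjective) (hT : 𝒪.HasLocalFrames)
    (hF : F.IsCodimOne) (hD : D.IsInvariant F) (hA : A.Extends (bott F))
    (hσ : ((bott F).neg hD).IsHorizontal (transverseJetConnection (bott F) (bott_isFlat F))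
      (splitting h𝒪 hT hF hA).1) (g h : D.ideal.toOMod.sec U) (v : F.tan.sec U) (w : VField 𝒪 U)
    (s : F.conormal.sec U) : A.curvature g h v.1 w s = 0 := by
  rw [isHorizontal_splitting_iff] at hσ
  -- With P = P_{w,y} the symbol at t is t(y)w, so horizontality gives t(y)R(v,w)s = 0; rank one
  -- moves t out of the pairing.
  have key : ∀ (V : Opens X) (g h : D.ideal.toOMod.sec V) (v : F.tan.sec V) (w y : VField 𝒪 V)
      (s : (F.conormal.neg D).sec V) (t : F.conormal.sec V),
      pair (A.curvature g h v.1 w s.1) y • t = 0 := by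
    intro V g h v w y s t
    have := IsContraction.curvature hA (isContraction_contraction h𝒪 hT hF A s (evalOp F w y))
      (isContraction_contraction h𝒪 hT hF A s ((bott F).opBracket v (evalOp F w y)))
      (isContraction_contraction h𝒪 hT hF A
        ⟨(bott F).along v s.1, (bott F).along_mem_neg hD v s⟩ (evalOp F w y)) g h t
    rw [hσ, mul_zero, zero_smul, DiffOp.symbol_evalOp, curvature_smul_field] at this
    rw [pair_smul_comm h𝒪 hF]
    exact this
  apply conormal_eq_zero_of_ideal_smul D
  intro V hV k
  -- Horizontality only concerns sections of E(-D), so s is replaced by ks with k in 𝒪(-D).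
  rw [res_curvature, ← curvature_smul]
  apply pair_eq_zero_ext
  intro W hW y
  apply eq_zero_of_smul_conormal h𝒪 hF
  intro W' hW' t
  rw [res_pair, res_curvature, res_curvature]
  exact key W' _ _ (F.tan.res (hW'.trans (hW.trans hV)) v) _ _
    ((F.conormal.neg D).res hW' ((F.conormal.neg D).res hW
      (OMod.smulNeg k (F.conormal.res hV s)))) t

/-- The form `w ↦ (g h R(v, w) s)(y)`. -/
def curvatureHom (A : MeromorphicConnection F.conormal D) (g h : D.ideal.toOMod.sec U)
    (v y : VField 𝒪 U) (s : F.conormal.sec U) : LHom (tangent 𝒪) (OMod.unit 𝒪) U where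
  app V hV :=
    { toFun := fun w => pair (A.curvature (D.ideal.toOMod.res hV g) (D.ideal.toOMod.res hV h)
        (v.restrict hV) w (F.conormal.res hV s)) (y.restrict hV)
      map_add' := fun w w' => by rw [A.curvature_add_field, pair_add_left]
      map_smul' := fun f w => by
        rw [A.curvature_smul_field, pair_smul_left, RingHom.id_apply, smul_eq_mul] }
  nat V W hV hW w := by
    change 𝒪.res hW (pair (A.curvature (D.ideal.toOMod.res hV g) (D.ideal.toOMod.res hV h)
        (v.restrict hV) w (F.conormal.res hV s)) (y.restrict hV)) =
      pair (A.curvature (D.ideal.toOMod.res (hW.trans hV) g) (D.ideal.toOMod.res (hW.trans hV) h)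
        (v.restrict (hW.trans hV)) (w.restrict hW) (F.conormal.res (hW.trans hV) s))
        (y.restrict (hW.trans hV))
    rw [res_pair, res_curvature, D.ideal.toOMod.res_res, D.ideal.toOMod.res_res,
      F.conormal.res_res]

theorem curvatureHom_mem (hA : ∀ (U : Opens X) (g h : D.ideal.toOMod.sec U) (v : F.tan.sec U)
    (w : VField 𝒪 U) (s : F.conormal.sec U), A.curvature g h v.1 w s = 0)
    (g h : D.ideal.toOMod.sec U) (v y : VField 𝒪 U) (s : F.conormal.sec U) :
    curvatureHom A g h v y s ∈ F.conormalSub.carrier U := by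
  intro V hV w hw
  change pair (A.curvature (D.ideal.toOMod.res hV g) (D.ideal.toOMod.res hV h)
        (v.restrict hV) w (F.conormal.res hV s)) (y.restrict hV) = 0
  let w' : F.tan.sec V := ⟨w, hw⟩
  have : A.curvature (D.ideal.toOMod.res hV g) (D.ideal.toOMod.res hV h) w (v.restrict hV)
    (F.conormal.res hV s) = 0 := hA V _ _ w' _ _
  rw [curvature_swap, this, neg_zero, pair_zero_left]

/-- The form `w ↦ (g h R(v, w) s)(y)`, which is conormal when the curvature vanishes on the
foliation. -/
def curvatureForm (A : MeromorphicConnection F.conormal D)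
    (hA : ∀ (U : Opens X) (g h : D.ideal.toOMod.sec U) (v : F.tan.sec U) (w : VField 𝒪 U)
      (s : F.conormal.sec U), A.curvature g h v.1 w s = 0)
    (g h : D.ideal.toOMod.sec U) (v y : VField 𝒪 U) (s : F.conormal.sec U) : F.conormal.sec U :=
  ⟨curvatureHom A g h v y s, curvatureHom_mem hA g h v y s⟩

theorem pair_curvatureForm (hA) (g h : D.ideal.toOMod.sec U) (v w y : VField 𝒪 U)
    (s : F.conormal.sec U) :
    pair (curvatureForm A hA g h v y s) w = pair (A.curvature g h v w s) y := by
  change pair (A.curvature (D.ideal.toOMod.res le_rfl g) (D.ideal.toOMod.res le_rfl h) v w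
    (F.conormal.res le_rfl s)) y = _
  rw [D.ideal.toOMod.res_self, D.ideal.toOMod.res_self, F.conormal.res_self]

/-- Conormal 1-forms are proportional in rank one, so an alternating 2-form with conormal
contractions behaves like a multiple of θ∧θ. The argument avoids a generator by comparing with an
arbitrary conormal form t. -/
theorem isFlat_of_curvature_tan_eq_zero (h𝒪 : 𝒪.DenseInjective) (hF : F.IsCodimOne)
    (hA : ∀ (U : Opens X) (g h : D.ideal.toOMod.sec U) (v : F.tan.sec U) (w : VField 𝒪 U)
      (s : F.conormal.sec U), A.curvature g h v.1 w s = 0) : A.IsFlat := by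
  rw [isFlat_iff]
  have key : ∀ (U : Opens X) (g h : D.ideal.toOMod.sec U) (u w x y : VField 𝒪 U)
      (s t : F.conormal.sec U), pair (A.curvature g h u w s) y * pair t x = 0 := by
    intro U g h u w x y s t
    have h1 : ∀ u w x, pair (A.curvature g h u w s) y * pair t x =
        pair t w * pair (A.curvature g h u x s) y := fun u w x => by
      simp only [← pair_curvatureForm hA]
      exact pair_mul_comm h𝒪 hF _ _ _ _
    have h2 : ∀ u w, pair (A.curvature g h u w s) y = -pair (A.curvature g h w u s) y :=
      fun u w => by rw [curvature_swap, pair_neg_left]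
    -- Put B(u,w) = (R(u,w)s)(y). Alternately applying B(u,w)t(x) = t(w)B(u,x) and the antisymmetry
    -- of B, three times each, returns to B(u,w)t(x) with the opposite sign.
    have h3 : (2 : 𝒪.sec U) * (pair (A.curvature g h u w s) y * pair t x) = 0 := by
      linear_combination h1 u w x + pair t w * h2 u x - h1 x u w -
        pair t u * h2 x w + h1 w x u + pair t x * h2 w u
    have h4 : algebraMap ℂ (𝒪.sec U) 2⁻¹ * 2 = 1 := by
      rw [← map_ofNat (algebraMap ℂ (𝒪.sec U)) 2, ← map_mul]
      norm_num
    rw [← one_mul (_ * _), ← h4, mul_assoc, h3, mul_zero]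
  intro U g h v w s
  apply pair_eq_zero_ext
  intro V hV y
  apply eq_zero_of_smul_conormal h𝒪 hF
  intro W hW t
  apply pair_eq_zero_ext
  intro W' hW' x
  rw [F.conormal.res_smul, 𝒪.res_res, pair_smul_left, res_pair, F.conormal.res_res, res_curvature]
  exact key _ _ _ _ _ _ _ _ _

theorem isHorizontal_splitting_iff_isFlat (h𝒪 : 𝒪.DenseInjective) (hT : 𝒪.HasLocalFrames)
    (hF : F.IsCodimOne) (hD : D.IsInvariant F) (hA : A.Extends (bott F)) :
    ((bott F).neg hD).IsHorizontal (transverseJetConnection (bott F) (bott_isFlat F))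
      (splitting h𝒪 hT hF hA).1 ↔ A.IsFlat :=
  ⟨fun h => isFlat_of_curvature_tan_eq_zero h𝒪 hF fun _ _ _ _ _ _ =>
    curvature_tan_eq_zero h𝒪 hT hF hD hA h _ _ _ _ _,
    isHorizontal_splitting_of_isFlat h𝒪 hT hF hD hA⟩

/-- For f in 𝒪(-D) and v tangent to the foliation, flatness expresses v(f)∇_u s through ∇_v(f∇_u s),
f∇_u∇_v s and f∇_{[v,u]}s, all sections of E. So v(f)∇ is holomorphic, and exactness of the polar
divisor puts v(f) in 𝒪(-D). -/
theorem isInvariant_of_hasPolarDivisor {E : OMod 𝒪} {A : MeromorphicConnection E D}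
    {N : PartialConnection F E} (hA : A.Extends N) (hflat : A.IsFlat) (hD : A.HasPolarDivisor) :
    D.IsInvariant F := by
  intro U v f hf
  apply hD U
  intro V hV u s
  let f' : D.ideal.toOMod.sec V := D.ideal.toOMod.res hV ⟨f, hf⟩
  let v' : F.tan.sec V := F.tan.res hV v
  refine ⟨N.along v' (A.mulAlong f' u s) - A.mulAlong f' u (N.along v' s) -
    A.mulAlong f' (VField.bracket v'.1 u) s, ?_⟩
  apply LHom.ext; funext W hW; apply LinearMap.ext; intro k
  have := isFlat_iff.1 hflat W (D.ideal.toOMod.res hW f') k (F.tan.res hW v').1 (u.restrict hW)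
    (E.res hW s)
  rw [hA.curvature] at this
  have e := A.mulAlong_comm (D.ideal.toOMod.res hW f') k (u.restrict hW)
    (N.along (F.tan.res hW v') (E.res hW s))
  rw [e] at this
  have e2 : 𝒪.res hW (𝒪.res hV (VField.act v.1 f)) =
      VField.act (F.tan.res hW v').1 (D.ideal.toOMod.res hW f').1 := by
    rw [VField.res_act, VField.res_act]
    rfl
  change 𝒪.res hW (𝒪.res hV (VField.act v.1 f)) • (A.along u s).app W hW k =
    (k.1 : 𝒪.sec W) • E.res hW (_ - _ - _)
  rw [A.app_along, e2, map_sub, map_sub, N.res_along, A.res_mulAlong, A.res_mulAlong,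
    A.res_mulAlong, N.res_along, smul_sub, smul_sub]
  rw [← sub_eq_zero, ← neg_eq_zero, ← this]
  abel

/-! ### The corollary for any structure sheaf with the two properties. -/

theorem exists_equiv_meromorphicSplitting (h𝒪 : 𝒪.DenseInjective) (hT : 𝒪.HasLocalFrames)
    (hF : F.IsCodimOne) (D : EffectiveDivisor 𝒪) :
    ∃ Ψ : MeromorphicExtension (bott F) D ≃ MeromorphicSplitting (bott F) D,
      (∀ A, Corresponds A.1 (Ψ A).1) ∧
      (∀ hD : D.IsInvariant F, ∃ Φ : TransverselyAffineStructure F D ≃ HorizontalSplitting F D hD,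
        ∀ A, (Φ A).1 = Ψ A.1) ∧
      (∀ A : TransverselyAffineStructure F D, A.1.1.HasPolarDivisor → D.IsInvariant F) :=
  ⟨extensionEquivSplitting h𝒪 hT hF D, fun A => corresponds_splitting h𝒪 hT hF A.2,
    fun hD => ⟨(extensionEquivSplitting h𝒪 hT hF D).subtypeEquiv fun A =>
      (isHorizontal_splitting_iff_isFlat h𝒪 hT hF hD A.2).symm, fun _ => rfl⟩,
    fun A h => isInvariant_of_hasPolarDivisor A.1.2 A.2 h⟩

end TransverseJets

namespace TransverseJets

/-! ### Local frames of derivations from a basis of open sets. -/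

section Frames
variable {X : Type} [TopologicalSpace X] {𝒪 : CAlgSheaf X}

theorem Derivation.sum_apply {A : Type*} [CommRing A] [Algebra ℂ A] {ι : Type*} (s : Finset ι)
    (d : ι → Derivation ℂ A A) (f : A) : (∑ k ∈ s, d k) f = ∑ k ∈ s, d k f :=
  map_sum (⟨⟨fun d : Derivation ℂ A A => d f, rfl⟩, fun _ _ => rfl⟩ : Derivation ℂ A A →+ A) d s

/-- A compatible family of derivations on a basis of open sets defines a vector field. -/
theorem exists_vfield_of_basis {V : Opens X} {ι : Type} (b : ι → Opens X) (hbV : ∀ i, b i ≤ V)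
    (hb : ∀ U ≤ V, ∀ x ∈ U, ∃ i, x ∈ b i ∧ b i ≤ U)
    (d : ∀ i, Derivation ℂ (𝒪.sec (b i)) (𝒪.sec (b i)))
    (hd : ∀ i j (h : b j ≤ b i) (f : 𝒪.sec (b i)), 𝒪.res h (d i f) = d j (𝒪.res h f)) :
    ∃ v : VField 𝒪 V, ∀ i, v.app (b i) (hbV i) = d i := by
  have ext_basis : ∀ (U : Opens X) (_ : U ≤ V) (s t : 𝒪.sec U),
      (∀ i (h : b i ≤ U), 𝒪.res h s = 𝒪.res h t) → s = t := by
    intro U hU s t h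
    apply 𝒪.eq_of_locally_eq
    intro x hx
    obtain ⟨i, hxi, hi⟩ := hb U hU x hx
    exact ⟨b i, hi, hxi, h i hi⟩
  have glue : ∀ (U : Opens X) (_ : U ≤ V) (f : 𝒪.sec U), ∃ t : 𝒪.sec U,
      ∀ i (h : b i ≤ U), 𝒪.res h t = d i (𝒪.res h f) := by
    intro U hU f
    obtain ⟨t, ht, -⟩ := 𝒪.existsUnique_glue (ι := {i // b i ≤ U}) U (fun i => b i.1)
      (fun i => i.2)
      (fun x hx => by
        obtain ⟨i, hxi, hi⟩ := hb U hU x hx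
        exact Opens.mem_iSup.2 ⟨⟨i, hi⟩, hxi⟩)
      (fun i => d i.1 (𝒪.res i.2 f))
      (fun i j => by
        apply ext_basis _ ((inf_le_left : b i.1 ⊓ b j.1 ≤ b i.1).trans (hbV _))
        intro k hk
        rw [𝒪.res_res, 𝒪.res_res, hd, hd, 𝒪.res_res, 𝒪.res_res])
    exact ⟨t, fun i h => ht ⟨i, h⟩⟩
  choose D hD using glue
  let v : VField 𝒪 V :=
    { app := fun U hU => Derivation.mk'
        { toFun := D U hU
          map_add' := fun f g => ext_basis U hU _ _ fun i h => by
            rw [map_add, hD, hD, hD, map_add, map_add]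
          map_smul' := fun c f => ext_basis U hU _ _ fun i h => by
            rw [RingHom.id_apply, map_smul, hD, hD, map_smul, Derivation.map_smul] }
        (fun f g => ext_basis U hU _ _ fun i h => by
          change 𝒪.res h (D U hU (f * g)) = 𝒪.res h (f * D U hU g + g * D U hU f)
          rw [map_add, map_mul, map_mul, hD, hD, hD, map_mul, Derivation.leibniz]
          rfl)
      nat := fun U W hU hW f => ext_basis W (hW.trans hU) _ _ fun i h => by
        change 𝒪.res h (𝒪.res hW (D U hU f)) = 𝒪.res h (D W _ (𝒪.res hW f))
        rw [𝒪.res_res, hD, hD, 𝒪.res_res] }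
  refine ⟨v, fun i => ?_⟩
  ext f
  have := hD (b i) (hbV i) f i le_rfl
  rwa [𝒪.res_self, 𝒪.res_self] at this

/-- The frame is dual to y: e_k(y_l) = δ_{kl}. Uniqueness is required for derivations along a
restriction map, because it must also show that the e_k on different basic sets are compatible. -/
theorem exists_frame_of_basis {V : Opens X} {n : ℕ} (y : Fin n → 𝒪.sec V) {ι : Type}
    (b : ι → Opens X) (hbV : ∀ i, b i ≤ V)
    (hb : ∀ U ≤ V, ∀ x ∈ U, ∃ i, x ∈ b i ∧ b i ≤ U)
    (hex : ∀ (i : ι) (a : Fin n → 𝒪.sec (b i)), ∃ d : Derivation ℂ (𝒪.sec (b i)) (𝒪.sec (b i)),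
      ∀ k, d (𝒪.res (hbV i) (y k)) = a k)
    (huniq : ∀ (i j : ι) (h : b j ≤ b i) (δ : 𝒪.sec (b i) →ₗ[ℂ] 𝒪.sec (b j)),
      (∀ f g, δ (f * g) = 𝒪.res h f * δ g + 𝒪.res h g * δ f) →
      (∀ k, δ (𝒪.res (hbV i) (y k)) = 0) → δ = 0) :
    ∃ e : Fin n → VField 𝒪 V, ∀ (W : Opens X) (hW : W ≤ V) (v : VField 𝒪 W),
      v = ∑ i, v.act (𝒪.res hW (y i)) • VField.restrict hW (e i) := by
  classical
  choose d hd using fun (k : Fin n) (i : ι) => hex i (Pi.single k 1)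
  have hnat : ∀ k i j (h : b j ≤ b i) (f : 𝒪.sec (b i)),
      𝒪.res h (d k i f) = d k j (𝒪.res h f) := by
    intro k i j h f
    -- The difference of restriction after `d k i` and `d k j` after restriction is a derivation
    -- along the restriction, and it kills every coordinate.
    have := huniq i j h ((𝒪.res h).toLinearMap ∘ₗ (d k i).toLinearMap -
      (d k j).toLinearMap ∘ₗ (𝒪.res h).toLinearMap)
      (fun f g => by
        change 𝒪.res h (d k i (f * g)) - d k j (𝒪.res h (f * g)) =
          𝒪.res h f * (𝒪.res h (d k i g) - d k j (𝒪.res h g)) +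
          𝒪.res h g * (𝒪.res h (d k i f) - d k j (𝒪.res h f))
        simp only [Derivation.leibniz, map_mul, map_add, smul_eq_mul]
        ring)
      (fun l => by
        change 𝒪.res h (d k i (𝒪.res (hbV i) (y l))) - d k j (𝒪.res h (𝒪.res (hbV i) (y l))) = 0
        rw [𝒪.res_res, hd, hd, sub_eq_zero]
        by_cases hkl : l = k
        · subst hkl; simp
        · simp [hkl])
    exact sub_eq_zero.1 (LinearMap.congr_fun this f)
  choose e he using fun k => exists_vfield_of_basis b hbV hb (d k) (hnat k)
  refine ⟨e, fun W hW v => ?_⟩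
  apply VField.ext
  funext U hU
  ext f
  apply 𝒪.eq_of_locally_eq
  intro x hx
  obtain ⟨i, hxi, hi⟩ := hb U (hU.trans hW) x hx
  refine ⟨b i, hi, hxi, ?_⟩
  rw [VField.res_app, VField.res_app]
  have key : ∀ g : 𝒪.sec (b i),
      (∑ k, v.act (𝒪.res hW (y k)) • VField.restrict hW (e k)).app (b i) (hi.trans hU) g =
      ∑ k, 𝒪.res (hi.trans hU) (v.act (𝒪.res hW (y k))) * d k i g := by
    intro g
    rw [VField.sum_app, Derivation.sum_apply]
    refine Finset.sum_congr rfl fun k _ => ?_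
    rw [VField.smul_app, Derivation.smul_apply, smul_eq_mul, ← he k i]
  rw [key]
  -- On a basic set, v - ∑ v(y_k)e_k is a derivation that kills every coordinate.
  have := huniq i i le_rfl ((v.app (b i) (hi.trans hU)).toLinearMap -
      (∑ k, 𝒪.res (hi.trans hU) (v.act (𝒪.res hW (y k))) • d k i).toLinearMap)
    (fun f g => by
      change (v.app (b i) (hi.trans hU) - ∑ k, 𝒪.res (hi.trans hU)
        (v.act (𝒪.res hW (y k))) • d k i) (f * g) = _
      rw [Derivation.leibniz, 𝒪.res_self, 𝒪.res_self]
      rfl)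
    (fun l => by
      change v.app (b i) (hi.trans hU) (𝒪.res (hbV i) (y l)) - (∑ k, 𝒪.res (hi.trans hU)
        (v.act (𝒪.res hW (y k))) • d k i) (𝒪.res (hbV i) (y l)) = 0
      rw [Derivation.sum_apply, Finset.sum_eq_single l]
      · rw [Derivation.smul_apply, hd, VField.res_act, Pi.single_eq_same, smul_eq_mul, mul_one,
          𝒪.res_res, sub_eq_zero]
      · intro k _ hk
        rw [Derivation.smul_apply, hd, Pi.single_eq_of_ne' hk, smul_zero]
      · simp)
  have h2 := LinearMap.congr_fun this (𝒪.res hi f)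
  have h3 : v.app (b i) (hi.trans hU) (𝒪.res hi f) - (∑ k, 𝒪.res (hi.trans hU)
        (v.act (𝒪.res hW (y k))) • d k i) (𝒪.res hi f) = 0 := h2
  rw [Derivation.sum_apply] at h3
  exact sub_eq_zero.1 h3

end Frames

/-! ### Étale algebras -/

open scoped TensorProduct in
-- Base change to the fraction field K gives an étale K-algebra, which is reduced. By flatness of S
-- over R, the injection of R into K induces an injection of S into this algebra.
theorem isReduced_of_etale (R S : Type) [CommRing R] [IsDomain R] [CommRing S] [Algebra R S]
    [Algebra.Etale R S] : IsReduced S := by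
  let K := FractionRing R
  have : IsReduced (K ⊗[R] S) := Algebra.FormallyUnramified.isReduced_of_field K (K ⊗[R] S)
  refine isReduced_of_injective (Algebra.TensorProduct.includeRight : S →ₐ[R] K ⊗[R] S) ?_
  exact Algebra.TensorProduct.includeRight_injective (IsFractionRing.injective R K)

/-- For a formally étale T over S the module of differentials of T is the base change of that of S,
so a linear form on the latter with values in T extends. -/
theorem exists_derivation_of_formallyEtale {R S T : Type} [CommRing R] [CommRing S] [CommRing T]
    [Algebra R S] [Algebra R T] [Algebra S T] [IsScalarTower R S T] [Algebra.FormallyEtale S T]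
    (d : Derivation R S T) : ∃ d' : Derivation R T T, ∀ s, d' (algebraMap S T s) = d s := by
  let e := KaehlerDifferential.tensorKaehlerEquivOfFormallyEtale R S T
  let l : Ω[T⁄R] →ₗ[T] T := d.liftKaehlerDifferential.liftBaseChange T ∘ₗ e.symm.toLinearMap
  refine ⟨l.compDer (KaehlerDifferential.D R T), fun s => ?_⟩
  change (d.liftKaehlerDifferential.liftBaseChange T) (e.symm (KaehlerDifferential.D R T _)) = _
  rw [KaehlerDifferential.tensorKaehlerEquivOfFormallyEtale_symm_D_algebraMap,
    LinearMap.liftBaseChange_tmul, one_smul, Derivation.liftKaehlerDifferential_comp_D]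

/-- A derivation along ρ that kills S is an S-derivation into T', seen as a T-module through ρ. It
factors through the differentials of T over S, which vanish. -/
theorem eq_zero_of_formallyUnramified {S T T' : Type} [CommRing S] [CommRing T] [CommRing T']
    [Algebra S T] [Algebra.FormallyUnramified S T] (ρ : T →+* T') (δ : T →+ T')
    (hδ : ∀ f g, δ (f * g) = ρ f * δ g + ρ g * δ f) (h0 : ∀ s, δ (algebraMap S T s) = 0) :
    δ = 0 := by
  let _ : Algebra T T' := ρ.toAlgebra
  let _ : Module S T' := Module.compHom T' (algebraMap S T)
  have : IsScalarTower S T T' := IsScalarTower.of_algebraMap_smul fun _ _ => rfl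
  let D : Derivation S T T' := Derivation.mk'
    { δ with
      map_smul' := fun s t => by
        change δ (s • t) = s • δ t
        rw [Algebra.smul_def, hδ, h0, mul_zero, add_zero]
        rfl }
    hδ
  have : D = 0 := by
    have h : D.liftKaehlerDifferential = 0 := LinearMap.ext fun x => by
      rw [Subsingleton.elim x 0, map_zero, map_zero]
    rw [← D.liftKaehlerDifferential_comp, h, LinearMap.compDer]
    ext; rfl
  ext t
  exact congrArg (fun D : Derivation S T T' => D t) this

end TransverseJets

namespace TransverseJets

/-! ### Smooth schemes -/

section Schemes
open AlgebraicGeometry CategoryTheory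
variable {Y : Scheme.{0}} {p : Y ⟶ Spec (CommRingCat.of ℂ)}

/-- A smooth morphism is locally standard smooth, and a standard smooth algebra is étale over a
polynomial ring. -/
theorem exists_etale_coordinates (p : Y ⟶ Spec (CommRingCat.of ℂ)) [Smooth p] (x : Y) :
    ∃ V : Y.Opens, IsAffineOpen V ∧ x ∈ V ∧ ∃ (n : ℕ) (g : MvPolynomial (Fin n) ℂ →+* Γ(Y, V)),
      g.comp MvPolynomial.C = schemeConst Y p V ∧ g.Etale := by
  obtain ⟨U, -, V, hV, hxV, e, hs⟩ := Smooth.exists_isStandardSmooth p x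
  -- The spectrum of ℂ is a single point.
  have hU : U = ⊤ := by
    rw [eq_top_iff]
    intro z _
    have : Subsingleton (Spec (CommRingCat.of ℂ)) :=
      inferInstanceAs (Subsingleton (PrimeSpectrum ℂ))
    rw [Subsingleton.elim z (p x)]
    exact e hxV
  subst hU
  refine ⟨V, hV, hxV, ?_⟩
  have h2 : (schemeConst Y p V).IsStandardSmooth := by
    have := RingHom.isStandardSmooth_respectsIso.2 (p.appLE ⊤ V e).hom
      (Scheme.ΓSpecIso (CommRingCat.of ℂ)).symm.commRingCatIsoToRingEquiv hs
    exact this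
  exact h2.exists_etale_mvPolynomial

theorem isReduced_of_smooth (p : Y ⟶ Spec (CommRingCat.of ℂ)) [Smooth p] :
    AlgebraicGeometry.IsReduced Y := by
  have : ∀ x : Y, _root_.IsReduced (Y.presheaf.stalk x) := fun x => by
    obtain ⟨V, hV, hxV, n, g, -, hg⟩ := exists_etale_coordinates p x
    algebraize [g]
    have := isReduced_of_etale (MvPolynomial (Fin n) ℂ) Γ(Y, V)
    let _ := Y.presheaf.algebra_section_stalk ⟨x, hxV⟩
    have := hV.isLocalization_stalk ⟨x, hxV⟩
    exact isReduced_localizationPreserves (hV.primeIdealOf ⟨x, hxV⟩).asIdeal.primeCompl _ ‹_›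
  exact isReduced_of_isReduced_stalk Y

/-- If f vanishes on the dense open set, the locus where f is invertible misses it and is therefore
empty; on a reduced scheme this forces f = 0. -/
theorem schemeSheaf_denseInjective [Smooth p] : (schemeSheaf Y p).DenseInjective := by
  intro U U₀ hU₀ f hf
  have := isReduced_of_smooth p
  have hf' : Y.presheaf.map (homOfLE (inf_le_left : U ⊓ U₀ ≤ U)).op f = 0 := hf
  have h := Scheme.basicOpen_res (X := Y) (f := f) (homOfLE (inf_le_left : U ⊓ U₀ ≤ U)).op
  rw [hf', Scheme.basicOpen_zero] at h
  refine (basicOpen_eq_bot_iff (X := Y) (U := U) f).1 ?_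
  rw [← Opens.not_nonempty_iff_eq_bot]
  intro hne
  obtain ⟨x, hx, hx0⟩ := hU₀.inter_open_nonempty _ (Y.basicOpen f).isOpen hne
  have : x ∈ (⊥ : Y.Opens) := by
    rw [h]
    exact ⟨⟨Y.basicOpen_le f hx, hx0⟩, hx⟩
  exact this

theorem schemeSheaf_hasLocalFrames [Smooth p] : (schemeSheaf Y p).HasLocalFrames := by
  intro x
  obtain ⟨V, hV, hxV, n, g, hgC, hg⟩ := exists_etale_coordinates p x
  refine ⟨V, hxV, n, fun k => g (MvPolynomial.X k), ?_⟩
  let R := MvPolynomial (Fin n) ℂ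
  have hbV : ∀ f : Γ(Y, V), Y.basicOpen f ≤ V := Y.basicOpen_le
  -- the étale coordinates on a basic open set
  let c : ∀ f : Γ(Y, V), R →ₐ[ℂ] (schemeSheaf Y p).sec (Y.basicOpen f) := fun f =>
    { RingHom.comp (β := (schemeSheaf Y p).sec V) ((schemeSheaf Y p).res (hbV f)).toRingHom g with
      commutes' := fun z => by
        have := congrArg (fun q => (schemeSheaf Y p).res (hbV f) (q z)) hgC
        exact this.trans (((schemeSheaf Y p).res (hbV f)).commutes z) }
  have hc : ∀ f, (c f).toRingHom.FormallyEtale := fun f => by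
    algebraize [g]
    let _ : Algebra Γ(Y, V) ((schemeSheaf Y p).sec (Y.basicOpen f)) :=
      (Y.presheaf.map (homOfLE (hbV f)).op).hom.toAlgebra
    have : IsLocalization.Away f ((schemeSheaf Y p).sec (Y.basicOpen f)) :=
      hV.isLocalization_basicOpen f
    have : Algebra.FormallyEtale Γ(Y, V) ((schemeSheaf Y p).sec (Y.basicOpen f)) :=
      Algebra.FormallyEtale.of_isLocalization (.powers f)
    let _ : Algebra R ((schemeSheaf Y p).sec (Y.basicOpen f)) := (c f).toRingHom.toAlgebra
    have : IsScalarTower R Γ(Y, V) ((schemeSheaf Y p).sec (Y.basicOpen f)) :=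
      IsScalarTower.of_algebraMap_eq fun _ => rfl
    -- Localizations are formally étale, so the coordinates on V remain formally étale on each basic
    -- open set.
    exact Algebra.FormallyEtale.comp R Γ(Y, V) _
  refine exists_frame_of_basis (𝒪 := schemeSheaf Y p) _ (fun f : Γ(Y, V) => Y.basicOpen f) hbV
    ?_ ?_ ?_
  · intro U hU z hz
    obtain ⟨f, hf, hzf⟩ := hV.exists_basicOpen_le ⟨z, hz⟩ (hU hz)
    exact ⟨f, hzf, hf⟩
  · intro f a
    let _ : Algebra R ((schemeSheaf Y p).sec (Y.basicOpen f)) := (c f).toRingHom.toAlgebra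
    have : IsScalarTower ℂ R ((schemeSheaf Y p).sec (Y.basicOpen f)) :=
      IsScalarTower.of_algebraMap_eq fun z => ((c f).commutes z).symm
    have : Algebra.FormallyEtale R ((schemeSheaf Y p).sec (Y.basicOpen f)) := hc f
    obtain ⟨d, hd⟩ := exists_derivation_of_formallyEtale (MvPolynomial.mkDerivation ℂ a)
    exact ⟨d, fun k => (hd (MvPolynomial.X k)).trans (MvPolynomial.mkDerivation_X ℂ a k)⟩
  · intro i j h δ hδ h0
    let _ : Algebra R ((schemeSheaf Y p).sec (Y.basicOpen i)) := (c i).toRingHom.toAlgebra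
    have : Algebra.FormallyEtale R ((schemeSheaf Y p).sec (Y.basicOpen i)) := hc i
    have h1 : δ 1 = 0 := by simpa using hδ 1 1
    -- A ℂ-linear derivation that kills the coordinates kills all polynomials in them.
    have := eq_zero_of_formallyUnramified (S := R) ((schemeSheaf Y p).res h).toRingHom
      δ.toAddMonoidHom hδ (fun s => by
        change δ (c i s) = 0
        induction s using MvPolynomial.induction_on with
        | C z =>
          have : c i (MvPolynomial.C z) = z • 1 :=
            ((c i).commutes z).trans (Algebra.algebraMap_eq_smul_one z)
          rw [this, map_smul, h1, smul_zero]
        | add s t hs ht => rw [map_add, map_add, hs, ht, add_zero]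
        | mul_X s k hs =>
          have : δ (c i (MvPolynomial.X k)) = 0 := h0 k
          rw [map_mul, hδ, hs, this, mul_zero, mul_zero, add_zero])
    exact LinearMap.ext fun s => DFunLike.congr_fun this s

end Schemes
end TransverseJets

namespace TransverseJets

/-! ### Complex manifolds -/

/-! ### Hadamard's lemma through shifted power series. -/

section Hadamard
variable {E : Type*} [NormedAddCommGroup E] [NormedSpace ℂ E]

open scoped Topology

theorem unshift_shift_eq (p : FormalMultilinearSeries ℂ E ℂ) (c : ℂ) (h : ∀ v, p 0 v = c) :
    p.shift.unshift c = p := by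
  ext1 m
  cases m with
  | zero =>
    ext v
    exact (h v).symm
  | succ m => exact (continuousMultilinearCurryRightEquiv' ℂ m E ℂ).symm_apply_apply (p (m + 1))

/-- Hadamard's lemma for analytic functions. -/
theorem exists_analyticAt_eq_add {F : E → ℂ} {a : E} (hF : AnalyticAt ℂ F a) :
    ∃ G : E → E →L[ℂ] ℂ, AnalyticAt ℂ G a ∧ ∀ᶠ z in 𝓝 a, F z = F a + G z (z - a) := by
  obtain ⟨p, r, hp⟩ := hF
  have hr : 0 < p.shift.radius := by
    rw [p.radius_shift]
    exact hp.r_pos.trans_le hp.r_le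
  have hq := (p.shift.hasFPowerSeriesOnBall hr).comp_sub a
  rw [zero_add] at hq
  -- G is the sum of the series of F with its constant term dropped and all degrees lowered by one.
  -- Unshifting represents F(a) + G(z)(z - a) by the original series, so it agrees with F on a
  -- common ball.
  have hu := hq.unshift (z := F a)
  rw [unshift_shift_eq p (F a) fun v => hp.coeff_zero v] at hu
  refine ⟨_, hq.analyticAt, ?_⟩
  have hmin : 0 < min r p.shift.radius := lt_min hp.r_pos hr
  filter_upwards [Metric.eball_mem_nhds a hmin] with z hz
  exact (hp.mono hmin (min_le_left _ _)).unique (hu.mono hmin (min_le_right _ _)) hz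

theorem analyticAt_clm_apply {G : E → E →L[ℂ] ℂ} {a : E} (hG : AnalyticAt ℂ G a) (w : E) :
    AnalyticAt ℂ (fun z => G z w) a :=
  ((ContinuousLinearMap.apply ℂ ℂ w).analyticAt _).comp hG

end Hadamard

/-! ### Coordinate vector fields and the frame of a chart. -/

section Manifolds
open scoped Manifold ContDiff Topology

theorem holomorphicSheaf_denseInjective (n : ℕ) (M : Type) [TopologicalSpace M]
    [ChartedSpace (EuclideanSpace ℂ (Fin n)) M] : (holomorphicSheaf n M).DenseInjective := by
  intro U U₀ hU₀ f hf
  have hd : Dense ((↑) ⁻¹' (U₀ : Set M) : Set U) := hU₀.preimage U.isOpenEmbedding'.isOpenMap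
  have := Continuous.ext_on hd f.contMDiff.continuous continuous_const
    (g := fun _ => (0 : ℂ))
    (fun q hq => congrArg (fun g : (holomorphicSheaf n M).sec (U ⊓ U₀) => g.1 ⟨q.1, q.2, hq⟩) hf)
  exact ContMDiffMap.ext fun q => congrFun this q

/-- Evaluation of holomorphic functions at a point. -/
def evalAt {n : ℕ} {M : Type} [TopologicalSpace M] [ChartedSpace (EuclideanSpace ℂ (Fin n)) M]
    {U : Opens M} (q : U) : (holomorphicSheaf n M).sec U →ₐ[ℂ] ℂ where
  toFun f := f.1 q
  map_one' := rfl
  map_mul' _ _ := rfl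
  map_zero' := rfl
  map_add' _ _ := rfl
  commutes' _ := rfl

variable {n : ℕ} {M : Type} [TopologicalSpace M] [ChartedSpace (EuclideanSpace ℂ (Fin n)) M]
  (φ : OpenPartialHomeomorph M (EuclideanSpace ℂ (Fin n)))

open Classical in
/-- The expression of a holomorphic function in a chart, extended by zero. -/
noncomputable def chartExpr {U : Opens M} (f : (holomorphicSheaf n M).sec U) :
    EuclideanSpace ℂ (Fin n) → ℂ :=
  fun z => if h : φ.symm z ∈ U then f.1 ⟨φ.symm z, h⟩ else 0

theorem chartExpr_of_mem {U : Opens M} (f : (holomorphicSheaf n M).sec U)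
    {z : EuclideanSpace ℂ (Fin n)} (h : φ.symm z ∈ U) :
    chartExpr φ f z = f.1 ⟨φ.symm z, h⟩ := dif_pos h

theorem chartExpr_apply {U : Opens M} (f : (holomorphicSheaf n M).sec U) {q : M} (hq : q ∈ U)
    (hφ : q ∈ φ.source) : chartExpr φ f (φ q) = f.1 ⟨q, hq⟩ := by
  have h : φ.symm (φ q) = q := φ.left_inv hφ
  rw [chartExpr_of_mem φ f (h.symm ▸ hq)]
  exact congrArg f.1 (Subtype.ext h)

theorem chartExpr_add {U : Opens M} (f g : (holomorphicSheaf n M).sec U) :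
    chartExpr φ (f + g) = chartExpr φ f + chartExpr φ g := by
  funext z
  by_cases h : φ.symm z ∈ U
  · rw [Pi.add_apply, chartExpr_of_mem φ _ h, chartExpr_of_mem φ _ h, chartExpr_of_mem φ _ h]
    rfl
  · simp [chartExpr, h]

theorem chartExpr_mul {U : Opens M} (f g : (holomorphicSheaf n M).sec U) :
    chartExpr φ (f * g) = chartExpr φ f * chartExpr φ g := by
  funext z
  by_cases h : φ.symm z ∈ U
  · rw [Pi.mul_apply, chartExpr_of_mem φ _ h, chartExpr_of_mem φ _ h, chartExpr_of_mem φ _ h]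
    rfl
  · simp [chartExpr, h]

theorem chartExpr_smul {U : Opens M} (c : ℂ) (f : (holomorphicSheaf n M).sec U) :
    chartExpr φ (c • f) = c • chartExpr φ f := by
  funext z
  by_cases h : φ.symm z ∈ U
  · rw [Pi.smul_apply, chartExpr_of_mem φ _ h, chartExpr_of_mem φ _ h]
    rfl
  · simp [chartExpr, h]

omit [ChartedSpace (EuclideanSpace ℂ (Fin n)) M] in
theorem eventually_symm_mem {U : Opens M} {q : M} (hq : q ∈ U) (hφ : q ∈ φ.source) :
    ∀ᶠ z in 𝓝 (φ q), φ.symm z ∈ U := by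
  have h := φ.continuousAt_symm (φ.map_source hφ)
  apply h.eventually_mem
  rw [φ.left_inv hφ]
  exact U.isOpen.mem_nhds hq

/-- The extension by zero depends on the domain, so only germs of chart expressions are compatible
with restriction. Germs are enough for derivatives. -/
theorem chartExpr_res {U W : Opens M} (h : W ≤ U) (f : (holomorphicSheaf n M).sec U) {q : M}
    (hq : q ∈ W) (hφ : q ∈ φ.source) :
    chartExpr φ ((holomorphicSheaf n M).res h f) =ᶠ[𝓝 (φ q)] chartExpr φ f := by
  filter_upwards [eventually_symm_mem φ hq hφ] with z hz
  rw [chartExpr_of_mem φ _ hz, chartExpr_of_mem φ _ (h hz)]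
  rfl

variable {φ} (hφA : φ ∈ IsManifold.maximalAtlas 𝓘(ℂ, EuclideanSpace ℂ (Fin n)) ω M)

include hφA

theorem analyticAt_chartExpr {U : Opens M} (f : (holomorphicSheaf n M).sec U) {q : M}
    (hq : q ∈ U) (hφ : q ∈ φ.source) : AnalyticAt ℂ (chartExpr φ f) (φ q) := by
  classical
  let T : M → ℂ := fun y => if h : y ∈ U then f.1 ⟨y, h⟩ else 0
  have hT : ContMDiffAt 𝓘(ℂ, EuclideanSpace ℂ (Fin n)) 𝓘(ℂ, ℂ) ω T q := by
    refine (contMDiffAt_subtype_iff (U := U) (x := ⟨q, hq⟩)).1 ?_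
    have : (fun y : U => T y.1) = f.1 := by
      funext y
      exact dif_pos y.2
    rw [this]
    exact f.2 _
  rw [← φ.left_inv hφ] at hT
  have := hT.comp (φ q) (contMDiffAt_symm_of_mem_maximalAtlas hφA (φ.map_source hφ))
  exact (contMDiffAt_iff_contDiffAt.1 this).analyticAt

/-- The holomorphic function with a given analytic expression in a chart. -/
@[reducible] noncomputable def holomorphicOfChart (G : EuclideanSpace ℂ (Fin n) → ℂ) {U : Opens M}
    (hU : ∀ q ∈ U, q ∈ φ.source) (hG : ∀ q ∈ U, AnalyticAt ℂ G (φ q)) :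
    (holomorphicSheaf n M).sec U :=
  ⟨fun q => G (φ q.1), fun q => contMDiffAt_subtype_iff.2
    ((contMDiffAt_iff_contDiffAt.2 (hG q.1 q.2).contDiffAt).comp q.1
      (contMDiffAt_of_mem_maximalAtlas hφA (hU q.1 q.2)))⟩

omit hφA in
theorem chartExpr_eventuallyEq {U : Opens M} (f : (holomorphicSheaf n M).sec U)
    (G : EuclideanSpace ℂ (Fin n) → ℂ) (hU : ∀ q ∈ U, q ∈ φ.source)
    (h : ∀ q : U, f.1 q = G (φ q.1)) {q : M} (hq : q ∈ U) :
    chartExpr φ f =ᶠ[𝓝 (φ q)] G := by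
  filter_upwards [eventually_symm_mem φ hq (hU q hq),
    φ.open_target.mem_nhds (φ.map_source (hU q hq))] with z hz hzt
  rw [chartExpr_of_mem φ _ hz, h, φ.right_inv hzt]

/-- The coordinate vector fields of a chart. -/
noncomputable def coordinateField (w : EuclideanSpace ℂ (Fin n)) :
    VField (holomorphicSheaf n M) ⟨φ.source, φ.open_source⟩ where
  app U hU := Derivation.mk'
    { toFun := fun f => holomorphicOfChart hφA (fun z => fderiv ℂ (chartExpr φ f) z w) hU
        fun q hq => analyticAt_clm_apply (analyticAt_chartExpr hφA f hq (hU hq)).fderiv w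
      map_add' := fun f g => ContMDiffMap.ext fun q => by
        change fderiv ℂ (chartExpr φ (f + g)) (φ q.1) w = fderiv ℂ (chartExpr φ f) (φ q.1) w +
          fderiv ℂ (chartExpr φ g) (φ q.1) w
        rw [chartExpr_add, fderiv_add
          (analyticAt_chartExpr hφA f q.2 (hU q.2)).differentiableAt
          (analyticAt_chartExpr hφA g q.2 (hU q.2)).differentiableAt]
        rfl
      map_smul' := fun c f => ContMDiffMap.ext fun q => by
        change fderiv ℂ (chartExpr φ (c • f)) (φ q.1) w = c • fderiv ℂ (chartExpr φ f) (φ q.1) w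
        rw [chartExpr_smul, fderiv_const_smul
          (analyticAt_chartExpr hφA f q.2 (hU q.2)).differentiableAt]
        rfl }
    (fun f g => ContMDiffMap.ext fun q => by
      change fderiv ℂ (chartExpr φ (f * g)) (φ q.1) w =
        f.1 q * fderiv ℂ (chartExpr φ g) (φ q.1) w + g.1 q * fderiv ℂ (chartExpr φ f) (φ q.1) w
      rw [chartExpr_mul, fderiv_mul
        (analyticAt_chartExpr hφA f q.2 (hU q.2)).differentiableAt
        (analyticAt_chartExpr hφA g q.2 (hU q.2)).differentiableAt,
        chartExpr_apply φ f q.2 (hU q.2), chartExpr_apply φ g q.2 (hU q.2)]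
      rfl)
  nat U W hU hW f := ContMDiffMap.ext fun q => by
    change fderiv ℂ (chartExpr φ f) (φ q.1) w =
      fderiv ℂ (chartExpr φ ((holomorphicSheaf n M).res hW f)) (φ q.1) w
    rw [(chartExpr_res φ hW f q.2 (hU (hW q.2))).fderiv_eq]

/-- The coordinate functions of a chart. -/
noncomputable def coordinate (k : Fin n) :
    (holomorphicSheaf n M).sec ⟨φ.source, φ.open_source⟩ :=
  holomorphicOfChart hφA (fun z => z k) (fun _ h => h)
    fun q _ => (EuclideanSpace.proj (𝕜 := ℂ) k).analyticAt (φ q)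

theorem coordinateField_coordinate (W : Opens M) (hW : W ≤ ⟨φ.source, φ.open_source⟩)
    (k l : Fin n) :
    (coordinateField hφA (EuclideanSpace.single k 1)).app W hW
      ((holomorphicSheaf n M).res hW (coordinate hφA l)) = Pi.single (M := fun _ => _) k 1 l := by
  refine ContMDiffMap.ext fun q => ?_
  change fderiv ℂ (chartExpr φ ((holomorphicSheaf n M).res hW (coordinate hφA l))) (φ q.1)
    (EuclideanSpace.single k 1) = _
  rw [(chartExpr_eventuallyEq _ (EuclideanSpace.proj (𝕜 := ℂ) l) hW (fun _ => rfl)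
    q.2).fderiv_eq, ContinuousLinearMap.fderiv]
  change (EuclideanSpace.single k (1 : ℂ)) l = _
  by_cases h : l = k
  · subst h
    simp
    rfl
  · simp [h]
    rfl

/-- A holomorphic vector field that kills the coordinates of a chart vanishes. -/
theorem vfield_eq_zero {W : Opens M} (hW : W ≤ ⟨φ.source, φ.open_source⟩)
    (v : VField (holomorphicSheaf n M) W)
    (hv : ∀ k, v.act ((holomorphicSheaf n M).res hW (coordinate hφA k)) = 0) : v = 0 := by
  let 𝒪 := holomorphicSheaf n M
  apply VField.ext
  funext U hU
  ext f
  change v.app U hU f = 0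
  refine ContMDiffMap.ext fun q => ?_
  have hqφ : q.1 ∈ φ.source := hW (hU q.2)
  -- Near q, f = f(q) + ∑ (y_k - y_k(q)) g_k. A derivation that kills constants and the y_k sends
  -- this to ∑ (y_k - y_k(q)) v(g_k), which vanishes at q.
  obtain ⟨G, hG, hFG⟩ := exists_analyticAt_eq_add (analyticAt_chartExpr hφA f q.2 hqφ)
  have hev := (φ.continuousAt hqφ).eventually (hFG.and hG.eventually_analyticAt)
  obtain ⟨N, hN, hNo, hqN⟩ := eventually_nhds_iff.1 (hev.and (U.isOpen.mem_nhds q.2))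
  let U' : Opens M := ⟨N, hNo⟩
  have hU' : U' ≤ U := fun z hz => (hN z hz).2
  have hs : ∀ z ∈ U', z ∈ φ.source := fun z hz => hW (hU (hU' hz))
  let y : Fin n → 𝒪.sec U' := fun k => 𝒪.res hs (coordinate hφA k)
  let g : Fin n → 𝒪.sec U' := fun k =>
    holomorphicOfChart hφA (fun z => G z (EuclideanSpace.single k 1)) hs
      fun z hz => analyticAt_clm_apply (hN z hz).1.2 _
  let c : Fin n → ℂ := fun k => (φ q.1) k
  have hf : 𝒪.res hU' f = algebraMap ℂ (𝒪.sec U') (f.1 q) +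
      ∑ k, (y k - algebraMap ℂ (𝒪.sec U') (c k)) * g k := by
    refine ContMDiffMap.ext fun z => ?_
    change f.1 ⟨z.1, hU' z.2⟩ = evalAt z (algebraMap ℂ (𝒪.sec U') (f.1 q) +
      ∑ k, (y k - algebraMap ℂ (𝒪.sec U') (c k)) * g k)
    have h := (hN z.1 z.2).1.1
    rw [chartExpr_apply φ f (hU' z.2) (hs _ z.2), chartExpr_apply φ f q.2 hqφ] at h
    rw [h, map_add, AlgHom.commutes, map_sum]
    change _ = f.1 q + _
    congr 1
    -- Expanding φ(z) - φ(q) in the standard basis turns G(z)(φ(z) - φ(q)) into the sum over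
    -- coordinates.
    conv_lhs => rw [← (EuclideanSpace.basisFun (Fin n) ℂ).sum_repr (φ z.1 - φ q.1), map_sum]
    refine Finset.sum_congr rfl fun k _ => ?_
    rw [map_smul, map_mul, map_sub (evalAt z), AlgHom.commutes, EuclideanSpace.basisFun_apply]
    rfl
  have h2 : 𝒪.res hU' (v.app U hU f) = ∑ k, (y k - algebraMap ℂ (𝒪.sec U') (c k)) *
      v.app U' (hU'.trans hU) (g k) := by
    rw [VField.res_app, hf, map_add, Derivation.map_algebraMap, zero_add, map_sum]
    refine Finset.sum_congr rfl fun k _ => ?_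
    have hy : v.app U' (hU'.trans hU) (y k) = 0 := by
      have h := VField.res_act (hU'.trans hU) v (𝒪.res hW (coordinate hφA k))
      rw [hv, map_zero] at h
      exact h.symm
    rw [Derivation.leibniz, map_sub, hy, Derivation.map_algebraMap, sub_zero, smul_zero, add_zero,
      smul_eq_mul]
  have h3 := congrArg (evalAt (⟨q.1, hqN⟩ : U')) h2
  rw [map_sum, Finset.sum_eq_zero] at h3
  · exact h3
  · intro k _
    rw [map_mul, map_sub, AlgHom.commutes]
    exact mul_eq_zero_of_left (sub_self (c k)) _

omit hφA in
-- The difference v - ∑ v(y_k)∂_k kills the coordinates of the chart, hence vanishes by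
-- `vfield_eq_zero`.
theorem holomorphicSheaf_hasLocalFrames (n : ℕ) (M : Type) [TopologicalSpace M]
    [ChartedSpace (EuclideanSpace ℂ (Fin n)) M]
    [IsManifold 𝓘(ℂ, EuclideanSpace ℂ (Fin n)) ω M] : (holomorphicSheaf n M).HasLocalFrames := by
  intro x
  have hφA : chartAt (EuclideanSpace ℂ (Fin n)) x ∈
    IsManifold.maximalAtlas 𝓘(ℂ, EuclideanSpace ℂ (Fin n)) ω M :=
    IsManifold.chart_mem_maximalAtlas x
  refine ⟨⟨_, (chartAt (EuclideanSpace ℂ (Fin n)) x).open_source⟩, mem_chart_source _ x, n,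
    coordinate hφA, fun k => coordinateField hφA (EuclideanSpace.single k 1), fun W hW v => ?_⟩
  rw [← sub_eq_zero]
  refine vfield_eq_zero hφA hW _ fun l => ?_
  rw [sub_eq_add_neg, VField.act_add]
  change _ + -(VField.app _ W le_rfl _) = 0
  rw [VField.sum_app, Derivation.sum_apply, Finset.sum_eq_single l, ← sub_eq_add_neg, sub_eq_zero]
  · rw [VField.smul_app, Derivation.smul_apply]
    change _ = _ • (coordinateField hφA (EuclideanSpace.single l 1)).app W _ _
    rw [coordinateField_coordinate, Pi.single_eq_same, smul_eq_mul, mul_one, CAlgSheaf.res_self]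
  · intro k _ hk
    rw [VField.smul_app, Derivation.smul_apply]
    change _ • (coordinateField hφA (EuclideanSpace.single k 1)).app W _ _ = _
    rw [coordinateField_coordinate, Pi.single_eq_of_ne' hk, smul_zero]
  · simp

end Manifolds
end TransverseJets

/-! ### Conclusion for smooth complex varieties. -/

namespace TransverseJets

theorem IsSmoothComplexVariety.denseInjective_and_hasLocalFrames {X : Type} [TopologicalSpace X]
    {𝒪 : CAlgSheaf X} (hX : IsSmoothComplexVariety 𝒪) : 𝒪.DenseInjective ∧ 𝒪.HasLocalFrames := by
  cases hX with
  | analytic n => exact ⟨holomorphicSheaf_denseInjective n _, holomorphicSheaf_hasLocalFrames n _⟩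
  | algebraic Y p => exact ⟨schemeSheaf_denseInjective, schemeSheaf_hasLocalFrames⟩

end TransverseJets

theorem corollaryB {X : Type} [TopologicalSpace X] (𝒪 : TransverseJets.CAlgSheaf X)
    (hX : TransverseJets.IsSmoothComplexVariety 𝒪)
    (F : TransverseJets.Foliation 𝒪) (hF : F.IsCodimOne)
    (D : TransverseJets.EffectiveDivisor 𝒪) :
    ∃ Ψ : TransverseJets.MeromorphicExtension (TransverseJets.bott F) D ≃
        TransverseJets.MeromorphicSplitting (TransverseJets.bott F) D,
      (∀ A, TransverseJets.Corresponds A.1 (Ψ A).1) ∧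
      (∀ hD : D.IsInvariant F,
        ∃ Φ : TransverseJets.TransverselyAffineStructure F D ≃
            TransverseJets.HorizontalSplitting F D hD,
          ∀ A, (Φ A).1 = Ψ A.1) ∧
      (∀ A : TransverseJets.TransverselyAffineStructure F D,
        A.1.1.HasPolarDivisor → D.IsInvariant F) := by
  obtain ⟨h𝒪, hT⟩ := hX.denseInjective_and_hasLocalFrames
  exact TransverseJets.exists_equiv_meromorphicSplitting h𝒪 hT hF D
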